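/- Let $M_3$ be a smooth 6-manifold (non-empty) with a smooth global coframe $e^1,\dots,e^6$ satisfying $de^1=de^2=de^3=de^4=0$, $de^5=e^{12}$, $de^6=e^{15}+e^{34}$, where $e^{ij}=e^i\wedge e^j$; for example, a nilmanifold $\Gamma\backslash G$ with $G$ the simply connected 3-step nilpotent Lie group with these structure equations and $e^i$ induced by left-invariant forms. Let $g=\sum_i e^i\otimes e^i$ and let $\nabla$ be its Levi-Civita connection. Let $\mathcal Z$ be the set of $g$-orthogonal almost complex structures $J$ on $M_3$ that have constant coefficients relative to $(e^i)$ and induce the orientation $e^1\wedge\dots\wedge e^6$; each $J$ is labelled by its fundamental form $\omega(X,Y)=g(JX,Y)$. Let $\mathcal W_1\oplus\mathcal W_2\oplus\mathcal W_3\oplus\mathcal W_4$ be the Gray--Hervella decomposition of the space of tensors with the symmetries of $\nabla\omega$, and put $\mathcal Z_{ijk}=\{\omega\in\mathcal Z:\nabla\omega\in\mathcal W_i\oplus\mathcal W_j\oplus\mathcal W_k \text{ at every point}\}$. For a form $\sigma=u\wedge v$ with $u,v$ orthonormal constant-coefficient 1-forms, let $\mathbb E(\sigma)=\{\sigma+\tau\in\mathcal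 Z:\tau\in\Lambda^2\langle u,v\rangle^\perp\}$. Let $\omega_0=e^{12}+e^{34}+e^{56}$, $\omega_1=e^{12}-e^{34}-e^{56}$, $\omega_2=-e^{12}+e^{34}-e^{56}$, $\omega_3=-e^{12}-e^{34}+e^{56}$; let $\mathcal E_{02}=\mathbb E(e^{34})$, $\mathcal E_{13}=\mathbb E(-e^{34})$, $\mathcal E_{03}=\mathbb E(e^{56})$, $\mathcal E_{12}=\mathbb E(-e^{56})$ (so that $\omega_i,\omega_j\in\mathcal E_{ij}$), and let $\mathcal S_{ij}=\{\omega\in\mathcal E_{ij}:g(\omega,\omega_i)=g(\omega,\omega_j)\}$. Finally let $\varpi_1=-e^{15}-e^{26}-e^{34}$ and $\varpi_2=e^{15}-e^{26}+e^{34}$. Then $$\mathcal Z_{234}\supseteq \mathcal E_{02}\cup\mathcal E_{13}\cup\mathbb E(e^{15})\cup\mathbb E(-e^{15}),\qquad \mathcal Z_{134}=\emptyset,$$ $$\mathcal Z_{124}=\{\varpi_1,\varpi_2\},\qquad \mathcal Z_{123}\supseteq \mathcal S_{03}\cup\mathcal S_{12}\cup\mathbb E(e^{26}),$$ and moreover $\varpi_1\in\mathcal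 S_{13}$ and $\varpi_2\in\mathcal S_{02}$. -/

import Mathlib

open scoped Manifold ContDiff Matrix
open Bundle

noncomputable section

namespace GrayHervella

/-! ### The Gray–Hervella decomposition of the space of tensors of the type of `∇ω` -/

section Decomposition

variable {V : Type*} [NormedAddCommGroup V] [InnerProductSpace ℝ V]

/-- The tensors `α(x, y, z)` with the symmetries of `∇ω` relative to an orthogonal almost complex
structure `J`: skew in the last two arguments, and `α(x, Jy, Jz) = -α(x, y, z)`. -/
def W (J : V →ₗ[ℝ] V) : Submodule ℝ (V →ₗ[ℝ] V →ₗ[ℝ] V →ₗ[ℝ] ℝ) where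
  carrier := {α | (∀ x y z, α x z y = -α x y z) ∧ ∀ x y z, α x (J y) (J z) = -α x y z}
  zero_mem' := by simp
  add_mem' := by
    rintro α β ⟨h₁, h₂⟩ ⟨h₃, h₄⟩
    refine ⟨fun x y z => ?_, fun x y z => ?_⟩
    · simp only [LinearMap.add_apply, h₁ x y z, h₃ x y z]; ring
    · simp only [LinearMap.add_apply, h₂ x y z, h₄ x y z]; ring
  smul_mem' := by
    rintro c α ⟨h₁, h₂⟩
    refine ⟨fun x y z => ?_, fun x y z => ?_⟩
    · simp only [LinearMap.smul_apply, smul_eq_mul, h₁ x y z]; ring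
    · simp only [LinearMap.smul_apply, smul_eq_mul, h₂ x y z]; ring

/-- The component `W₁`: tensors with `α(x, x, z) = 0`. -/
def W₁ (J : V →ₗ[ℝ] V) : Submodule ℝ (V →ₗ[ℝ] V →ₗ[ℝ] V →ₗ[ℝ] ℝ) :=
  W J ⊓
    { carrier := {α | ∀ x z, α x x z = 0}
      zero_mem' := by simp
      add_mem' := by
        intro α β h₁ h₂ x z
        simp only [LinearMap.add_apply, h₁ x z, h₂ x z, add_zero]
      smul_mem' := by
        intro c α h x z
        simp only [LinearMap.smul_apply, smul_eq_mul, h x z, mul_zero] }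

/-- The component `W₂`: tensors whose cyclic sum vanishes. -/
def W₂ (J : V →ₗ[ℝ] V) : Submodule ℝ (V →ₗ[ℝ] V →ₗ[ℝ] V →ₗ[ℝ] ℝ) :=
  W J ⊓
    { carrier := {α | ∀ x y z, α x y z + α y z x + α z x y = 0}
      zero_mem' := by simp
      add_mem' := by
        intro α β h₁ h₂ x y z
        have h₁' := h₁ x y z
        have h₂' := h₂ x y z
        simp only [LinearMap.add_apply]
        linarith
      smul_mem' := by
        intro c α h x y z
        simp only [LinearMap.smul_apply, smul_eq_mul, ← mul_add, h x y z, mul_zero] }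

variable [FiniteDimensional ℝ V]

/-- The contraction `z ↦ ∑ᵢ α(uᵢ, uᵢ, z)` over an orthonormal basis `(uᵢ)`. -/
def contraction : (V →ₗ[ℝ] V →ₗ[ℝ] V →ₗ[ℝ] ℝ) →ₗ[ℝ] V →ₗ[ℝ] ℝ where
  toFun α := ∑ i, α (stdOrthonormalBasis ℝ V i) (stdOrthonormalBasis ℝ V i)
  map_add' α β := by simp [Finset.sum_add_distrib]
  map_smul' c α := by simp [Finset.smul_sum]

/-- The component `W₃`: tensors with `α(Jx, Jy, z) = α(x, y, z)` and zero contraction. -/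
def W₃ (J : V →ₗ[ℝ] V) : Submodule ℝ (V →ₗ[ℝ] V →ₗ[ℝ] V →ₗ[ℝ] ℝ) :=
  W J ⊓
    { carrier := {α | (∀ x y z, α (J x) (J y) z = α x y z) ∧ contraction α = 0}
      zero_mem' := by simp
      add_mem' := by
        rintro α β ⟨h₁, h₂⟩ ⟨h₃, h₄⟩
        refine ⟨fun x y z => ?_, by simp [h₂, h₄]⟩
        simp only [LinearMap.add_apply, h₁ x y z, h₃ x y z]
      smul_mem' := by
        rintro c α ⟨h₁, h₂⟩
        refine ⟨fun x y z => ?_, by simp [h₂]⟩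
        simp only [LinearMap.smul_apply, h₁ x y z] }

/-- The component `W₄`: tensors determined by their contraction `θ`, through
`2(n-1) α(x, y, z) = ⟨x, y⟩ θ(z) - ⟨x, z⟩ θ(y) - ⟨x, Jy⟩ θ(Jz) + ⟨x, Jz⟩ θ(Jy)`,
where `2n` is the dimension of `V`. -/
def W₄ (J : V →ₗ[ℝ] V) : Submodule ℝ (V →ₗ[ℝ] V →ₗ[ℝ] V →ₗ[ℝ] ℝ) :=
  W J ⊓
    { carrier := {α | ∀ x y z, ((Module.finrank ℝ V : ℝ) - 2) * α x y z =
          inner ℝ x y * contraction α z - inner ℝ x z * contraction α y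
          - inner ℝ x (J y) * contraction α (J z) + inner ℝ x (J z) * contraction α (J y)}
      zero_mem' := by simp
      add_mem' := by
        intro α β h₁ h₂ x y z
        have h₁' := h₁ x y z
        have h₂' := h₂ x y z
        simp only [LinearMap.add_apply, map_add]
        linear_combination h₁' + h₂'
      smul_mem' := by
        intro c α h x y z
        have h' := h x y z
        simp only [LinearMap.smul_apply, map_smul, smul_eq_mul]
        linear_combination c * h' }

/-- The four components, labelled by `1, 2, 3, 4`. -/
def component (J : V →ₗ[ℝ] V) : ℕ → Submodule ℝ (V →ₗ[ℝ] V →ₗ[ℝ] V →ₗ[ℝ] ℝ)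
  | 1 => W₁ J
  | 2 => W₂ J
  | 3 => W₃ J
  | 4 => W₄ J
  | _ => ⊥

end Decomposition

/-! ### Invariant forms, given by their constant coefficients relative to the coframe `e¹, …, e⁶` -/

/-- The invariant `1`-form `eⁱ`, for `1 ≤ i ≤ 6`, as a vector of coefficients. -/
def eForm (i : ℕ) : Fin 6 → ℝ := fun k => if (k : ℕ) + 1 = i then 1 else 0

/-- The wedge product of two invariant `1`-forms. A `2`-form `σ` is recorded by the skew matrix of
its values `σ(Eᵢ, Eⱼ)` on the dual frame. -/
def wedge (u v : Fin 6 → ℝ) : Matrix (Fin 6) (Fin 6) ℝ :=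
  Matrix.of fun i j => u i * v j - u j * v i

/-- The invariant `2`-form `e^{ij} = eⁱ ∧ eʲ`. -/
def eForm₂ (i j : ℕ) : Matrix (Fin 6) (Fin 6) ℝ := wedge (eForm i) (eForm j)

/-- The inner product on invariant `2`-forms for which the `e^{ij}`, `i < j`, are orthonormal. -/
def formInner (σ τ : Matrix (Fin 6) (Fin 6) ℝ) : ℝ := (1 / 2) * ∑ i, ∑ j, σ i j * τ i j

/-- The value of `½ A ∧ A` on the four frame vectors with indices `i, j, k, l`. -/
def halfSquare (A : Matrix (Fin 6) (Fin 6) ℝ) (i j k l : Fin 6) : ℝ :=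
  A i j * A k l - A i k * A j l + A i l * A j k

/-- The Pfaffian of the `2`-form `A`: the coefficient `p` in `A ∧ A ∧ A = 6 p e^{123456}`. -/
def pfaffian (A : Matrix (Fin 6) (Fin 6) ℝ) : ℝ :=
  A 0 1 * halfSquare A 2 3 4 5 - A 0 2 * halfSquare A 1 3 4 5 + A 0 3 * halfSquare A 1 2 4 5
    - A 0 4 * halfSquare A 1 2 3 5 + A 0 5 * halfSquare A 1 2 3 4

/-- The space `𝒵` of invariant orthogonal almost complex structures `J` inducing the orientation
`e^{123456}`, each labelled by its fundamental form
`A(X, Y) = g(JX, Y)`. -/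
def Z : Set (Matrix (Fin 6) (Fin 6) ℝ) := {A | Aᵀ = -A ∧ A * A = -1 ∧ 0 < pfaffian A}

/-- The generalized edge `𝔼(u ∧ v)` for orthonormal `1`-forms `u, v`: all `u ∧ v + τ` in `𝒵`
with `τ` a `2`-form on the orthogonal complement of `⟨u, v⟩`. -/
def genEdge (u v : Fin 6 → ℝ) : Set (Matrix (Fin 6) (Fin 6) ℝ) :=
  {A | A ∈ Z ∧ (A - wedge u v) *ᵥ u = 0 ∧ (A - wedge u v) *ᵥ v = 0}

/-- The vertex `ω₀`. -/
def ω₀ : Matrix (Fin 6) (Fin 6) ℝ := eForm₂ 1 2 + eForm₂ 3 4 + eForm₂ 5 6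

/-- The vertex `ω₁`. -/
def ω₁ : Matrix (Fin 6) (Fin 6) ℝ := eForm₂ 1 2 - eForm₂ 3 4 - eForm₂ 5 6

/-- The vertex `ω₂`. -/
def ω₂ : Matrix (Fin 6) (Fin 6) ℝ := -eForm₂ 1 2 + eForm₂ 3 4 - eForm₂ 5 6

/-- The vertex `ω₃`. -/
def ω₃ : Matrix (Fin 6) (Fin 6) ℝ := -eForm₂ 1 2 - eForm₂ 3 4 + eForm₂ 5 6

/-- The edge `𝓔₀₂ = 𝔼(e^{34})` through `ω₀` and `ω₂`. -/
def edge₀₂ : Set (Matrix (Fin 6) (Fin 6) ℝ) := genEdge (eForm 3) (eForm 4)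

/-- The edge `𝓔₁₃ = 𝔼(-e^{34})` through `ω₁` and `ω₃`. -/
def edge₁₃ : Set (Matrix (Fin 6) (Fin 6) ℝ) := genEdge (-eForm 3) (eForm 4)

/-- The edge `𝓔₀₃ = 𝔼(e^{56})` through `ω₀` and `ω₃`. -/
def edge₀₃ : Set (Matrix (Fin 6) (Fin 6) ℝ) := genEdge (eForm 5) (eForm 6)

/-- The edge `𝓔₁₂ = 𝔼(-e^{56})` through `ω₁` and `ω₂`. -/
def edge₁₂ : Set (Matrix (Fin 6) (Fin 6) ℝ) := genEdge (-eForm 5) (eForm 6)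

/-- The equatorial circle of an edge `S` relative to two vertices `p, q` on it. -/
def equator (S : Set (Matrix (Fin 6) (Fin 6) ℝ)) (p q : Matrix (Fin 6) (Fin 6) ℝ) :
    Set (Matrix (Fin 6) (Fin 6) ℝ) :=
  {A | A ∈ S ∧ formInner A p = formInner A q}

/-- The form `ϖ₁`. -/
def varpi₁ : Matrix (Fin 6) (Fin 6) ℝ := -eForm₂ 1 5 - eForm₂ 2 6 - eForm₂ 3 4

/-- The form `ϖ₂`. -/
def varpi₂ : Matrix (Fin 6) (Fin 6) ℝ := eForm₂ 1 5 - eForm₂ 2 6 + eForm₂ 3 4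

/-- The exterior derivatives of `e¹, …, e⁶` in the `3`-step nilpotent Lie algebra:
`deⁱ = 0` for `i ≤ 4`, `de⁵ = e^{12}`, `de⁶ = e^{15} + e^{34}`. -/
def structureForm : Fin 6 → Matrix (Fin 6) (Fin 6) ℝ :=
  ![0, 0, 0, 0, eForm₂ 1 2, eForm₂ 1 5 + eForm₂ 3 4]

/-! ### Riemannian geometry of a `6`-manifold with an invariant frame -/

/-- The model space. -/
abbrev E6 : Type := EuclideanSpace ℝ (Fin 6)

section Geometry

variable {M : Type*} [TopologicalSpace M] [ChartedSpace E6 M]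

instance instFiniteDimensionalTangent (x : M) :
    FiniteDimensional ℝ (TangentSpace 𝓘(ℝ, E6) x) :=
  inferInstanceAs (FiniteDimensional ℝ E6)

variable [RiemannianBundle (fun x : M => TangentSpace 𝓘(ℝ, E6) x)]

variable [IsManifold 𝓘(ℝ, E6) ∞ M]

/-- The value `dθ(X, Y) = X(θ(Y)) - Y(θ(X)) - θ([X, Y])` at `x` of the exterior derivative of the
`1`-form `θ = g(U, ·)`. -/
def extDerivOneForm (U X Y : Π x : M, TangentSpace 𝓘(ℝ, E6) x) (x : M) : ℝ :=
  mvfderiv 𝓘(ℝ, E6) (fun y => inner ℝ (U y) (Y y)) x (X x)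
    - mvfderiv 𝓘(ℝ, E6) (fun y => inner ℝ (U y) (X y)) x (Y x)
    - inner ℝ (U x) (VectorField.mlieBracket 𝓘(ℝ, E6) X Y x)

/-- `E₁, …, E₆` is a smooth global orthonormal frame, and the dual coframe `eᵏ = g(Eₖ, ·)`
satisfies the structure equations `de⁵ = e^{12}`, `de⁶ = e^{15} + e^{34}`, `deⁱ = 0` otherwise. On
a nilmanifold `Γ \ G` of this Lie algebra with its standard metric, this is the frame induced by
the left-invariant vector fields dual to `e¹, …, e⁶`. -/
structure IsInvariantFrame (E : Fin 6 → Π x : M, TangentSpace 𝓘(ℝ, E6) x) : Prop where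
  contMDiff : ∀ i, ContMDiff 𝓘(ℝ, E6) 𝓘(ℝ, E6).tangent ∞
    (fun x => (⟨x, E i x⟩ : TangentBundle 𝓘(ℝ, E6) M))
  orthonormal : ∀ x, Orthonormal ℝ (fun i => E i x)
  structure_eq : ∀ k i j x, extDerivOneForm (E k) (E i) (E j) x = structureForm k i j

/-- The almost complex structure with fundamental form `A`: it sends `Eᵢ` to `∑ⱼ A(Eᵢ, Eⱼ) Eⱼ`. -/
def almostComplex (E : Fin 6 → Π x : M, TangentSpace 𝓘(ℝ, E6) x) (A : Matrix (Fin 6) (Fin 6) ℝ)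
    (x : M) : TangentSpace 𝓘(ℝ, E6) x →ₗ[ℝ] TangentSpace 𝓘(ℝ, E6) x :=
  ∑ i, ∑ j, A i j • (innerₗ (TangentSpace 𝓘(ℝ, E6) x) (E i x)).smulRight (E j x)

/-- The fundamental form `g(JX, Y)`, at `x`. -/
def fundamentalForm (J : Π x : M, TangentSpace 𝓘(ℝ, E6) x →ₗ[ℝ] TangentSpace 𝓘(ℝ, E6) x)
    (x : M) (v w : TangentSpace 𝓘(ℝ, E6) x) : ℝ :=
  inner ℝ (J x v) w

/-- The vector field `X` is differentiable at `x`. -/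
def DiffFieldAt (X : Π y : M, TangentSpace 𝓘(ℝ, E6) y) (x : M) : Prop :=
  MDifferentiableAt 𝓘(ℝ, E6) 𝓘(ℝ, E6).tangent
    (fun y => (⟨y, X y⟩ : TangentBundle 𝓘(ℝ, E6) M)) x

/-- `T` is the covariant derivative at `x` of the fundamental form `Ω` of `J`:
`T(X, Y, Z) = X(Ω(Y, Z)) - Ω(∇_X Y, Z) - Ω(Y, ∇_X Z)` for all vector fields `X, Y, Z`
differentiable at `x`. -/
def IsNablaFundamentalForm
    (nabla : CovariantDerivative 𝓘(ℝ, E6) E6 (fun x : M => TangentSpace 𝓘(ℝ, E6) x))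
    (J : Π x : M, TangentSpace 𝓘(ℝ, E6) x →ₗ[ℝ] TangentSpace 𝓘(ℝ, E6) x) (x : M)
    (T : TangentSpace 𝓘(ℝ, E6) x →ₗ[ℝ] TangentSpace 𝓘(ℝ, E6) x →ₗ[ℝ]
      TangentSpace 𝓘(ℝ, E6) x →ₗ[ℝ] ℝ) : Prop :=
  ∀ X Y Z : Π y : M, TangentSpace 𝓘(ℝ, E6) y,
    DiffFieldAt X x → DiffFieldAt Y x → DiffFieldAt Z x →
      T (X x) (Y x) (Z x) =
        mvfderiv 𝓘(ℝ, E6) (fun y => fundamentalForm J y (Y y) (Z y)) x (X x)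
          - fundamentalForm J x (nabla Y x (X x)) (Z x)
          - fundamentalForm J x (Y x) (nabla Z x (X x))

/-- The class `𝒵_{ijk}` of the invariant almost Hermitian structures in `𝒵` for which `∇ω` lies in
`W_i ⊕ W_j ⊕ W_k` at every point. -/
def ghClass (E : Fin 6 → Π x : M, TangentSpace 𝓘(ℝ, E6) x)
    (nabla : CovariantDerivative 𝓘(ℝ, E6) E6 (fun x : M => TangentSpace 𝓘(ℝ, E6) x))
    (i j k : ℕ) : Set (Matrix (Fin 6) (Fin 6) ℝ) :=
  {A | A ∈ Z ∧ ∀ x : M,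
    ∃ T ∈ component (almostComplex E A x) i ⊔ component (almostComplex E A x) j
        ⊔ component (almostComplex E A x) k,
      IsNablaFundamentalForm nabla (almostComplex E A) x T}

variable [IsContMDiffRiemannianBundle 𝓘(ℝ, E6) ∞ E6 (fun x : M => TangentSpace 𝓘(ℝ, E6) x)]

instance instRiemannianBundleOne :
    IsContMDiffRiemannianBundle 𝓘(ℝ, E6) 1 E6 (fun x : M => TangentSpace 𝓘(ℝ, E6) x) :=
  IsContMDiffRiemannianBundle.of_le (n := ∞) (by norm_cast)

/-- The Levi-Civita connection: torsion-free and compatible with the metric. -/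
def IsLeviCivita
    (nabla : CovariantDerivative 𝓘(ℝ, E6) E6 (fun x : M => TangentSpace 𝓘(ℝ, E6) x)) : Prop :=
  nabla.torsion = 0 ∧ nabla.IsMetricCompatible

end Geometry

end GrayHervella

end

open GrayHervella

/-! Write `T α (x, y, z) = α (J x, J y, z)`. On the space `W J` of tensors of the type of `∇ω` this
is an involution. Its `-1` eigenspace is `W₁ ⊕ W₂`, split by the cyclic sum (a 3-form on `W₁`, zero
on `W₂`), and its `+1` eigenspace is `W₃ ⊕ W₄`, split by the contraction. Hence each sum of three
components is tested by one simple condition: `W₁ ⊕ W₂ ⊕ W₃` by zero contraction, `W₂ ⊕ W₃ ⊕ W₄` by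
a zero cyclic sum of `α - T α`, `W₁ ⊕ W₂ ⊕ W₄` by `α + T α` being built from the contraction. On `W₁
⊕ W₃ ⊕ W₄` the Nijenhuis tensor is totally skew; it vanishes on the `+1` eigenspace.

In the invariant frame `∇ω` has the constant coefficients `A Γᵢ - Γᵢ A`, with `Γ` given by Koszul's
formula. Torsion-freeness removes `Γ` from the Nijenhuis tensor (`nijenhuisCoeff_eq`), from `dω`
(`nablaCoeff_cyclic`) and from the contraction (`nablaCoeff_contraction`). All three become
polynomials in `A` and the structure constants, and the theorem becomes algebra with a skew
orthogonal `6 × 6` matrix.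

The contraction vanishes as soon as `ω` is orthogonal to `e^{12}` and `e^{15} + e^{34}`, which gives
the subsets of `𝒵₁₂₃`. On a generalized edge two columns of `A` are fixed and the remaining `4 × 4`
block is self-dual or anti-self-dual, so three parameters on a sphere remain; the cyclic sum of the
Nijenhuis tensor then vanishes on the edges listed in `𝒵₂₃₄`. A totally skew Nijenhuis tensor would
force `J` to preserve the plane of the last two frame vectors, and one further component is then
contradictory (`not_nijenhuisCoeff_skew`), so `𝒵₁₃₄` is empty.

For `𝒵₁₂₄`, the condition on `α + T α` is symmetrized into equations on `dω` with an unknown Lee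
form (`exists_lee_form_of_mem`). Solving them gives `A 4 5 = 0`, then `A 0 5 = 0`, then all entries
up to a sign (`eq_varpi_of_lee_form`). Conversely `ϖ₁` and `ϖ₂` are signed permutation matrices, so
their membership is a finite check over the integers. -/

namespace GrayHervella

/-! ### The Gray–Hervella components as eigenspaces of the `J`-twist -/

section Algebra

variable {V : Type*} [NormedAddCommGroup V] [InnerProductSpace ℝ V]

/-- The tensor `(x, y, z) ↦ α (J x) (J y) z`. -/
noncomputable def twist (J : V →ₗ[ℝ] V) (α : V →ₗ[ℝ] V →ₗ[ℝ] V →ₗ[ℝ] ℝ) :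
    V →ₗ[ℝ] V →ₗ[ℝ] V →ₗ[ℝ] ℝ :=
  α.compl₁₂ J J

@[simp] lemma twist_apply (J : V →ₗ[ℝ] V) (α : V →ₗ[ℝ] V →ₗ[ℝ] V →ₗ[ℝ] ℝ) (x y z : V) :
    twist J α x y z = α (J x) (J y) z := rfl

/-- The tensor `(x, y, z) ↦ α x z y`. -/
noncomputable def swapLast (α : V →ₗ[ℝ] V →ₗ[ℝ] V →ₗ[ℝ] ℝ) : V →ₗ[ℝ] V →ₗ[ℝ] V →ₗ[ℝ] ℝ :=
  (LinearMap.lflip (R₀ := ℝ)).toLinearMap ∘ₗ α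

@[simp] lemma swapLast_apply (α : V →ₗ[ℝ] V →ₗ[ℝ] V →ₗ[ℝ] ℝ) (x y z : V) :
    swapLast α x y z = α x z y := rfl

/-- The tensor `(x, y, z) ↦ α y z x`. -/
noncomputable def rotate (α : V →ₗ[ℝ] V →ₗ[ℝ] V →ₗ[ℝ] ℝ) : V →ₗ[ℝ] V →ₗ[ℝ] V →ₗ[ℝ] ℝ :=
  (swapLast α).flip

@[simp] lemma rotate_apply (α : V →ₗ[ℝ] V →ₗ[ℝ] V →ₗ[ℝ] ℝ) (x y z : V) :
    rotate α x y z = α y z x := rfl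

/-- The tensor of type `W₄` with a given contraction, up to a factor. -/
noncomputable def traceTensor (J : V →ₗ[ℝ] V) (θ : V →ₗ[ℝ] ℝ) : V →ₗ[ℝ] V →ₗ[ℝ] V →ₗ[ℝ] ℝ :=
  let B : V →ₗ[ℝ] V →ₗ[ℝ] V →ₗ[ℝ] ℝ :=
    (innerₗ V).compr₂ (LinearMap.toSpanSingleton ℝ (V →ₗ[ℝ] ℝ) θ)
  let C : V →ₗ[ℝ] V →ₗ[ℝ] V →ₗ[ℝ] ℝ :=
    ((innerₗ V).compl₂ J).compr₂ (LinearMap.toSpanSingleton ℝ (V →ₗ[ℝ] ℝ) (θ ∘ₗ J))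
  B + (-1 : ℝ) • swapLast B + (-1 : ℝ) • C + swapLast C

lemma traceTensor_apply (J : V →ₗ[ℝ] V) (θ : V →ₗ[ℝ] ℝ) (x y z : V) :
    traceTensor J θ x y z = inner ℝ x y * θ z - inner ℝ x z * θ y
      - inner ℝ x (J y) * θ (J z) + inner ℝ x (J z) * θ (J y) := by
  simp [traceTensor]
  ring

lemma skew_of_mem_W₁ {J : V →ₗ[ℝ] V}
    {α : V →ₗ[ℝ] V →ₗ[ℝ] V →ₗ[ℝ] ℝ} (h : α ∈ W₁ J) (x y z : V) :
    α x y z = -α y x z := by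
  have h := h.2
  have h' := h (x + y) z
  simp only [map_add, LinearMap.add_apply, h x z, h y z] at h'
  linarith

/-- Elements of `W₁` are 3-forms, so the sign rule for `J` in the last two slots can be carried to
the first two. -/
lemma twist_of_mem_W₁ {J : V →ₗ[ℝ] V}
    {α : V →ₗ[ℝ] V →ₗ[ℝ] V →ₗ[ℝ] ℝ} (h : α ∈ W₁ J) (x y z : V) :
    α (J x) (J y) z = -α x y z := by
  have hs := skew_of_mem_W₁ h
  obtain ⟨⟨h₁, h₂⟩, -⟩ := h
  linarith [h₁ (J x) (J y) z, hs (J x) z (J y), h₂ z x y, hs z x y, h₁ x y z]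

lemma twist_right {J : V →ₗ[ℝ] V} (hJ : ∀ x, J (J x) = -x)
    {α : V →ₗ[ℝ] V →ₗ[ℝ] V →ₗ[ℝ] ℝ} (h : α ∈ W J) (x y z : V) :
    α x (J y) z = α x y (J z) := by
  have := h.2 x y (J z)
  rw [hJ, map_neg, neg_inj] at this
  exact this

lemma twist_of_mem_W₂ {J : V →ₗ[ℝ] V} (hJ : ∀ x, J (J x) = -x)
    {α : V →ₗ[ℝ] V →ₗ[ℝ] V →ₗ[ℝ] ℝ} (h : α ∈ W₂ J) (x y z : V) :
    α (J x) (J y) z = -α x y z := by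
  obtain ⟨hW, hc⟩ := h
  have hr := twist_right hJ hW
  obtain ⟨h₁, h₂⟩ := hW
  -- Cyclic identities with `J` in no slot and in each pair of slots. Once `J` is moved by the
  -- symmetries of `W J`, the combination `c₀ + c₁ - c₂ + c₃` is twice the claim.
  have c₀ := hc x y z
  have c₁ := hc (J x) (J y) z
  have c₂ := hc x (J y) (J z)
  have c₃ := hc (J x) y (J z)
  linarith [h₂ z x y, h₂ x y z, hr (J y) z x, hr (J z) x y, hr (J x) y z, h₁ y (J z) (J x),
    h₂ y z x]

lemma inner_skew {J : V →ₗ[ℝ] V} (hJ : ∀ x, J (J x) = -x)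
    (hg : ∀ x y, inner ℝ (J x) (J y) = inner ℝ x y) (x y : V) :
    inner ℝ (J x) y = -inner ℝ x (J y) := by
  have := hg x (J y)
  rw [hJ, inner_neg_right] at this
  linarith

lemma twist_mem_W {J : V →ₗ[ℝ] V} (hJ : ∀ x, J (J x) = -x)
    {α : V →ₗ[ℝ] V →ₗ[ℝ] V →ₗ[ℝ] ℝ} (h : α ∈ W J) : twist J α ∈ W J := by
  refine ⟨fun x y z => ?_, fun x y z => ?_⟩
  · rw [twist_apply, twist_apply, h.1, twist_right hJ h]
  · rw [twist_apply, twist_apply, h.2]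

lemma mem_W₂_of_cyclic {J : V →ₗ[ℝ] V} {α : V →ₗ[ℝ] V →ₗ[ℝ] V →ₗ[ℝ] ℝ} (h : α ∈ W J)
    (hc : ∀ x y z, α x y z + α y z x + α z x y = 0) : α ∈ W₂ J := ⟨h, hc⟩

/-- The cyclic sum `β` is totally skew, and the eigenvalue `-1` keeps it in `W J`. Its own cyclic
sum is `3 β`, so `β / 3` is the `W₁` part and `α - β / 3` has zero cyclic sum. -/
lemma mem_W₁_sup_W₂ {J : V →ₗ[ℝ] V} (hJ : ∀ x, J (J x) = -x)
    {α : V →ₗ[ℝ] V →ₗ[ℝ] V →ₗ[ℝ] ℝ} (h : α ∈ W J)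
    (ht : ∀ x y z, α (J x) (J y) z = -α x y z) : α ∈ W₁ J ⊔ W₂ J := by
  let β := α + rotate α + rotate (rotate α)
  have hβ : ∀ x y z, β x y z = α x y z + α y z x + α z x y := fun x y z => rfl
  have hβW : β ∈ W J := by
    refine ⟨fun x y z => ?_, fun x y z => ?_⟩
    · rw [hβ, hβ]
      linarith [h.1 x y z, h.1 y z x, h.1 z x y]
    · rw [hβ, hβ]
      have h₁ := ht y z x
      have h₂ := ht x y z
      linarith [h.2 x y z, ht y z x, twist_right hJ h (J z) x y, ht z x y]
  have hβ₁ : β ∈ W₁ J := by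
    refine ⟨hβW, fun x z => ?_⟩
    rw [hβ]
    linarith [h.1 x x z, h.1 z x x]
  refine Submodule.mem_sup.2 ⟨(1 / 3 : ℝ) • β, Submodule.smul_mem _ _ hβ₁,
    α + (-1 / 3 : ℝ) • β,
    mem_W₂_of_cyclic (Submodule.add_mem _ h (Submodule.smul_mem _ _ hβW)) fun x y z => ?_, ?_⟩
  · simp only [LinearMap.add_apply, LinearMap.smul_apply, smul_eq_mul, hβ]
    ring
  · ext x y z
    simp only [LinearMap.add_apply, LinearMap.smul_apply, smul_eq_mul]
    ring

lemma traceTensor_mem_W {J : V →ₗ[ℝ] V} (hJ : ∀ x, J (J x) = -x) (θ : V →ₗ[ℝ] ℝ) :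
    traceTensor J θ ∈ W J := by
  refine ⟨fun x y z => ?_, fun x y z => ?_⟩
  · simp only [traceTensor_apply]
    ring
  · simp only [traceTensor_apply, hJ, map_neg, inner_neg_right]
    ring

lemma traceTensor_twist {J : V →ₗ[ℝ] V} (hJ : ∀ x, J (J x) = -x)
    (hg : ∀ x y, inner ℝ (J x) (J y) = inner ℝ x y) (θ : V →ₗ[ℝ] ℝ) (x y z : V) :
    traceTensor J θ (J x) (J y) z = traceTensor J θ x y z := by
  simp only [traceTensor_apply, hg, hJ, map_neg, inner_neg_right, inner_skew hJ hg]
  ring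

lemma half_add_half (J : V →ₗ[ℝ] V) (α : V →ₗ[ℝ] V →ₗ[ℝ] V →ₗ[ℝ] ℝ) :
    (1 / 2 : ℝ) • (α + (-1 : ℝ) • twist J α) + (1 / 2 : ℝ) • (α + twist J α) = α := by
  ext x y z
  simp only [LinearMap.add_apply, LinearMap.smul_apply, smul_eq_mul]
  ring

lemma sub_twist_mem {J : V →ₗ[ℝ] V} (hJ : ∀ x, J (J x) = -x)
    {α : V →ₗ[ℝ] V →ₗ[ℝ] V →ₗ[ℝ] ℝ} (h : α ∈ W J) :
    (1 / 2 : ℝ) • (α + (-1 : ℝ) • twist J α) ∈ W J :=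
  Submodule.smul_mem _ _ (Submodule.add_mem _ h (Submodule.smul_mem _ _ (twist_mem_W hJ h)))

lemma add_twist_mem {J : V →ₗ[ℝ] V} (hJ : ∀ x, J (J x) = -x)
    {α : V →ₗ[ℝ] V →ₗ[ℝ] V →ₗ[ℝ] ℝ} (h : α ∈ W J) :
    (1 / 2 : ℝ) • (α + twist J α) ∈ W J :=
  Submodule.smul_mem _ _ (Submodule.add_mem _ h (twist_mem_W hJ h))

lemma sub_twist_twist {J : V →ₗ[ℝ] V} (hJ : ∀ x, J (J x) = -x)
    (α : V →ₗ[ℝ] V →ₗ[ℝ] V →ₗ[ℝ] ℝ) (x y z : V) :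
    ((1 / 2 : ℝ) • (α + (-1 : ℝ) • twist J α)) (J x) (J y) z =
      -((1 / 2 : ℝ) • (α + (-1 : ℝ) • twist J α)) x y z := by
  simp [hJ]

lemma add_twist_twist {J : V →ₗ[ℝ] V} (hJ : ∀ x, J (J x) = -x)
    (α : V →ₗ[ℝ] V →ₗ[ℝ] V →ₗ[ℝ] ℝ) (x y z : V) :
    ((1 / 2 : ℝ) • (α + twist J α)) (J x) (J y) z =
      ((1 / 2 : ℝ) • (α + twist J α)) x y z := by
  simp [hJ]
  ring

/-! ### The contraction, and tests for sums of three components -/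

variable [FiniteDimensional ℝ V]

/-- A trace does not depend on the orthonormal basis. This permits both a basis rotated by `J` and
the invariant frame. -/
lemma contraction_apply_eq_sum {ι : Type*} [Fintype ι] (b : OrthonormalBasis ι ℝ V)
    (α : V →ₗ[ℝ] V →ₗ[ℝ] V →ₗ[ℝ] ℝ) (z : V) :
    contraction α z = ∑ i, α (b i) (b i) z := by
  have key : ∀ B : V →ₗ[ℝ] V →ₗ[ℝ] ℝ,
      ∑ i, B (b i) (b i) = ∑ i, B (stdOrthonormalBasis ℝ V i) (stdOrthonormalBasis ℝ V i) := by
    intro B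
    set c := stdOrthonormalBasis ℝ V
    have h : ∀ k, B (b k) (b k) =
        ∑ i, ∑ j, inner ℝ (c i) (b k) * inner ℝ (b k) (c j) * B (c i) (c j) := by
      intro k
      conv_lhs => rw [← c.sum_repr' (b k)]
      simp only [map_sum, map_smul, LinearMap.sum_apply, LinearMap.smul_apply, smul_eq_mul,
        Finset.mul_sum]
      rw [Finset.sum_comm]
      refine Finset.sum_congr rfl fun i _ => Finset.sum_congr rfl fun j _ => ?_
      rw [real_inner_comm (c j) (b k)]
      ring
    simp_rw [h]
    rw [Finset.sum_comm]
    refine Finset.sum_congr rfl fun i _ => ?_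
    rw [Finset.sum_comm]
    simp_rw [← Finset.sum_mul, b.sum_inner_mul_inner, c.inner_eq_ite]
    simp
  have h : contraction α z = ∑ i, swapLast α (stdOrthonormalBasis ℝ V i) z
      (stdOrthonormalBasis ℝ V i) := by
    simp [contraction]
  have := key (swapLast (rotate α) z)
  simpa [contraction] using this.symm

/-- An orthogonal `J` carries an orthonormal basis to an orthonormal basis. Consequently the
contraction vanishes on the `-1` eigenspace of the twist. -/
lemma contraction_twist {J : V →ₗ[ℝ] V}
    (hg : ∀ x y, inner ℝ (J x) (J y) = inner ℝ x y) (α : V →ₗ[ℝ] V →ₗ[ℝ] V →ₗ[ℝ] ℝ) :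
    contraction (twist J α) = contraction α := by
  ext z
  rw [contraction_apply_eq_sum ((stdOrthonormalBasis ℝ V).map
      ((J.isometryOfInner hg).toLinearIsometryEquiv rfl)) α,
    contraction_apply_eq_sum (stdOrthonormalBasis ℝ V)]
  simp

lemma contraction_eq_zero_of_twist {J : V →ₗ[ℝ] V}
    (hg : ∀ x y, inner ℝ (J x) (J y) = inner ℝ x y) {α : V →ₗ[ℝ] V →ₗ[ℝ] V →ₗ[ℝ] ℝ}
    (h : ∀ x y z, α (J x) (J y) z = -α x y z) : contraction α = 0 := by
  have h' : twist J α = (-1 : ℝ) • α := by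
    ext x y z
    simp [h]
  have := contraction_twist hg α
  rw [h', map_smul] at this
  ext z
  have := LinearMap.congr_fun this z
  simp only [LinearMap.smul_apply, smul_eq_mul] at this
  simp only [LinearMap.zero_apply]
  linarith

/-- With `n = dim V`, the four terms contribute `n`, `-1`, `0` and `-1` times `θ z`; the third
vanishes because `J x` is orthogonal to `x`. -/
lemma contraction_traceTensor {J : V →ₗ[ℝ] V} (hJ : ∀ x, J (J x) = -x)
    (hg : ∀ x y, inner ℝ (J x) (J y) = inner ℝ x y) (θ : V →ₗ[ℝ] ℝ) (z : V) :
    contraction (traceTensor J θ) z = ((Module.finrank ℝ V : ℝ) - 2) * θ z := by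
  have hb : ∀ (f : V →ₗ[ℝ] ℝ) (w : V), ∑ i, inner ℝ (stdOrthonormalBasis ℝ V i) w *
      f (stdOrthonormalBasis ℝ V i) = f w := by
    intro f w
    conv_rhs => rw [← (stdOrthonormalBasis ℝ V).sum_repr' w]
    simp
  have h₀ : ∀ x, inner ℝ x (J x) = 0 := by
    intro x
    have := inner_skew hJ hg x x
    rw [real_inner_comm] at this
    linarith
  rw [contraction_apply_eq_sum (stdOrthonormalBasis ℝ V)]
  simp only [traceTensor_apply, h₀, Finset.sum_add_distrib, Finset.sum_sub_distrib]
  have h₁ := hb (θ ∘ₗ J) (J z)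
  simp only [LinearMap.comp_apply] at h₁
  rw [hb θ z, h₁]
  simp [hJ]
  ring

lemma traceTensor_mem_W₄ {J : V →ₗ[ℝ] V} (hJ : ∀ x, J (J x) = -x)
    (hg : ∀ x y, inner ℝ (J x) (J y) = inner ℝ x y) (θ : V →ₗ[ℝ] ℝ) :
    traceTensor J θ ∈ W₄ J := by
  refine ⟨traceTensor_mem_W hJ θ, fun x y z => ?_⟩
  simp only [contraction_traceTensor hJ hg, traceTensor_apply]
  ring

lemma eq_traceTensor_of_mem_W₄ {J : V →ₗ[ℝ] V} {α : V →ₗ[ℝ] V →ₗ[ℝ] V →ₗ[ℝ] ℝ}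
    (h : α ∈ W₄ J) (x y z : V) :
    ((Module.finrank ℝ V : ℝ) - 2) * α x y z = traceTensor J (contraction α) x y z := by
  rw [traceTensor_apply]
  exact h.2 x y z

lemma twist_of_mem_W₄ {J : V →ₗ[ℝ] V} (hJ : ∀ x, J (J x) = -x)
    (hg : ∀ x y, inner ℝ (J x) (J y) = inner ℝ x y) (hn : (Module.finrank ℝ V : ℝ) ≠ 2)
    {α : V →ₗ[ℝ] V →ₗ[ℝ] V →ₗ[ℝ] ℝ} (h : α ∈ W₄ J) (x y z : V) :
    α (J x) (J y) z = α x y z := by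
  refine mul_left_cancel₀ (sub_ne_zero.2 hn) ?_
  rw [eq_traceTensor_of_mem_W₄ h, eq_traceTensor_of_mem_W₄ h, traceTensor_twist hJ hg]

/-- The trace tensor of the contraction, divided by `n - 2`, has the same contraction as `α` and
lies in `W₄`; the difference is the `W₃` part. Dimension two is excluded because of this division.
-/
lemma mem_W₃_sup_W₄ {J : V →ₗ[ℝ] V} (hJ : ∀ x, J (J x) = -x)
    (hg : ∀ x y, inner ℝ (J x) (J y) = inner ℝ x y) (hn : (Module.finrank ℝ V : ℝ) ≠ 2)
    {α : V →ₗ[ℝ] V →ₗ[ℝ] V →ₗ[ℝ] ℝ} (h : α ∈ W J)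
    (ht : ∀ x y z, α (J x) (J y) z = α x y z) : α ∈ W₃ J ⊔ W₄ J := by
  set r : ℝ := (Module.finrank ℝ V : ℝ) - 2 with hr
  have hr₀ : r ≠ 0 := sub_ne_zero.2 hn
  set β := r⁻¹ • traceTensor J (contraction α) with hβ
  have hβ₄ : β ∈ W₄ J := Submodule.smul_mem _ _ (traceTensor_mem_W₄ hJ hg _)
  refine Submodule.mem_sup.2 ⟨α + (-1 : ℝ) • β, ⟨Submodule.add_mem _ h
    (Submodule.smul_mem _ _ hβ₄.1), fun x y z => ?_, ?_⟩, β, hβ₄, ?_⟩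
  · simp only [LinearMap.add_apply, LinearMap.smul_apply, ht, twist_of_mem_W₄ hJ hg hn hβ₄]
  · ext z
    simp only [hβ, map_add, map_smul, LinearMap.add_apply, LinearMap.smul_apply,
      contraction_traceTensor hJ hg, smul_eq_mul, LinearMap.zero_apply, ← hr]
    field_simp
    ring
  · ext x y z
    simp

/-- Only the `W₁` part must vanish, and it is the cyclic sum of the `-1` eigencomponent `(α - T α) /
2`. -/
theorem mem_W₂₃₄ {J : V →ₗ[ℝ] V} (hJ : ∀ x, J (J x) = -x)
    (hg : ∀ x y, inner ℝ (J x) (J y) = inner ℝ x y) (hn : (Module.finrank ℝ V : ℝ) ≠ 2)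
    {α : V →ₗ[ℝ] V →ₗ[ℝ] V →ₗ[ℝ] ℝ} (h : α ∈ W J)
    (hc : ∀ x y z, α x y z + α y z x + α z x y =
      α (J x) (J y) z + α (J y) (J z) x + α (J z) (J x) y) :
    α ∈ W₂ J ⊔ W₃ J ⊔ W₄ J := by
  rw [← half_add_half J α, sup_assoc]
  refine Submodule.add_mem_sup (mem_W₂_of_cyclic (sub_twist_mem hJ h) fun x y z => ?_)
    (mem_W₃_sup_W₄ hJ hg hn (add_twist_mem hJ h) (add_twist_twist hJ α))
  simp only [LinearMap.add_apply, LinearMap.smul_apply, smul_eq_mul, twist_apply]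
  linarith [hc x y z]

theorem mem_W₁₂₃ {J : V →ₗ[ℝ] V} (hJ : ∀ x, J (J x) = -x)
    (hg : ∀ x y, inner ℝ (J x) (J y) = inner ℝ x y)
    {α : V →ₗ[ℝ] V →ₗ[ℝ] V →ₗ[ℝ] ℝ} (h : α ∈ W J) (hc : contraction α = 0) :
    α ∈ W₁ J ⊔ W₂ J ⊔ W₃ J := by
  rw [← half_add_half J α]
  refine Submodule.add_mem_sup (mem_W₁_sup_W₂ hJ (sub_twist_mem hJ h) (sub_twist_twist hJ α))
    ⟨add_twist_mem hJ h, add_twist_twist hJ α, ?_⟩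
  rw [map_smul, map_add, contraction_twist hg, hc, add_zero, smul_zero]

/-- Adding the twist kills `W₁ ⊕ W₂` and doubles the rest. What remains lies in `W₄` exactly when it
is the trace tensor of its contraction, which is also the contraction of `α`. -/
theorem mem_W₁₂₄_iff {J : V →ₗ[ℝ] V} (hJ : ∀ x, J (J x) = -x)
    (hg : ∀ x y, inner ℝ (J x) (J y) = inner ℝ x y) (hn : (Module.finrank ℝ V : ℝ) ≠ 2)
    {α : V →ₗ[ℝ] V →ₗ[ℝ] V →ₗ[ℝ] ℝ} (h : α ∈ W J) :
    α ∈ W₁ J ⊔ W₂ J ⊔ W₄ J ↔ ∀ x y z, ((Module.finrank ℝ V : ℝ) - 2) *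
      (α x y z + α (J x) (J y) z) = 2 * traceTensor J (contraction α) x y z := by
  constructor
  · intro hα x y z
    obtain ⟨δ, hδ, γ, hγ, rfl⟩ := Submodule.mem_sup.1 hα
    obtain ⟨β₁, h₁, β₂, h₂, rfl⟩ := Submodule.mem_sup.1 hδ
    rw [map_add, map_add, contraction_eq_zero_of_twist hg (twist_of_mem_W₁ h₁),
      contraction_eq_zero_of_twist hg (twist_of_mem_W₂ hJ h₂), add_zero, zero_add,
      ← eq_traceTensor_of_mem_W₄ hγ]
    simp only [LinearMap.add_apply, twist_of_mem_W₁ h₁, twist_of_mem_W₂ hJ h₂,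
      twist_of_mem_W₄ hJ hg hn hγ]
    ring
  · intro hα
    rw [← half_add_half J α]
    refine Submodule.add_mem_sup (mem_W₁_sup_W₂ hJ (sub_twist_mem hJ h) (sub_twist_twist hJ α))
      ⟨add_twist_mem hJ h, fun x y z => ?_⟩
    rw [← traceTensor_apply, map_smul, map_add, contraction_twist hg]
    have e : (1 / 2 : ℝ) • (contraction α + contraction α) = contraction α := by
      rw [← two_smul ℝ, smul_smul]
      norm_num
    rw [e]
    simp only [LinearMap.add_apply, LinearMap.smul_apply, smul_eq_mul, twist_apply]
    linarith [hα x y z]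

end Algebra

/-- The coefficients `g(∇_{Eᵢ} Eⱼ, Eₖ)` of the Levi-Civita connection in the invariant frame. -/
noncomputable def christoffel (i : Fin 6) : Matrix (Fin 6) (Fin 6) ℝ :=
  Matrix.of fun j k => (structureForm i j k - structureForm k i j - structureForm j k i) / 2

/-- The coefficients of `∇_{Eᵢ} ω` in the invariant frame. -/
noncomputable def nablaCoeff (A : Matrix (Fin 6) (Fin 6) ℝ) (i : Fin 6) :
    Matrix (Fin 6) (Fin 6) ℝ :=
  A * christoffel i - christoffel i * A

lemma eForm₂_skew (a c : ℕ) (i j : Fin 6) : eForm₂ a c i j = -eForm₂ a c j i := by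
  simp only [eForm₂, wedge, Matrix.of_apply]
  ring

lemma structureForm_skew (k i j : Fin 6) : structureForm k i j = -structureForm k j i := by
  have h : ∀ k : Fin 6, structureForm k = 0 ∨ structureForm k = eForm₂ 1 2 ∨
      structureForm k = eForm₂ 1 5 + eForm₂ 3 4 := by
    intro k
    fin_cases k
    exacts [.inl rfl, .inl rfl, .inl rfl, .inl rfl, .inr (.inl rfl), .inr (.inr rfl)]
  rcases h k with h | h | h <;> rw [h]
  · simp
  · exact eForm₂_skew 1 2 i j
  · rw [Matrix.add_apply, Matrix.add_apply, eForm₂_skew 1 5 i j, eForm₂_skew 3 4 i j]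
    ring

/-! ### Endomorphisms and tensors in an orthonormal frame -/

section Coordinates

variable {V : Type*} [NormedAddCommGroup V] [InnerProductSpace ℝ V]

/-- The endomorphism with matrix `A` in the frame `b`: it sends `bᵢ` to `∑ⱼ A i j • bⱼ`. -/
noncomputable def frameEnd (b : Fin 6 → V) (A : Matrix (Fin 6) (Fin 6) ℝ) : V →ₗ[ℝ] V :=
  ∑ i, ∑ j, A i j • (innerₗ V (b i)).smulRight (b j)

lemma frameEnd_apply (b : Fin 6 → V) (A : Matrix (Fin 6) (Fin 6) ℝ) (x : V) :
    frameEnd b A x = ∑ i, ∑ j, A i j • inner ℝ (b i) x • b j := by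
  simp [frameEnd, LinearMap.sum_apply]

variable (b : OrthonormalBasis (Fin 6) ℝ V)

lemma frameEnd_basis (A : Matrix (Fin 6) (Fin 6) ℝ) (i : Fin 6) :
    frameEnd b A (b i) = ∑ j, A i j • b j := by
  rw [frameEnd_apply, Finset.sum_eq_single i]
  · simp
  · intro k _ hk
    simp [b.inner_eq_ite, hk]
  · simp

lemma frameEnd_frameEnd {A : Matrix (Fin 6) (Fin 6) ℝ} (hA : A * A = -1) (x : V) :
    frameEnd b A (frameEnd b A x) = -x := by
  have : frameEnd b A ∘ₗ frameEnd b A = -LinearMap.id := by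
    refine b.toBasis.ext fun i => ?_
    simp only [OrthonormalBasis.coe_toBasis, LinearMap.comp_apply, frameEnd_basis, map_sum,
      map_smul, Finset.smul_sum, smul_smul]
    rw [Finset.sum_comm]
    simp_rw [← Finset.sum_smul, ← Matrix.mul_apply, hA]
    simp [Matrix.one_apply, ite_smul]
  exact LinearMap.congr_fun this x

lemma inner_frameEnd_frameEnd {A : Matrix (Fin 6) (Fin 6) ℝ} (hA : A * A = -1) (hs : Aᵀ = -A)
    (x y : V) : inner ℝ (frameEnd b A x) (frameEnd b A y) = inner ℝ x y := by
  have : (innerₗ V).compl₁₂ (frameEnd b A) (frameEnd b A) = innerₗ V := by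
    refine b.toBasis.ext fun i => b.toBasis.ext fun j => ?_
    have h : A * Aᵀ = 1 := by rw [hs, mul_neg, hA, neg_neg]
    simp only [OrthonormalBasis.coe_toBasis, LinearMap.compl₁₂_apply, frameEnd_basis,
      innerₗ_apply_apply, sum_inner, inner_sum, inner_smul_left, inner_smul_right, b.inner_eq_ite]
    simp only [mul_ite, mul_one, mul_zero]
    have := congr_fun (congr_fun h i) j
    rw [Matrix.mul_apply, Matrix.one_apply] at this
    simpa [mul_comm] using this
  exact LinearMap.congr_fun (LinearMap.congr_fun this x) y

lemma tensor_ext {α β : V →ₗ[ℝ] V →ₗ[ℝ] V →ₗ[ℝ] ℝ}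
    (h : ∀ i j k, α (b i) (b j) (b k) = β (b i) (b j) (b k)) : α = β :=
  b.toBasis.ext fun i => b.toBasis.ext fun j => b.toBasis.ext fun k => by simpa using h i j k

variable {A : Matrix (Fin 6) (Fin 6) ℝ} {τ : Fin 6 → Matrix (Fin 6) (Fin 6) ℝ}
  {α : V →ₗ[ℝ] V →ₗ[ℝ] V →ₗ[ℝ] ℝ}

lemma twist_basis (hτ : ∀ i j k, α (b i) (b j) (b k) = τ i j k) (i j k : Fin 6) :
    α (frameEnd b A (b i)) (frameEnd b A (b j)) (b k) = ∑ p, ∑ q, A i p * A j q * τ p q k := by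
  simp only [frameEnd_basis, map_sum, map_smul, LinearMap.sum_apply, LinearMap.smul_apply,
    smul_eq_mul, hτ, Finset.mul_sum]
  rw [Finset.sum_comm]
  refine Finset.sum_congr rfl fun p _ => Finset.sum_congr rfl fun q _ => ?_
  ring

lemma mem_W_of_basis (hτ : ∀ i j k, α (b i) (b j) (b k) = τ i j k) (hs : ∀ i, (τ i)ᵀ = -τ i)
    (hA : ∀ i, A * τ i * Aᵀ = -τ i) : α ∈ W (frameEnd b A) := by
  have h₁ : swapLast α = (-1 : ℝ) • α := by
    refine tensor_ext b fun i j k => ?_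
    simp only [swapLast_apply, LinearMap.smul_apply, hτ]
    simpa using congr_fun (congr_fun (hs i) j) k
  -- This composite is `(x, y, z) ↦ α x (J y) (J z)`. Writing the symmetry as an equality of
  -- trilinear maps allows it to be checked on the frame.
  have h₂ : rotate (twist (frameEnd b A) (rotate (rotate α))) = (-1 : ℝ) • α := by
    refine tensor_ext b fun i j k => ?_
    simp only [rotate_apply, twist_apply, LinearMap.smul_apply, hτ, frameEnd_basis, map_sum,
      map_smul, LinearMap.sum_apply, smul_eq_mul]
    have := congr_fun (congr_fun (hA i) j) k
    simp only [Matrix.mul_apply, Matrix.transpose_apply, Matrix.neg_apply] at this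
    rw [neg_one_mul, ← this]
    refine Finset.sum_congr rfl fun p _ => ?_
    rw [mul_comm]
  refine ⟨fun x y z => ?_, fun x y z => ?_⟩
  · have := congrArg (fun β => β x y z) h₁
    simpa using this
  · have := congrArg (fun β => β x y z) h₂
    simpa using this

lemma finrank_eq_six (b : OrthonormalBasis (Fin 6) ℝ V) : (Module.finrank ℝ V : ℝ) = 6 := by
  rw [Module.finrank_eq_card_basis b.toBasis]
  simp

section FiniteDimensional

variable [FiniteDimensional ℝ V]

lemma contraction_basis (hτ : ∀ i j k, α (b i) (b j) (b k) = τ i j k) (k : Fin 6) :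
    contraction α (b k) = ∑ i, τ i i k := by
  rw [contraction_apply_eq_sum b]
  simp only [hτ]

lemma mem_W₁₂₃_of_basis (hA : A * A = -1) (hs : Aᵀ = -A)
    (hτ : ∀ i j k, α (b i) (b j) (b k) = τ i j k) (hW : α ∈ W (frameEnd b A))
    (hc : ∀ k, ∑ i, τ i i k = 0) :
    α ∈ W₁ (frameEnd b A) ⊔ W₂ (frameEnd b A) ⊔ W₃ (frameEnd b A) := by
  refine mem_W₁₂₃ (frameEnd_frameEnd b hA) (inner_frameEnd_frameEnd b hA hs) hW ?_
  refine b.toBasis.ext fun k => ?_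
  rw [OrthonormalBasis.coe_toBasis, contraction_basis b hτ, hc, LinearMap.zero_apply]

/-- In dimension six the factor `n - 2` is `4`; the factor `2` here is what is left after halving
both sides. -/
lemma mem_W₁₂₄_iff_basis (hA : A * A = -1) (hs : Aᵀ = -A)
    (hτ : ∀ i j k, α (b i) (b j) (b k) = τ i j k) (hW : α ∈ W (frameEnd b A)) :
    α ∈ W₁ (frameEnd b A) ⊔ W₂ (frameEnd b A) ⊔ W₄ (frameEnd b A) ↔
      ∀ i j k, 2 * (τ i j k + ∑ p, ∑ q, A i p * A j q * τ p q k) =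
        (1 : Matrix (Fin 6) (Fin 6) ℝ) i j * ∑ l, τ l l k
        - (1 : Matrix (Fin 6) (Fin 6) ℝ) i k * ∑ l, τ l l j
        - A j i * ∑ m, A k m * ∑ l, τ l l m + A k i * ∑ m, A j m * ∑ l, τ l l m := by
  have hn : (Module.finrank ℝ V : ℝ) ≠ 2 := by
    rw [finrank_eq_six b]
    norm_num
  have hinner : ∀ i j, inner ℝ (b i) (frameEnd b A (b j)) = A j i := by
    intro i j
    simp [frameEnd_basis, inner_sum, inner_smul_right, b.inner_eq_ite]
  have htr : ∀ i j k, traceTensor (frameEnd b A) (contraction α) (b i) (b j) (b k) =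
        (1 : Matrix (Fin 6) (Fin 6) ℝ) i j * ∑ l, τ l l k
        - (1 : Matrix (Fin 6) (Fin 6) ℝ) i k * ∑ l, τ l l j
        - A j i * ∑ m, A k m * ∑ l, τ l l m + A k i * ∑ m, A j m * ∑ l, τ l l m := by
    intro i j k
    simp only [traceTensor_apply, hinner, b.inner_eq_ite, Matrix.one_apply,
      contraction_basis b hτ]
    simp only [frameEnd_basis, map_sum, map_smul, contraction_basis b hτ, smul_eq_mul]
  rw [mem_W₁₂₄_iff (frameEnd_frameEnd b hA) (inner_frameEnd_frameEnd b hA hs) hn hW,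
    finrank_eq_six b]
  constructor
  · intro h i j k
    have := h (b i) (b j) (b k)
    rw [htr, hτ, twist_basis b hτ] at this
    linarith
  · intro h x y z
    have : (2 : ℝ) • (α + twist (frameEnd b A) α) =
        traceTensor (frameEnd b A) (contraction α) := by
      refine tensor_ext b fun i j k => ?_
      rw [htr, ← h]
      simp only [LinearMap.smul_apply, LinearMap.add_apply, smul_eq_mul, twist_apply, hτ,
        twist_basis b hτ]
    rw [← this]
    simp only [LinearMap.smul_apply, LinearMap.add_apply, smul_eq_mul, twist_apply]
    ring

end FiniteDimensional

end Coordinates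

lemma christoffel_transpose (i : Fin 6) : (christoffel i)ᵀ = -christoffel i := by
  ext j k
  simp only [christoffel, Matrix.of_apply, Matrix.transpose_apply, Matrix.neg_apply]
  linarith [structureForm_skew i j k, structureForm_skew k i j, structureForm_skew j k i]

/-! ### The tensor `∇ω` of an invariant structure -/

section Manifold

variable {M : Type*} [TopologicalSpace M] [ChartedSpace E6 M]

lemma mvfderiv_sum {ι : Type*} (s : Finset ι) {f : ι → M → ℝ} {x : M}
    (hf : ∀ i ∈ s, MDifferentiableAt 𝓘(ℝ, E6) 𝓘(ℝ, ℝ) (f i) x) :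
    MDifferentiableAt 𝓘(ℝ, E6) 𝓘(ℝ, ℝ) (fun y => ∑ i ∈ s, f i y) x ∧
    mvfderiv 𝓘(ℝ, E6) (fun y => ∑ i ∈ s, f i y) x = ∑ i ∈ s, mvfderiv 𝓘(ℝ, E6) (f i) x := by
  classical
  induction s using Finset.induction_on with
  | empty => simpa using ⟨mdifferentiableAt_const, mvfderiv_const 0⟩
  | insert a s ha ih =>
    obtain ⟨h₁, h₂⟩ := ih fun i hi => hf i (Finset.mem_insert_of_mem hi)
    have h₀ := hf a (Finset.mem_insert_self a s)
    simp only [Finset.sum_insert ha]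
    exact ⟨h₀.add h₁, by rw [mvfderiv_fun_add h₀ h₁, h₂]⟩

variable [RiemannianBundle (fun x : M => TangentSpace 𝓘(ℝ, E6) x)]

lemma almostComplex_eq_frameEnd (E : Fin 6 → Π x : M, TangentSpace 𝓘(ℝ, E6) x)
    (A : Matrix (Fin 6) (Fin 6) ℝ) (x : M) :
    almostComplex E A x = frameEnd (fun i => E i x) A := rfl

lemma fundamentalForm_almostComplex (E : Fin 6 → Π x : M, TangentSpace 𝓘(ℝ, E6) x)
    (A : Matrix (Fin 6) (Fin 6) ℝ) (x : M) (v w : TangentSpace 𝓘(ℝ, E6) x) :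
    fundamentalForm (almostComplex E A) x v w =
      ∑ j, ∑ k, A j k * (inner ℝ (E j x) v * inner ℝ (E k x) w) := by
  simp [fundamentalForm, almostComplex_eq_frameEnd, frameEnd_apply, sum_inner, inner_smul_left]

variable [IsManifold 𝓘(ℝ, E6) ∞ M]

/-- The covariant derivative of the fundamental form with coefficients `A`, as a tensor. -/
noncomputable def nablaForm (E : Fin 6 → Π x : M, TangentSpace 𝓘(ℝ, E6) x)
    (nabla : CovariantDerivative 𝓘(ℝ, E6) E6 (fun x : M => TangentSpace 𝓘(ℝ, E6) x))
    (A : Matrix (Fin 6) (Fin 6) ℝ) (x : M) :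
    TangentSpace 𝓘(ℝ, E6) x →ₗ[ℝ] TangentSpace 𝓘(ℝ, E6) x →ₗ[ℝ]
      TangentSpace 𝓘(ℝ, E6) x →ₗ[ℝ] ℝ :=
  let B (j k : Fin 6) : TangentSpace 𝓘(ℝ, E6) x →ₗ[ℝ] TangentSpace 𝓘(ℝ, E6) x →ₗ[ℝ]
      TangentSpace 𝓘(ℝ, E6) x →ₗ[ℝ] ℝ :=
    ((innerₗ (TangentSpace 𝓘(ℝ, E6) x)) ∘ₗ (nabla (E j) x).toLinearMap).compr₂
      (LinearMap.toSpanSingleton ℝ _ (innerₗ (TangentSpace 𝓘(ℝ, E6) x) (E k x)))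
  ∑ j, ∑ k, A j k • (B j k + swapLast (B k j))

lemma nablaForm_apply (E : Fin 6 → Π x : M, TangentSpace 𝓘(ℝ, E6) x)
    (nabla : CovariantDerivative 𝓘(ℝ, E6) E6 (fun x : M => TangentSpace 𝓘(ℝ, E6) x))
    (A : Matrix (Fin 6) (Fin 6) ℝ) (x : M) (u v w : TangentSpace 𝓘(ℝ, E6) x) :
    nablaForm E nabla A x u v w = ∑ j, ∑ k, A j k *
      (inner ℝ (nabla (E j) x u) v * inner ℝ (E k x) w +
        inner ℝ (nabla (E k) x u) w * inner ℝ (E j x) v) := by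
  simp [nablaForm, LinearMap.sum_apply, mul_add]

/-- The orthonormal basis of a tangent space given by an invariant frame. -/
noncomputable def IsInvariantFrame.basis {E : Fin 6 → Π x : M, TangentSpace 𝓘(ℝ, E6) x}
    (hE : IsInvariantFrame E) (x : M) :
    OrthonormalBasis (Fin 6) ℝ (TangentSpace 𝓘(ℝ, E6) x) :=
  (basisOfOrthonormalOfCardEqFinrank (hE.orthonormal x) (by
    rw [show Module.finrank ℝ (TangentSpace 𝓘(ℝ, E6) x) = Module.finrank ℝ E6 from rfl]
    simp)).toOrthonormalBasis (by simpa using hE.orthonormal x)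

lemma IsInvariantFrame.basis_apply {E : Fin 6 → Π x : M, TangentSpace 𝓘(ℝ, E6) x}
    (hE : IsInvariantFrame E) (x : M) (i : Fin 6) : hE.basis x i = E i x := by
  simp [IsInvariantFrame.basis]

lemma IsInvariantFrame.coe_basis {E : Fin 6 → Π x : M, TangentSpace 𝓘(ℝ, E6) x}
    (hE : IsInvariantFrame E) (x : M) : ⇑(hE.basis x) = fun i => E i x :=
  funext fun i => hE.basis_apply x i

lemma IsInvariantFrame.diffFieldAt {E : Fin 6 → Π x : M, TangentSpace 𝓘(ℝ, E6) x}
    (hE : IsInvariantFrame E) (i : Fin 6) (x : M) : DiffFieldAt (E i) x :=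
  ((hE.contMDiff i) x).mdifferentiableAt (by simp)

lemma IsInvariantFrame.inner_eq {E : Fin 6 → Π x : M, TangentSpace 𝓘(ℝ, E6) x}
    (hE : IsInvariantFrame E) (i j : Fin 6) (x : M) :
    inner ℝ (E i x) (E j x) = (1 : Matrix (Fin 6) (Fin 6) ℝ) i j := by
  rw [Matrix.one_apply]
  exact orthonormal_iff_ite.1 (hE.orthonormal x) i j

lemma IsInvariantFrame.inner_mlieBracket {E : Fin 6 → Π x : M, TangentSpace 𝓘(ℝ, E6) x}
    (hE : IsInvariantFrame E) (i j k : Fin 6) (x : M) :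
    inner ℝ (E k x) (VectorField.mlieBracket 𝓘(ℝ, E6) (E i) (E j) x) = -structureForm k i j := by
  have h := hE.structure_eq k i j x
  simp only [extDerivOneForm, hE.inner_eq, mvfderiv_const] at h
  simp only [zero_apply] at h
  linarith

variable [IsContMDiffRiemannianBundle 𝓘(ℝ, E6) ∞ E6 (fun x : M => TangentSpace 𝓘(ℝ, E6) x)]

/-- Koszul's formula: the frame has constant inner products, so metric compatibility makes the
coefficients skew in the last two indices, and the torsion equation expresses their skew part
through the brackets. -/
lemma inner_nabla {E : Fin 6 → Π x : M, TangentSpace 𝓘(ℝ, E6) x} (hE : IsInvariantFrame E)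
    {nabla : CovariantDerivative 𝓘(ℝ, E6) E6 (fun x : M => TangentSpace 𝓘(ℝ, E6) x)}
    (hnabla : IsLeviCivita nabla) (i j k : Fin 6) (x : M) :
    inner ℝ (nabla (E j) x (E i x)) (E k x) = christoffel i j k := by
  obtain ⟨htor, hmet⟩ := hnabla
  have hm : ∀ i j k, inner ℝ (nabla (E j) x (E i x)) (E k x) =
      -inner ℝ (nabla (E k) x (E i x)) (E j x) := by
    intro i j k
    have h := hmet.mvfderiv_inner_eq (E i) (hE.diffFieldAt j x) (hE.diffFieldAt k x)
    simp only [hE.inner_eq, mvfderiv_const, zero_apply] at h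
    rw [real_inner_comm (nabla (E k) x (E i x)) (E j x)] at h
    linarith
  have ht : ∀ i j k, inner ℝ (nabla (E j) x (E i x)) (E k x) -
      inner ℝ (nabla (E i) x (E j x)) (E k x) = -structureForm k i j := by
    intro i j k
    have h := (nabla.torsion_eq_zero_iff.1 htor) (hE.diffFieldAt i x) (hE.diffFieldAt j x)
    rw [← hE.inner_mlieBracket i j k x, ← h, inner_sub_right,
      real_inner_comm (E k x), real_inner_comm (E k x)]
  simp only [christoffel, Matrix.of_apply]
  linarith [ht i j k, ht j k i, ht k i j, hm i j k, hm j k i, hm k i j, hm i k j, hm j i k,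
    hm k j i, structureForm_skew j k i]

lemma nablaForm_frame {E : Fin 6 → Π x : M, TangentSpace 𝓘(ℝ, E6) x} (hE : IsInvariantFrame E)
    {nabla : CovariantDerivative 𝓘(ℝ, E6) E6 (fun x : M => TangentSpace 𝓘(ℝ, E6) x)}
    (hnabla : IsLeviCivita nabla) (A : Matrix (Fin 6) (Fin 6) ℝ) (x : M) (i j k : Fin 6) :
    nablaForm E nabla A x (hE.basis x i) (hE.basis x j) (hE.basis x k) = nablaCoeff A i j k := by
  have hs : ∀ i j k, christoffel i j k = -christoffel i k j := fun i j k =>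
    congr_fun (congr_fun (christoffel_transpose i) k) j
  simp only [hE.basis_apply, nablaForm_apply, inner_nabla hE hnabla, hE.inner_eq, mul_add,
    Finset.sum_add_distrib, Matrix.one_apply, mul_ite, mul_one, mul_zero, Finset.sum_ite_eq',
    Finset.mem_univ, if_true]
  rw [Finset.sum_comm (γ := Fin 6)]
  simp only [Finset.sum_ite_eq', Finset.mem_univ, if_true, nablaCoeff, Matrix.sub_apply,
    Matrix.mul_apply]
  have h : ∑ l, A l k * christoffel i l j = -∑ l, christoffel i j l * A l k := by
    rw [← Finset.sum_neg_distrib]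
    refine Finset.sum_congr rfl fun l _ => ?_
    rw [hs i l j]
    ring
  rw [h]
  ring

/-- Leibniz rule for `ω = ∑ A j k eʲ ⊗ eᵏ` with constant coefficients. By metric compatibility `∇eʲ
= g(∇Eⱼ, ·)`, so the terms that differentiate `Y` and `Z` cancel. -/
lemma isNablaFundamentalForm_nablaForm {E : Fin 6 → Π x : M, TangentSpace 𝓘(ℝ, E6) x}
    (hE : IsInvariantFrame E)
    {nabla : CovariantDerivative 𝓘(ℝ, E6) E6 (fun x : M => TangentSpace 𝓘(ℝ, E6) x)}
    (hnabla : IsLeviCivita nabla) (A : Matrix (Fin 6) (Fin 6) ℝ) (x : M) :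
    IsNablaFundamentalForm nabla (almostComplex E A) x (nablaForm E nabla A x) := by
  intro X Y Z hX hY hZ
  have hd : ∀ j, ∀ Y : Π y : M, TangentSpace 𝓘(ℝ, E6) y, DiffFieldAt Y x →
      MDifferentiableAt 𝓘(ℝ, E6) 𝓘(ℝ, ℝ) (fun y => inner ℝ (E j y) (Y y)) x :=
    fun j Y hY => MDifferentiableAt.inner_bundle (hE.diffFieldAt j x) hY
  have hm : ∀ j, ∀ Y : Π y : M, TangentSpace 𝓘(ℝ, E6) y, DiffFieldAt Y x →
      mvfderiv 𝓘(ℝ, E6) (fun y => inner ℝ (E j y) (Y y)) x (X x) =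
        inner ℝ (nabla (E j) x (X x)) (Y x) + inner ℝ (E j x) (nabla Y x (X x)) :=
    fun j Y hY => hnabla.2.mvfderiv_inner_eq X (hE.diffFieldAt j x) hY
  have hp : ∀ j k, MDifferentiableAt 𝓘(ℝ, E6) 𝓘(ℝ, ℝ)
      (fun y => inner ℝ (E j y) (Y y) * inner ℝ (E k y) (Z y)) x :=
    fun j k => (hd j Y hY).mul (hd k Z hZ)
  have hq : ∀ j k, MDifferentiableAt 𝓘(ℝ, E6) 𝓘(ℝ, ℝ)
      (fun y => A j k * (inner ℝ (E j y) (Y y) * inner ℝ (E k y) (Z y))) x :=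
    fun j k => mdifferentiableAt_const.mul (hp j k)
  have hr := fun j => mvfderiv_sum Finset.univ (fun k _ => hq j k)
  have hs := mvfderiv_sum Finset.univ (fun j _ => (hr j).1)
  simp only [fundamentalForm_almostComplex, nablaForm_apply]
  rw [hs.2]
  simp only [sum_apply, ← Finset.sum_sub_distrib]
  refine Finset.sum_congr rfl fun j _ => ?_
  rw [(hr j).2]
  simp only [sum_apply, ← Finset.sum_sub_distrib]
  refine Finset.sum_congr rfl fun k _ => ?_
  rw [mvfderiv_fun_mul mdifferentiableAt_const (hp j k), mvfderiv_fun_mul (hd j Y hY) (hd k Z hZ),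
    mvfderiv_const]
  simp only [add_apply, smul_apply, smul_eq_mul,
    zero_apply, hm j Y hY, hm k Z hZ]
  ring

/-- A tensor is determined by its values on the frame, and the frame fields are differentiable,
hence admissible in the defining identity. -/
lemma IsNablaFundamentalForm.eq_nablaForm {E : Fin 6 → Π x : M, TangentSpace 𝓘(ℝ, E6) x}
    (hE : IsInvariantFrame E)
    {nabla : CovariantDerivative 𝓘(ℝ, E6) E6 (fun x : M => TangentSpace 𝓘(ℝ, E6) x)}
    (hnabla : IsLeviCivita nabla) {A : Matrix (Fin 6) (Fin 6) ℝ} {x : M}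
    {T : TangentSpace 𝓘(ℝ, E6) x →ₗ[ℝ] TangentSpace 𝓘(ℝ, E6) x →ₗ[ℝ]
      TangentSpace 𝓘(ℝ, E6) x →ₗ[ℝ] ℝ}
    (hT : IsNablaFundamentalForm nabla (almostComplex E A) x T) : T = nablaForm E nabla A x := by
  refine tensor_ext (hE.basis x) fun i j k => ?_
  simp only [hE.basis_apply]
  have hi := hE.diffFieldAt i x
  have hj := hE.diffFieldAt j x
  have hk := hE.diffFieldAt k x
  rw [hT _ _ _ hi hj hk, isNablaFundamentalForm_nablaForm hE hnabla A x _ _ _ hi hj hk]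

lemma mem_ghClass_iff {E : Fin 6 → Π x : M, TangentSpace 𝓘(ℝ, E6) x} (hE : IsInvariantFrame E)
    {nabla : CovariantDerivative 𝓘(ℝ, E6) E6 (fun x : M => TangentSpace 𝓘(ℝ, E6) x)}
    (hnabla : IsLeviCivita nabla) (A : Matrix (Fin 6) (Fin 6) ℝ) (i j k : ℕ) :
    A ∈ ghClass E nabla i j k ↔ A ∈ Z ∧ ∀ x : M, nablaForm E nabla A x ∈
      component (frameEnd (hE.basis x) A) i ⊔ component (frameEnd (hE.basis x) A) j ⊔
        component (frameEnd (hE.basis x) A) k := by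
  refine and_congr_right fun _ => forall_congr' fun x => ?_
  rw [hE.coe_basis, ← almostComplex_eq_frameEnd]
  constructor
  · rintro ⟨T, hT, h⟩
    have e := h.eq_nablaForm hE hnabla
    subst e
    exact hT
  · exact fun h => ⟨_, h, isNablaFundamentalForm_nablaForm hE hnabla A x⟩

lemma nablaForm_mem_W {E : Fin 6 → Π x : M, TangentSpace 𝓘(ℝ, E6) x} (hE : IsInvariantFrame E)
    {nabla : CovariantDerivative 𝓘(ℝ, E6) E6 (fun x : M => TangentSpace 𝓘(ℝ, E6) x)}
    (hnabla : IsLeviCivita nabla) {A : Matrix (Fin 6) (Fin 6) ℝ} (hA : A ∈ Z) (x : M) :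
    nablaForm E nabla A x ∈ W (frameEnd (hE.basis x) A) := by
  obtain ⟨hs, hA, -⟩ := hA
  refine mem_W_of_basis (hE.basis x) (nablaForm_frame hE hnabla A x) (fun i => ?_) fun i => ?_
  · rw [nablaCoeff, Matrix.transpose_sub, Matrix.transpose_mul, Matrix.transpose_mul, hs,
      christoffel_transpose]
    noncomm_ring
  · have h : A * (nablaCoeff A i) * Aᵀ =
        -((A * A) * christoffel i * A) + A * christoffel i * (A * A) := by
      rw [nablaCoeff, hs]
      noncomm_ring
    rw [h, hA, nablaCoeff]
    noncomm_ring

end Manifold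

/-! ### The Nijenhuis tensor and the Lee form -/

section Nijenhuis

variable {V : Type*} [NormedAddCommGroup V] [InnerProductSpace ℝ V]

/-- The Nijenhuis tensor of an almost complex structure, in terms of the covariant derivative `α`
of its fundamental form. -/
def nijenhuis (J : V →ₗ[ℝ] V) (α : V →ₗ[ℝ] V →ₗ[ℝ] V →ₗ[ℝ] ℝ) (x y z : V) : ℝ :=
  α (J x) y z + α x (J y) z - α (J y) x z - α y (J x) z

/-- The cyclic sum is evaluated at `(J x, y, z)`: there `J² = -1` and the symmetries of `W J` turn
every term into a value of `α` or of its twist. -/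
lemma cyclic_of_nijenhuis {J : V →ₗ[ℝ] V} (hJ : ∀ x, J (J x) = -x)
    {α : V →ₗ[ℝ] V →ₗ[ℝ] V →ₗ[ℝ] ℝ} (h : α ∈ W J)
    (hN : ∀ x y z, nijenhuis J α x y z + nijenhuis J α y z x + nijenhuis J α z x y = 0)
    (x y z : V) : α x y z + α y z x + α z x y =
      α (J x) (J y) z + α (J y) (J z) x + α (J z) (J x) y := by
  have hr := twist_right hJ h
  have h' := hN (J x) y z
  simp only [nijenhuis, hJ, map_neg, LinearMap.neg_apply] at h'
  linarith [h.1 y z x, h.1 (J y) z (J x), hr (J y) z x, h.2 y z x, h.1 (J z) (J x) y,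
    hr (J z) x y, h.1 (J z) x (J y), h.1 (J z) y (J x), h.2 z y x, h.1 z x y, h.1 x y z,
    h.1 (J x) y (J z), hr (J x) y z]

variable [FiniteDimensional ℝ V]

/-- On the `+1` eigenspace `α (J x) y z = -α x (J y) z`, so the tensor vanishes there. On `W₁` it is
`4 α (J x) y z`, a 3-form. -/
lemma nijenhuis_skew_of_mem_W₁₃₄ {J : V →ₗ[ℝ] V} (hJ : ∀ x, J (J x) = -x)
    (hg : ∀ x y, inner ℝ (J x) (J y) = inner ℝ x y) (hn : (Module.finrank ℝ V : ℝ) ≠ 2)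
    {α : V →ₗ[ℝ] V →ₗ[ℝ] V →ₗ[ℝ] ℝ} (hα : α ∈ W₁ J ⊔ W₃ J ⊔ W₄ J) (x y z : V) :
    nijenhuis J α x y z = -nijenhuis J α x z y := by
  obtain ⟨δ, hδ, γ, hγ, rfl⟩ := Submodule.mem_sup.1 hα
  obtain ⟨β, h₁, β₃, h₃, rfl⟩ := Submodule.mem_sup.1 hδ
  have hzero : ∀ β : V →ₗ[ℝ] V →ₗ[ℝ] V →ₗ[ℝ] ℝ, (∀ x y z, β (J x) (J y) z = β x y z) →
      ∀ x y z, β (J x) y z + β x (J y) z = 0 := by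
    intro β hβ x y z
    have := hβ x (J y) z
    rw [hJ, map_neg, LinearMap.neg_apply] at this
    linarith
  have e₃ := hzero _ h₃.2.1
  have e₄ := hzero _ (twist_of_mem_W₄ hJ hg hn hγ)
  have hs := skew_of_mem_W₁ h₁
  have hl : ∀ x y z, β (J x) y z = β x (J y) z := by
    intro x y z
    have := twist_of_mem_W₁ h₁ x (J y) z
    rw [hJ, map_neg, LinearMap.neg_apply] at this
    linarith
  have hr := twist_right hJ h₁.1
  simp only [nijenhuis, LinearMap.add_apply]
  linarith [e₃ x y z, e₃ y x z, e₃ x z y, e₃ z x y, e₄ x y z, e₄ y x z, e₄ x z y, e₄ z x y,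
    hs y (J x) z, hs z (J x) y, hl x y z, hl y x z, hl x z y, hl z x y, hr x z y, h₁.1.1 x (J y) z]

lemma mem_W₂₃₄_of_nijenhuis {J : V →ₗ[ℝ] V} (hJ : ∀ x, J (J x) = -x)
    (hg : ∀ x y, inner ℝ (J x) (J y) = inner ℝ x y) (hn : (Module.finrank ℝ V : ℝ) ≠ 2)
    {α : V →ₗ[ℝ] V →ₗ[ℝ] V →ₗ[ℝ] ℝ} (h : α ∈ W J)
    (hN : ∀ x y z, nijenhuis J α x y z + nijenhuis J α y z x + nijenhuis J α z x y = 0) :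
    α ∈ W₂ J ⊔ W₃ J ⊔ W₄ J :=
  mem_W₂₃₄ hJ hg hn h (cyclic_of_nijenhuis hJ h hN)

/-- The left side is `dω(x, Jy, z) + dω(y, Jx, z)`, with `dω` the cyclic sum of `α`. The terms with
`z` in the first slot cancel; the others are the values of `α + T α` at `(x, J y, z)` and `(y, J x,
z)`, which the contraction determines. The identity involves only `dω`, so it is free of connection
coefficients. -/
lemma exists_lee_form_of_mem_W₁₂₄ {J : V →ₗ[ℝ] V} (hJ : ∀ x, J (J x) = -x)
    (hg : ∀ x y, inner ℝ (J x) (J y) = inner ℝ x y) (hn : (Module.finrank ℝ V : ℝ) = 6)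
    {α : V →ₗ[ℝ] V →ₗ[ℝ] V →ₗ[ℝ] ℝ} (h : α ∈ W J) (hα : α ∈ W₁ J ⊔ W₂ J ⊔ W₄ J) :
    ∃ θ : V →ₗ[ℝ] ℝ, ∀ x y z,
      (α x (J y) z + α (J y) z x + α z x (J y)) + (α y (J x) z + α (J x) z y + α z y (J x)) =
      2 * inner ℝ x y * θ z - θ x * inner ℝ y z - θ y * inner ℝ x z
        - θ (J x) * inner ℝ (J y) z - θ (J y) * inner ℝ (J x) z := by
  have hn' : (Module.finrank ℝ V : ℝ) ≠ 2 := by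
    rw [hn]
    norm_num
  have key := (mem_W₁₂₄_iff hJ hg hn' h).1 hα
  rw [hn] at key
  refine ⟨(1 / 2 : ℝ) • contraction α ∘ₗ J, fun x y z => ?_⟩
  have k₁ := key x (J y) z
  have k₂ := key y (J x) z
  have hi := inner_skew hJ hg
  have i₁ : inner ℝ x (J z) = -inner ℝ (J x) z := by rw [hi, neg_neg]
  have i₂ : inner ℝ x (J y) = -inner ℝ (J x) y := by rw [hi, neg_neg]
  have i₃ : inner ℝ y (J z) = -inner ℝ (J y) z := by rw [hi, neg_neg]
  have i₄ : inner ℝ y (J x) = inner ℝ (J x) y := real_inner_comm _ _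
  have i₅ : inner ℝ y x = inner ℝ x y := real_inner_comm _ _
  simp only [traceTensor_apply, hJ, map_neg, LinearMap.neg_apply, inner_neg_right, i₁, i₂, i₃,
    i₄, i₅] at k₁ k₂
  simp only [LinearMap.smul_apply, LinearMap.comp_apply, smul_eq_mul, hJ, map_neg]
  linarith [twist_right hJ h z y x, h.1 z x (J y), h.1 z y (J x), h.1 (J y) x z, h.1 (J x) y z]

end Nijenhuis

/-! ### Structure constants as matrices -/

section Entries

lemma structureForm_of_lt {k : Fin 6} (hk : k < 4) : structureForm k = 0 := by
  fin_cases k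
  · rfl
  · rfl
  · rfl
  · rfl
  · exact absurd hk (by decide)
  · exact absurd hk (by decide)

lemma structureForm_four : structureForm 4 = !![0, 1, 0, 0, 0, 0; -1, 0, 0, 0, 0, 0;
    0, 0, 0, 0, 0, 0; 0, 0, 0, 0, 0, 0; 0, 0, 0, 0, 0, 0; 0, 0, 0, 0, 0, 0] := by
  rw [show structureForm 4 = eForm₂ 1 2 from rfl]
  ext i j
  fin_cases i <;> fin_cases j <;> simp [eForm₂, wedge, eForm]

lemma structureForm_five : structureForm 5 = !![0, 0, 0, 0, 1, 0; 0, 0, 0, 0, 0, 0;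
    0, 0, 0, 1, 0, 0; 0, 0, -1, 0, 0, 0; -1, 0, 0, 0, 0, 0; 0, 0, 0, 0, 0, 0] := by
  rw [show structureForm 5 = eForm₂ 1 5 + eForm₂ 3 4 from rfl]
  ext i j
  fin_cases i <;> fin_cases j <;> simp [eForm₂, wedge, eForm]

end Entries

/-! ### Eliminating the connection coefficients -/

section Coefficients

/-- The components `N(Eᵢ, Eⱼ, Eₖ)` of the Nijenhuis tensor, for fixed `k`. -/
noncomputable def nijenhuisCoeff (A : Matrix (Fin 6) (Fin 6) ℝ) (k : Fin 6) :
    Matrix (Fin 6) (Fin 6) ℝ :=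
  structureForm k + A * structureForm k * A +
    ∑ q, A q k • (A * structureForm q - structureForm q * A)

/-- The components of the exterior derivative of the fundamental form. -/
noncomputable def extDerivCoeff (A : Matrix (Fin 6) (Fin 6) ℝ) (i j k : Fin 6) : ℝ :=
  ∑ q, (structureForm q i j * A q k + structureForm q j k * A q i + structureForm q k i * A q j)

lemma christoffel_torsion (i j k : Fin 6) :
    christoffel i j k - christoffel j i k = -structureForm k i j := by
  simp only [christoffel, Matrix.of_apply]
  linarith [structureForm_skew k i j, structureForm_skew i j k, structureForm_skew j k i]

lemma christoffel_skew (i j k : Fin 6) : christoffel i j k = -christoffel i k j :=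
  congr_fun (congr_fun (christoffel_transpose i) k) j

variable {A : Matrix (Fin 6) (Fin 6) ℝ}

lemma apply_skew (hs : Aᵀ = -A) (i j : Fin 6) : A i j = -A j i :=
  congr_fun (congr_fun hs j) i

/-- For a torsion-free connection the alternation of `∇ω` is `dω`: the connection coefficients pair
up into torsion differences. -/
lemma nablaCoeff_cyclic (hs : Aᵀ = -A) (i j k : Fin 6) :
    nablaCoeff A i j k + nablaCoeff A j k i + nablaCoeff A k i j = extDerivCoeff A i j k := by
  simp only [nablaCoeff, Matrix.sub_apply, Matrix.mul_apply, extDerivCoeff,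
    ← Finset.sum_sub_distrib, ← Finset.sum_add_distrib]
  refine Finset.sum_congr rfl fun l _ => ?_
  rw [apply_skew hs j l, apply_skew hs k l, apply_skew hs i l, christoffel_skew i l k,
    christoffel_skew j l i, christoffel_skew k l j]
  linear_combination (-A l k) * christoffel_torsion i j l - A l i * christoffel_torsion j k l
    - A l j * christoffel_torsion k i l

lemma nijenhuisCoeff_eq (hs : Aᵀ = -A) (hA : A * A = -1) (i j k : Fin 6) :
    ∑ p, A i p * nablaCoeff A p j k + ∑ p, A j p * nablaCoeff A i p k
      - ∑ p, A j p * nablaCoeff A p i k - ∑ p, A i p * nablaCoeff A j p k =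
      nijenhuisCoeff A k i j := by
  -- The relation `A² = -1` collapses `A (A Γᵢ - Γᵢ A)` to `-Γᵢ - A Γᵢ A`.
  have hB : ∀ i j, ∑ p, A j p * nablaCoeff A i p k =
      -christoffel i j k - ∑ p, ∑ q, A j p * christoffel i p q * A q k := by
    intro i j
    have h : A * nablaCoeff A i = -christoffel i - A * christoffel i * A := by
      rw [nablaCoeff, mul_sub, ← mul_assoc, hA, mul_assoc]
      noncomm_ring
    rw [← Matrix.mul_apply, h]
    simp only [Matrix.sub_apply, Matrix.neg_apply, Matrix.mul_apply, Finset.sum_mul]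
    rw [Finset.sum_comm]
  have hC : ∀ i j, ∑ p, A i p * nablaCoeff A p j k =
      ∑ p, ∑ q, (A i p * A j q * christoffel p q k - A i p * christoffel p j q * A q k) := by
    intro i j
    simp only [nablaCoeff, Matrix.sub_apply, Matrix.mul_apply, ← Finset.sum_sub_distrib,
      Finset.mul_sum]
    refine Finset.sum_congr rfl fun p _ => Finset.sum_congr rfl fun q _ => ?_
    ring
  have hD : nijenhuisCoeff A k i j = structureForm k i j +
      ∑ p, ∑ q, (-(A i p * A j q * structureForm k p q)
        + A q k * (A i p * structureForm q p j) + A q k * (structureForm q i p * A j p)) := by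
    have h₁ : (A * structureForm k * A) i j =
        ∑ p, ∑ q, -(A i p * A j q * structureForm k p q) := by
      simp only [Matrix.mul_apply, Finset.sum_mul]
      rw [Finset.sum_comm]
      refine Finset.sum_congr rfl fun p _ => Finset.sum_congr rfl fun q _ => ?_
      rw [apply_skew hs q j]
      ring
    have h₂ : (∑ q, A q k • (A * structureForm q - structureForm q * A)) i j =
        ∑ p, ∑ q, (A q k * (A i p * structureForm q p j)
          + A q k * (structureForm q i p * A j p)) := by
      rw [Finset.sum_comm, Matrix.sum_apply]
      refine Finset.sum_congr rfl fun q _ => ?_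
      simp only [Matrix.smul_apply, Matrix.sub_apply, Matrix.mul_apply, smul_eq_mul,
        ← Finset.sum_sub_distrib, Finset.mul_sum]
      refine Finset.sum_congr rfl fun p _ => ?_
      rw [apply_skew hs p j]
      ring
    rw [nijenhuisCoeff, Matrix.add_apply, Matrix.add_apply, h₁, h₂]
    simp only [Finset.sum_add_distrib]
    ring
  -- Termwise, the six connection coefficients form three torsion differences, each a structure
  -- constant.
  have hE : ∑ p, ∑ q, (A i p * A j q * christoffel p q k - A i p * christoffel p j q * A q k
      - A j p * christoffel i p q * A q k - A i p * A j q * christoffel q p k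
      + A j p * christoffel p i q * A q k + A i p * christoffel j p q * A q k) =
      ∑ p, ∑ q, (-(A i p * A j q * structureForm k p q)
        + A q k * (A i p * structureForm q p j) + A q k * (structureForm q i p * A j p)) := by
    refine Finset.sum_congr rfl fun p _ => Finset.sum_congr rfl fun q _ => ?_
    linear_combination A i p * A j q * christoffel_torsion p q k
      - A i p * A q k * christoffel_torsion p j q - A j p * A q k * christoffel_torsion i p q
  have hsw : ∑ p, ∑ q, A j p * A i q * christoffel p q k =
      ∑ p, ∑ q, A i p * A j q * christoffel q p k := by
    rw [Finset.sum_comm]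
    refine Finset.sum_congr rfl fun p _ => Finset.sum_congr rfl fun q _ => ?_
    ring
  rw [hB i j, hB j i, hC i j, hC j i, hD, ← hE]
  simp only [Finset.sum_add_distrib, Finset.sum_sub_distrib]
  linarith [christoffel_torsion i j k]

lemma nijenhuisCoeff_expand (k : Fin 6) :
    nijenhuisCoeff A k = structureForm k + A * structureForm k * A +
      (A 4 k • (A * structureForm 4 - structureForm 4 * A) +
        A 5 k • (A * structureForm 5 - structureForm 5 * A)) := by
  rw [nijenhuisCoeff, Fin.sum_univ_six, structureForm_of_lt (k := 0) (by decide),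
    structureForm_of_lt (k := 1) (by decide), structureForm_of_lt (k := 2) (by decide),
    structureForm_of_lt (k := 3) (by decide)]
  simp

lemma extDerivCoeff_expand (i j k : Fin 6) :
    extDerivCoeff A i j k =
      structureForm 4 i j * A 4 k + structureForm 4 j k * A 4 i + structureForm 4 k i * A 4 j +
      (structureForm 5 i j * A 5 k + structureForm 5 j k * A 5 i
          + structureForm 5 k i * A 5 j) := by
  rw [extDerivCoeff, Fin.sum_univ_six, structureForm_of_lt (k := 0) (by decide),
    structureForm_of_lt (k := 1) (by decide), structureForm_of_lt (k := 2) (by decide),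
    structureForm_of_lt (k := 3) (by decide)]
  simp

/-- The contraction is `-⟨ω, deᵏ⟩`. One half of the commutator drops out because `Γᵢ` has zero
`i`-th row; the other is a torsion term once `A` is skew-symmetrized. -/
lemma nablaCoeff_contraction (hs : Aᵀ = -A) (k : Fin 6) :
    ∑ i, nablaCoeff A i i k = -(1 / 2) * ∑ i, ∑ l, A i l * structureForm k i l := by
  -- No `eⁱ` occurs in its own exterior derivative.
  have hd : ∀ i l, christoffel i i l = 0 := by
    intro i l
    have h : structureForm i i l = 0 := by
      by_cases hi : i < 4
      · rw [structureForm_of_lt hi, Matrix.zero_apply]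
      · obtain rfl | rfl : i = 4 ∨ i = 5 := by omega
        · rw [structureForm_four]
          fin_cases l <;> simp
        · rw [structureForm_five]
          fin_cases l <;> simp
    simp only [christoffel, Matrix.of_apply]
    linarith [structureForm_skew l i i, structureForm_skew i i l]
  have h₁ : ∑ i, nablaCoeff A i i k = ∑ i, ∑ l, A i l * christoffel i l k := by
    simp only [nablaCoeff, Matrix.sub_apply, Matrix.mul_apply, hd, zero_mul,
      Finset.sum_const_zero, sub_zero]
  have h₂ : ∑ i, ∑ l, A i l * christoffel i l k = -∑ i, ∑ l, A i l * christoffel l i k := by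
    rw [Finset.sum_comm, ← Finset.sum_neg_distrib]
    refine Finset.sum_congr rfl fun i _ => ?_
    rw [← Finset.sum_neg_distrib]
    refine Finset.sum_congr rfl fun l _ => ?_
    rw [apply_skew hs l i]
    ring
  have h₃ : ∑ i, ∑ l, A i l * christoffel i l k - ∑ i, ∑ l, A i l * christoffel l i k =
      -∑ i, ∑ l, A i l * structureForm k i l := by
    simp only [← Finset.sum_sub_distrib, ← Finset.sum_neg_distrib]
    refine Finset.sum_congr rfl fun i _ => Finset.sum_congr rfl fun l _ => ?_
    linear_combination A i l * christoffel_torsion i l k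
  rw [h₁]
  linarith

end Coefficients

/-! ### Membership in the classes as conditions on matrix entries -/

section Classes

variable {V : Type*} [NormedAddCommGroup V] [InnerProductSpace ℝ V]

lemma nijenhuis_basis (b : OrthonormalBasis (Fin 6) ℝ V) {A : Matrix (Fin 6) (Fin 6) ℝ}
    (hA : A * A = -1) (hs : Aᵀ = -A) {α : V →ₗ[ℝ] V →ₗ[ℝ] V →ₗ[ℝ] ℝ}
    (hτ : ∀ i j k, α (b i) (b j) (b k) = nablaCoeff A i j k) (i j k : Fin 6) :
    nijenhuis (frameEnd b A) α (b i) (b j) (b k) = nijenhuisCoeff A k i j := by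
  rw [← nijenhuisCoeff_eq hs hA]
  simp only [nijenhuis, frameEnd_basis, map_sum, map_smul, LinearMap.sum_apply,
    LinearMap.smul_apply, smul_eq_mul, hτ]

/-- The Nijenhuis tensor as a trilinear map. -/
noncomputable def nijenhuisMap (J : V →ₗ[ℝ] V) (α : V →ₗ[ℝ] V →ₗ[ℝ] V →ₗ[ℝ] ℝ) :
    V →ₗ[ℝ] V →ₗ[ℝ] V →ₗ[ℝ] ℝ :=
  α.comp J + α.compl₂ J + (-1 : ℝ) • (α.comp J + α.compl₂ J).flip

lemma nijenhuisMap_apply (J : V →ₗ[ℝ] V) (α : V →ₗ[ℝ] V →ₗ[ℝ] V →ₗ[ℝ] ℝ) (x y z : V) :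
    nijenhuisMap J α x y z = nijenhuis J α x y z := by
  simp [nijenhuisMap, nijenhuis]
  ring

variable {M : Type*} [TopologicalSpace M] [ChartedSpace E6 M]
    [RiemannianBundle (fun x : M => TangentSpace 𝓘(ℝ, E6) x)] [IsManifold 𝓘(ℝ, E6) ∞ M]
    [IsContMDiffRiemannianBundle 𝓘(ℝ, E6) ∞ E6 (fun x : M => TangentSpace 𝓘(ℝ, E6) x)]
    {E : Fin 6 → Π x : M, TangentSpace 𝓘(ℝ, E6) x}
    {nabla : CovariantDerivative 𝓘(ℝ, E6) E6 (fun x : M => TangentSpace 𝓘(ℝ, E6) x)}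
    {A : Matrix (Fin 6) (Fin 6) ℝ}

lemma nijenhuisCoeff_skew_of_mem [Nonempty M] (hE : IsInvariantFrame E)
    (hnabla : IsLeviCivita nabla) (h : A ∈ ghClass E nabla 1 3 4) (i j k : Fin 6) :
    nijenhuisCoeff A k i j = -nijenhuisCoeff A j i k := by
  obtain ⟨⟨hs, hA, -⟩, h⟩ := (mem_ghClass_iff hE hnabla A 1 3 4).1 h
  obtain ⟨x⟩ := ‹Nonempty M›
  have hn : (Module.finrank ℝ (TangentSpace 𝓘(ℝ, E6) x) : ℝ) ≠ 2 := by
    rw [finrank_eq_six (hE.basis x)]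
    norm_num
  have hτ := nablaForm_frame hE hnabla A x
  have := nijenhuis_skew_of_mem_W₁₃₄ (frameEnd_frameEnd (hE.basis x) hA)
    (inner_frameEnd_frameEnd (hE.basis x) hA hs) hn (h x) (hE.basis x i) (hE.basis x j)
    (hE.basis x k)
  rwa [nijenhuis_basis _ hA hs hτ, nijenhuis_basis _ hA hs hτ] at this

lemma mem_ghClass_two_three_four (hE : IsInvariantFrame E)
    (hnabla : IsLeviCivita nabla) (hZ : A ∈ Z)
    (h : ∀ i j k, nijenhuisCoeff A k i j + nijenhuisCoeff A i j k + nijenhuisCoeff A j k i = 0) :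
    A ∈ ghClass E nabla 2 3 4 := by
  refine (mem_ghClass_iff hE hnabla A 2 3 4).2 ⟨hZ, fun x => ?_⟩
  have hW := nablaForm_mem_W hE hnabla hZ x
  obtain ⟨hs, hA, -⟩ := hZ
  have hn : (Module.finrank ℝ (TangentSpace 𝓘(ℝ, E6) x) : ℝ) ≠ 2 := by
    rw [finrank_eq_six (hE.basis x)]
    norm_num
  have hτ := nablaForm_frame hE hnabla A x
  refine mem_W₂₃₄_of_nijenhuis (frameEnd_frameEnd (hE.basis x) hA)
    (inner_frameEnd_frameEnd (hE.basis x) hA hs) hn hW ?_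
  set β := nijenhuisMap (frameEnd (hE.basis x) A) (nablaForm E nabla A x) with hβ
  have h₀ : β + rotate β + rotate (rotate β) = 0 := by
    refine tensor_ext (hE.basis x) fun i j k => ?_
    simp only [LinearMap.add_apply, rotate_apply, hβ, nijenhuisMap_apply,
      nijenhuis_basis _ hA hs hτ, h, LinearMap.zero_apply]
  intro u v w
  simp only [← nijenhuisMap_apply]
  exact congrArg (fun γ => γ u v w) h₀

/-- The two hypotheses say that `ω` is orthogonal to `de⁵` and `de⁶`; the other coframe elements are
closed. -/
lemma mem_ghClass_one_two_three (hE : IsInvariantFrame E)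
    (hnabla : IsLeviCivita nabla) (hZ : A ∈ Z) (h₁ : A 0 1 = 0) (h₂ : A 0 4 + A 2 3 = 0) :
    A ∈ ghClass E nabla 1 2 3 := by
  refine (mem_ghClass_iff hE hnabla A 1 2 3).2 ⟨hZ, fun x => ?_⟩
  have hW := nablaForm_mem_W hE hnabla hZ x
  obtain ⟨hs, hA, -⟩ := hZ
  refine mem_W₁₂₃_of_basis (hE.basis x) hA hs (nablaForm_frame hE hnabla A x) hW fun k => ?_
  rw [nablaCoeff_contraction hs]
  by_cases hk : k < 4
  · simp [structureForm_of_lt hk]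
  · obtain rfl | rfl : k = 4 ∨ k = 5 := by omega
    · simp [structureForm_four, Fin.sum_univ_six, apply_skew hs 1 0, h₁]
    · simp [structureForm_five, Fin.sum_univ_six, apply_skew hs 4 0, apply_skew hs 3 2]
      linarith

lemma exists_lee_form_of_mem [Nonempty M] (hE : IsInvariantFrame E)
    (hnabla : IsLeviCivita nabla) (h : A ∈ ghClass E nabla 1 2 4) :
    ∃ t : Fin 6 → ℝ, ∀ i j k,
      ∑ q, A j q * extDerivCoeff A i q k + ∑ q, A i q * extDerivCoeff A j q k =
      2 * (1 : Matrix (Fin 6) (Fin 6) ℝ) i j * t k - t i * (1 : Matrix (Fin 6) (Fin 6) ℝ) j k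
        - t j * (1 : Matrix (Fin 6) (Fin 6) ℝ) i k - (∑ q, A i q * t q) * A j k
        - (∑ q, A j q * t q) * A i k := by
  obtain ⟨hZ, h⟩ := (mem_ghClass_iff hE hnabla A 1 2 4).1 h
  obtain ⟨x⟩ := ‹Nonempty M›
  have hW := nablaForm_mem_W hE hnabla hZ x
  obtain ⟨hs, hA, -⟩ := hZ
  have hτ := nablaForm_frame hE hnabla A x
  obtain ⟨θ, hθ⟩ := exists_lee_form_of_mem_W₁₂₄ (frameEnd_frameEnd (hE.basis x) hA)
    (inner_frameEnd_frameEnd (hE.basis x) hA hs) (finrank_eq_six (hE.basis x)) hW (h x)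
  refine ⟨fun i => θ (hE.basis x i), fun i j k => ?_⟩
  have h₁ := hθ (hE.basis x i) (hE.basis x j) (hE.basis x k)
  have hinner : ∀ i j, inner ℝ (frameEnd (hE.basis x) A (hE.basis x i)) (hE.basis x j) =
      A i j := by
    intro i j
    simp [frameEnd_basis, sum_inner, inner_smul_left, (hE.basis x).inner_eq_ite]
  rw [hinner, hinner] at h₁
  simp only [frameEnd_basis, map_sum, map_smul, LinearMap.sum_apply,
    LinearMap.smul_apply, smul_eq_mul, hτ, (hE.basis x).inner_eq_ite, ← Matrix.one_apply,
    ← Finset.sum_add_distrib, ← mul_add, nablaCoeff_cyclic hs] at h₁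
  rw [← Finset.sum_add_distrib]
  simpa only [← Finset.sum_add_distrib, ← mul_add, nablaCoeff_cyclic hs] using h₁

lemma mem_ghClass_one_two_four (hE : IsInvariantFrame E)
    (hnabla : IsLeviCivita nabla) (hZ : A ∈ Z)
    (h : ∀ i j k, 2 * (nablaCoeff A i j k + ∑ p, ∑ q, A i p * A j q * nablaCoeff A p q k) =
        (1 : Matrix (Fin 6) (Fin 6) ℝ) i j * ∑ l, nablaCoeff A l l k
        - (1 : Matrix (Fin 6) (Fin 6) ℝ) i k * ∑ l, nablaCoeff A l l j
        - A j i * ∑ m, A k m * ∑ l, nablaCoeff A l l m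
        + A k i * ∑ m, A j m * ∑ l, nablaCoeff A l l m) :
    A ∈ ghClass E nabla 1 2 4 :=
  (mem_ghClass_iff hE hnabla A 1 2 4).2 ⟨hZ, fun x =>
    (mem_W₁₂₄_iff_basis (hE.basis x) hZ.2.1 hZ.1 (nablaForm_frame hE hnabla A x)
      (nablaForm_mem_W hE hnabla hZ x)).2 h⟩

end Classes

/-! ### Emptiness of `𝒵₁₃₄` -/

section Invariant

variable {A : Matrix (Fin 6) (Fin 6) ℝ}

lemma row_orthonormal (hs : Aᵀ = -A) (hA : A * A = -1) (i j : Fin 6) :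
    A i 0 * A j 0 + A i 1 * A j 1 + A i 2 * A j 2 + A i 3 * A j 3 + A i 4 * A j 4
      + A i 5 * A j 5 = (1 : Matrix (Fin 6) (Fin 6) ℝ) i j := by
  have h : A * Aᵀ = 1 := by rw [hs, mul_neg, hA, neg_neg]
  rw [← h, Matrix.mul_apply, Fin.sum_univ_six]
  rfl

lemma lower_entries (hs : Aᵀ = -A) : (∀ i, A i i = 0) ∧
    A 1 0 = -A 0 1 ∧
    A 2 0 = -A 0 2 ∧ A 2 1 = -A 1 2 ∧
    A 3 0 = -A 0 3 ∧ A 3 1 = -A 1 3 ∧ A 3 2 = -A 2 3 ∧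
    A 4 0 = -A 0 4 ∧ A 4 1 = -A 1 4 ∧ A 4 2 = -A 2 4 ∧ A 4 3 = -A 3 4 ∧
    A 5 0 = -A 0 5 ∧ A 5 1 = -A 1 5 ∧ A 5 2 = -A 2 5 ∧ A 5 3 = -A 3 5 ∧ A 5 4 = -A 4 5 :=
  ⟨fun i => by linarith [apply_skew hs i i], apply_skew hs _ _, apply_skew hs _ _,
    apply_skew hs _ _, apply_skew hs _ _, apply_skew hs _ _, apply_skew hs _ _, apply_skew hs _ _,
    apply_skew hs _ _, apply_skew hs _ _, apply_skew hs _ _, apply_skew hs _ _, apply_skew hs _ _,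
    apply_skew hs _ _, apply_skew hs _ _, apply_skew hs _ _⟩

lemma nijenhuisCoeff_eq_add (k i j : Fin 6) :
    nijenhuisCoeff A k i j = (structureForm k + A * structureForm k * A) i j +
      (A 4 k * (A i 0 * structureForm 4 0 j + A i 1 * structureForm 4 1 j
      - structureForm 4 i 0 * A 0 j - structureForm 4 i 1 * A 1 j) + A 5 k *
      (A i 0 * structureForm 5 0 j + A i 2 * structureForm 5 2 j + A i 3 * structureForm 5 3 j
      + A i 4 * structureForm 5 4 j - structureForm 5 i 0 * A 0 j - structureForm 5 i 2 * A 2 j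
      - structureForm 5 i 3 * A 3 j - structureForm 5 i 4 * A 4 j)) := by
  rw [nijenhuisCoeff_expand, Matrix.add_apply]
  congr 1
  simp only [Matrix.add_apply, Matrix.smul_apply, Matrix.sub_apply, Matrix.mul_apply,
    Fin.sum_univ_six, smul_eq_mul]
  have h₄ : ∀ i, structureForm 4 i 2 = 0 ∧ structureForm 4 i 3 = 0 ∧ structureForm 4 i 4 = 0 ∧
      structureForm 4 i 5 = 0 := by
    intro i
    rw [structureForm_four]
    fin_cases i <;> simp
  have h₅ : ∀ i, structureForm 5 i 1 = 0 ∧ structureForm 5 i 5 = 0 := by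
    intro i
    rw [structureForm_five]
    fin_cases i <;> simp
  rw [(h₄ i).1, (h₄ i).2.1, (h₄ i).2.2.1, (h₄ i).2.2.2, (h₅ i).1, (h₅ i).2,
    structureForm_skew 4 2, structureForm_skew 4 3, structureForm_skew 4 4, structureForm_skew 4 5,
    (h₄ j).1, (h₄ j).2.1, (h₄ j).2.2.1, (h₄ j).2.2.2, structureForm_skew 5 1,
    structureForm_skew 5 5, (h₅ j).1, (h₅ j).2]
  ring

lemma nijenhuisCoeff_of_lt {k : Fin 6} (hk : k < 4) (i j : Fin 6) :
    nijenhuisCoeff A k i j = A 4 k * (A i 0 * structureForm 4 0 j + A i 1 * structureForm 4 1 j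
      - structureForm 4 i 0 * A 0 j - structureForm 4 i 1 * A 1 j) + A 5 k *
      (A i 0 * structureForm 5 0 j + A i 2 * structureForm 5 2 j + A i 3 * structureForm 5 3 j
      + A i 4 * structureForm 5 4 j - structureForm 5 i 0 * A 0 j - structureForm 5 i 2 * A 2 j
      - structureForm 5 i 3 * A 3 j - structureForm 5 i 4 * A 4 j) := by
  rw [nijenhuisCoeff_eq_add, structureForm_of_lt hk]
  simp

/-- No orthogonal almost complex structure has a totally skew Nijenhuis tensor. -/
theorem not_nijenhuisCoeff_skew (hs : Aᵀ = -A) (hA : A * A = -1)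
    (hN : ∀ i j k, nijenhuisCoeff A k i j = -nijenhuisCoeff A j i k) : False := by
  have hr := row_orthonormal hs hA
  have hl := lower_entries hs
  -- Since `e¹, …, e⁴` are closed, these components have only terms with a factor from row `4` or
  -- `5` of `A`.
  have hN' : ∀ i k l : Fin 6, k < 4 → l < 4 → _ := fun i k l hk hl =>
    (nijenhuisCoeff_of_lt hl i k).symm.trans
      ((hN i k l).trans (congrArg Neg.neg (nijenhuisCoeff_of_lt hk i l)))
  simp only [structureForm_four, structureForm_five] at hN'
  have e221 : -A 1 4 * A 1 5 = 0 := by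
    have h := hN' 0 1 1 (by decide) (by decide)
    simp only [Matrix.of_apply, Matrix.cons_val, hl] at h
    linarith
  have e112 : A 0 5 * A 1 4 = 0 := by
    have h := hN' 1 0 0 (by decide) (by decide)
    simp only [Matrix.of_apply, Matrix.cons_val, hl] at h
    linarith
  have e115 : -A 0 4 * A 1 4 = 0 := by
    have h := hN' 4 0 0 (by decide) (by decide)
    simp only [Matrix.of_apply, Matrix.cons_val, hl] at h
    linarith
  have e223 : A 0 2 * A 1 4 - A 1 3 * A 1 5 = 0 := by
    have h := hN' 2 1 1 (by decide) (by decide)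
    simp only [Matrix.of_apply, Matrix.cons_val, hl] at h
    linarith
  have e224 : A 0 3 * A 1 4 + A 1 2 * A 1 5 = 0 := by
    have h := hN' 3 1 1 (by decide) (by decide)
    simp only [Matrix.of_apply, Matrix.cons_val, hl] at h
    linarith
  have e225 : -A 0 1 * A 1 5 + A 0 4 * A 1 4 = 0 := by
    have h := hN' 4 1 1 (by decide) (by decide)
    simp only [Matrix.of_apply, Matrix.cons_val, hl] at h
    linarith
  have e116 : -A 0 4 * A 1 5 - A 0 5 * A 4 5 = 0 := by
    have h := hN' 5 0 0 (by decide) (by decide)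
    simp only [Matrix.of_apply, Matrix.cons_val, hl] at h
    linarith
  have e136 : -A 0 5 * A 3 5 - A 1 5 * A 2 4 - A 2 5 * A 4 5 = 0 := by
    have h := hN' 5 0 2 (by decide) (by decide)
    simp only [Matrix.of_apply, Matrix.cons_val, hl] at h
    linarith
  have e146 : A 0 5 * A 2 5 - A 1 5 * A 3 4 - A 3 5 * A 4 5 = 0 := by
    have h := hN' 5 0 3 (by decide) (by decide)
    simp only [Matrix.of_apply, Matrix.cons_val, hl] at h
    linarith
  have e126 : A 0 4 * A 0 5 - A 1 4 * A 1 5 - A 1 5 * A 4 5 = 0 := by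
    have h := hN' 5 0 1 (by decide) (by decide)
    simp only [Matrix.of_apply, Matrix.cons_val, hl] at h
    linarith
  have e125 : -A 0 1 * A 0 5 + A 0 4 * A 0 4 - A 1 4 * A 1 4 = 0 := by
    have h := hN' 4 0 1 (by decide) (by decide)
    simp only [Matrix.of_apply, Matrix.cons_val, hl] at h
    linarith
  have e123 : A 0 2 * A 0 4 - A 0 3 * A 1 5 - A 0 5 * A 1 3 - A 1 2 * A 1 4
      + A 1 5 * A 2 4 = 0 := by
    have h := hN' 2 0 1 (by decide) (by decide)
    simp only [Matrix.of_apply, Matrix.cons_val, hl] at h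
    linarith
  have e124 : A 0 2 * A 1 5 + A 0 3 * A 0 4 + A 0 5 * A 1 2 - A 1 3 * A 1 4
      + A 1 5 * A 3 4 = 0 := by
    have h := hN' 3 0 1 (by decide) (by decide)
    simp only [Matrix.of_apply, Matrix.cons_val, hl] at h
    linarith
  have e336 : -A 2 5 * A 3 5 = 0 := by
    have h := hN' 5 2 2 (by decide) (by decide)
    simp only [Matrix.of_apply, Matrix.cons_val, hl] at h
    linarith
  have e235 : -A 0 1 * A 2 5 - A 0 2 * A 1 5 + A 0 4 * A 2 4 - A 1 5 * A 3 4 = 0 := by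
    have h := hN' 4 1 2 (by decide) (by decide)
    simp only [Matrix.of_apply, Matrix.cons_val, hl] at h
    linarith
  have e233 : A 0 2 * A 2 4 - A 1 3 * A 2 5 = 0 := by
    have h := hN' 2 1 2 (by decide) (by decide)
    simp only [Matrix.of_apply, Matrix.cons_val, hl] at h
    linarith
  have e234 : A 0 3 * A 2 4 + A 1 2 * A 2 5 = 0 := by
    have h := hN' 3 1 2 (by decide) (by decide)
    simp only [Matrix.of_apply, Matrix.cons_val, hl] at h
    linarith
  have e245 : -A 0 1 * A 3 5 - A 0 3 * A 1 5 + A 0 4 * A 3 4 + A 1 5 * A 2 4 = 0 := by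
    have h := hN' 4 1 3 (by decide) (by decide)
    simp only [Matrix.of_apply, Matrix.cons_val, hl] at h
    linarith
  have e243 : A 0 2 * A 3 4 - A 1 3 * A 3 5 = 0 := by
    have h := hN' 2 1 3 (by decide) (by decide)
    simp only [Matrix.of_apply, Matrix.cons_val, hl] at h
    linarith
  have e244 : A 0 3 * A 3 4 + A 1 2 * A 3 5 = 0 := by
    have h := hN' 3 1 3 (by decide) (by decide)
    simp only [Matrix.of_apply, Matrix.cons_val, hl] at h
    linarith
  have r0 : A 0 1 * A 0 1 + A 0 2 * A 0 2 + A 0 3 * A 0 3 + A 0 4 * A 0 4 + A 0 5 * A 0 5 = 1 := by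
    have h := hr 0 0
    simp only [hl, Matrix.one_apply_eq] at h
    linarith
  have r1 : A 0 1 * A 0 1 + A 1 2 * A 1 2 + A 1 3 * A 1 3 + A 1 4 * A 1 4 + A 1 5 * A 1 5 = 1 := by
    have h := hr 1 1
    simp only [hl, Matrix.one_apply_eq] at h
    linarith
  have r2 : A 0 2 * A 0 2 + A 1 2 * A 1 2 + A 2 3 * A 2 3 + A 2 4 * A 2 4 + A 2 5 * A 2 5 = 1 := by
    have h := hr 2 2
    simp only [hl, Matrix.one_apply_eq] at h
    linarith
  have r3 : A 0 3 * A 0 3 + A 1 3 * A 1 3 + A 2 3 * A 2 3 + A 3 4 * A 3 4 + A 3 5 * A 3 5 = 1 := by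
    have h := hr 3 3
    simp only [hl, Matrix.one_apply_eq] at h
    linarith
  have r4 : A 0 4 * A 0 4 + A 1 4 * A 1 4 + A 2 4 * A 2 4 + A 3 4 * A 3 4 + A 4 5 * A 4 5 = 1 := by
    have h := hr 4 4
    simp only [hl, Matrix.one_apply_eq] at h
    linarith
  have r5 : A 0 5 * A 0 5 + A 1 5 * A 1 5 + A 2 5 * A 2 5 + A 3 5 * A 3 5 + A 4 5 * A 4 5 = 1 := by
    have h := hr 5 5
    simp only [hl, Matrix.one_apply_eq] at h
    linarith
  have p1 : A 1 4 = 0 := by grind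
  have q1 : A 1 5 = 0 := by grind
  have q0 : A 0 5 = 0 := by grind
  have p0 : A 0 4 = 0 := by grind
  have q2 : A 2 5 = 0 := by grind
  have q3 : A 3 5 = 0 := by grind
  -- Row `5` now reduces to `A 4 5 = ±1`, so `J` preserves the plane of the last two frame vectors.
  -- Then `nijenhuisCoeff A 4 5 0 = -(A 5 4)²` is nonzero, while `nijenhuisCoeff A 0 5 4` vanishes.
  have h := hN 5 0 4
  rw [nijenhuisCoeff_expand, nijenhuisCoeff_of_lt (by decide), structureForm_four,
    structureForm_five] at h
  simp only [Matrix.add_apply, Matrix.smul_apply, Matrix.sub_apply, Matrix.mul_apply,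
    Fin.sum_univ_six, smul_eq_mul, Matrix.of_apply, Matrix.cons_val, hl] at h
  clear hN' hN hr hl
  grind

/-! ### Solving the Lee form equations for `𝒵₁₂₄` -/

set_option linter.unusedSimpArgs false

-- If `A 4 5 ≠ 0`, the equations with last index `5` determine `s 0, …, s 4` and force `A 0 1 = A 0
-- 2 = A 0 3 = A 0 4 = 0`. Row `0` then gives `(A 0 5)² = 1`, which leaves no room for `A 4 5` in
-- row `5`.
set_option maxHeartbeats 1000000 in
lemma apply_four_five_eq_zero (hs : Aᵀ = -A) (hA : A * A = -1) {s t : Fin 6 → ℝ}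
    (h : ∀ i j k, ∑ q, A j q * extDerivCoeff A i q k + ∑ q, A i q * extDerivCoeff A j q k =
      2 * (1 : Matrix (Fin 6) (Fin 6) ℝ) i j * t k - t i * (1 : Matrix (Fin 6) (Fin 6) ℝ) j k
        - t j * (1 : Matrix (Fin 6) (Fin 6) ℝ) i k - s i * A j k - s j * A i k) :
    A 4 5 = 0 := by
  by_contra ha
  have hr := row_orthonormal hs hA
  have hl := lower_entries hs
  simp only [extDerivCoeff_expand, structureForm_four, structureForm_five, Fin.sum_univ_six,
    Matrix.one_apply] at h
  have e445 : 2 * A 4 5 * s 4 - 2 * t 5 = 0 := by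
    have h := h 4 4 5
    simp (decide := true) only [Matrix.of_apply, Matrix.cons_val, hl, if_true, if_false] at h
    linarith
  have e245 : A 2 5 * s 4 + A 4 5 * s 2 = 0 := by
    have h := h 2 4 5
    simp (decide := true) only [Matrix.of_apply, Matrix.cons_val, hl, if_true, if_false] at h
    linarith
  have e345 : A 3 5 * s 4 + A 4 5 * s 3 = 0 := by
    have h := h 3 4 5
    simp (decide := true) only [Matrix.of_apply, Matrix.cons_val, hl, if_true, if_false] at h
    linarith
  have e225 : 2 * A 2 5 * s 2 - 2 * t 5 = 0 := by
    have h := h 2 2 5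
    simp (decide := true) only [Matrix.of_apply, Matrix.cons_val, hl, if_true, if_false] at h
    linarith
  have e005 : 2 * A 0 1 * A 4 5 + 2 * A 0 5 * s 0 - 2 * t 5 = 0 := by
    have h := h 0 0 5
    simp (decide := true) only [Matrix.of_apply, Matrix.cons_val, hl, if_true, if_false] at h
    linarith
  have e015 : A 0 5 * s 1 + A 1 5 * s 0 = 0 := by
    have h := h 0 1 5
    simp (decide := true) only [Matrix.of_apply, Matrix.cons_val, hl, if_true, if_false] at h
    linarith
  have e025 : A 0 5 * s 2 - A 1 2 * A 4 5 + A 2 5 * s 0 = 0 := by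
    have h := h 0 2 5
    simp (decide := true) only [Matrix.of_apply, Matrix.cons_val, hl, if_true, if_false] at h
    linarith
  have e035 : A 0 5 * s 3 - A 1 3 * A 4 5 + A 3 5 * s 0 = 0 := by
    have h := h 0 3 5
    simp (decide := true) only [Matrix.of_apply, Matrix.cons_val, hl, if_true, if_false] at h
    linarith
  have e045 : A 0 5 * s 4 - A 1 4 * A 4 5 + A 4 5 * s 0 = 0 := by
    have h := h 0 4 5
    simp (decide := true) only [Matrix.of_apply, Matrix.cons_val, hl, if_true, if_false] at h
    linarith
  have e115 : 2 * A 0 1 * A 4 5 + 2 * A 1 5 * s 1 - 2 * t 5 = 0 := by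
    have h := h 1 1 5
    simp (decide := true) only [Matrix.of_apply, Matrix.cons_val, hl, if_true, if_false] at h
    linarith
  have e125 : A 0 2 * A 4 5 + A 1 5 * s 2 + A 2 5 * s 1 = 0 := by
    have h := h 1 2 5
    simp (decide := true) only [Matrix.of_apply, Matrix.cons_val, hl, if_true, if_false] at h
    linarith
  have e135 : A 0 3 * A 4 5 + A 1 5 * s 3 + A 3 5 * s 1 = 0 := by
    have h := h 1 3 5
    simp (decide := true) only [Matrix.of_apply, Matrix.cons_val, hl, if_true, if_false] at h
    linarith
  have e145 : A 0 4 * A 4 5 + A 1 5 * s 4 + A 4 5 * s 1 = 0 := by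
    have h := h 1 4 5
    simp (decide := true) only [Matrix.of_apply, Matrix.cons_val, hl, if_true, if_false] at h
    linarith
  have r05 : -A 0 1 * A 1 5 - A 0 2 * A 2 5 - A 0 3 * A 3 5 - A 0 4 * A 4 5 = 0 := by
    have h := hr 0 5
    simp (decide := true) only [hl, Matrix.one_apply, if_true, if_false] at h
    linarith
  have r15 : A 0 1 * A 0 5 - A 1 2 * A 2 5 - A 1 3 * A 3 5 - A 1 4 * A 4 5 = 0 := by
    have h := hr 1 5
    simp (decide := true) only [hl, Matrix.one_apply, if_true, if_false] at h
    linarith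
  have r00 : A 0 1 * A 0 1 + A 0 2 * A 0 2 + A 0 3 * A 0 3 + A 0 4 * A 0 4 + A 0 5 * A 0 5 = 1 := by
    have h := hr 0 0
    simp (decide := true) only [hl, Matrix.one_apply, if_true, if_false] at h
    linarith
  have r55 : A 0 5 * A 0 5 + A 1 5 * A 1 5 + A 2 5 * A 2 5 + A 3 5 * A 3 5 + A 4 5 * A 4 5 = 1 := by
    have h := hr 5 5
    simp (decide := true) only [hl, Matrix.one_apply, if_true, if_false] at h
    linarith
  clear h hr hl
  have hpos : 0 < A 4 5 * A 4 5 := mul_self_pos.2 ha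
  -- This combination eliminates `s 2` and `t 5`, leaving `s 4` times a positive number.
  have h₄ : s 4 * (A 2 5 * A 2 5 + A 4 5 * A 4 5) = 0 := by
    linear_combination A 2 5 * e245 - A 4 5 / 2 * e225 + A 4 5 / 2 * e445
  have s4 : s 4 = 0 := by
    refine (mul_eq_zero.1 h₄).resolve_right (ne_of_gt ?_)
    linarith [mul_self_nonneg (A 0 5), mul_self_nonneg (A 1 5), mul_self_nonneg (A 2 5),
      mul_self_nonneg (A 3 5)]
  have s2 : s 2 = 0 := by grind
  have s3 : s 3 = 0 := by grind
  have t5 : t 5 = 0 := by grind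
  have s0 : s 0 = A 1 4 := by grind
  have s1 : s 1 = -A 0 4 := by grind
  simp only [s0, s1, s2, s3, s4, t5, mul_zero, zero_add, add_zero, sub_zero]
    at e005 e015 e025 e035 e115 e125 e135
  -- Orthogonality of rows `0` and `5`, multiplied by `A 4 5`: the equations replace `A 0 i * A 4 5`
  -- by `A i 5 * A 0 4` for `i = 1, 2, 3`. The next identity treats rows `1` and `5` likewise.
  have h₀ : A 0 4 * (A 1 5 * A 1 5 + A 2 5 * A 2 5 + A 3 5 * A 3 5 + A 4 5 * A 4 5) = 0 := by
    clear r55 r00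
    grind
  have h₁ : A 1 4 * (A 0 5 * A 0 5 + A 2 5 * A 2 5 + A 3 5 * A 3 5 + A 4 5 * A 4 5) = 0 := by
    clear r55 r00
    grind
  have p₀ : A 0 4 = 0 := by
    refine (mul_eq_zero.1 h₀).resolve_right (ne_of_gt ?_)
    linarith [mul_self_nonneg (A 0 5), mul_self_nonneg (A 1 5), mul_self_nonneg (A 2 5),
      mul_self_nonneg (A 3 5)]
  have p₁ : A 1 4 = 0 := by
    refine (mul_eq_zero.1 h₁).resolve_right (ne_of_gt ?_)
    linarith [mul_self_nonneg (A 0 5), mul_self_nonneg (A 1 5), mul_self_nonneg (A 2 5),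
      mul_self_nonneg (A 3 5)]
  rw [p₁] at e005
  rw [p₀] at e125 e135
  have q₁ : A 0 1 = 0 := by grind
  have q₂ : A 0 2 = 0 := by grind
  have q₃ : A 0 3 = 0 := by grind
  rw [q₁, q₂, q₃, p₀] at r00
  nlinarith [mul_self_nonneg (A 1 5), mul_self_nonneg (A 2 5), mul_self_nonneg (A 3 5)]

-- Once `A 4 5 = 0`, the equations give `t = s 5 •` (row `5` of `A`). Since `s = A t` and the rows
-- are orthonormal, `s` is supported at index `5`.
set_option maxHeartbeats 1000000 in
lemma eq_zero_of_lee_form (hs : Aᵀ = -A) (hA : A * A = -1) {s t : Fin 6 → ℝ}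
    (hst : ∀ i, s i = ∑ q, A i q * t q)
    (h : ∀ i j k, ∑ q, A j q * extDerivCoeff A i q k + ∑ q, A i q * extDerivCoeff A j q k =
      2 * (1 : Matrix (Fin 6) (Fin 6) ℝ) i j * t k - t i * (1 : Matrix (Fin 6) (Fin 6) ℝ) j k
        - t j * (1 : Matrix (Fin 6) (Fin 6) ℝ) i k - s i * A j k - s j * A i k) :
    (s 0 = 0 ∧ s 1 = 0 ∧ s 2 = 0 ∧ s 3 = 0 ∧ s 4 = 0 ∧ s 5 = A 0 4 ∧ t 0 = -A 0 5 * A 0 4 ∧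
      t 1 = -A 1 5 * A 0 4 ∧ t 2 = -A 2 5 * A 0 4 ∧ t 3 = -A 3 5 * A 0 4) ∧
    A 0 4 * A 0 4 + A 0 5 * A 0 5 = 1 ∧
    A 0 5 * A 1 5 + A 1 4 * A 0 4 = 0 ∧ A 0 5 * A 2 5 + A 2 4 * A 0 4 = 0 ∧
    A 0 5 * A 3 5 + A 3 4 * A 0 4 = 0 := by
  have ha := apply_four_five_eq_zero hs hA h
  have hr := row_orthonormal hs hA
  have hl := lower_entries hs
  simp only [extDerivCoeff_expand, structureForm_four, structureForm_five, Fin.sum_univ_six,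
    Matrix.one_apply] at h
  simp only [Fin.sum_univ_six] at hst
  have e445 : 2 * A 4 5 * s 4 - 2 * t 5 = 0 := by
    have h := h 4 4 5
    simp (decide := true) only [Matrix.of_apply, Matrix.cons_val, hl, if_true, if_false] at h
    linarith
  have e550 : -2 * A 0 5 * s 5 + 2 * A 1 5 * A 4 5 - 2 * t 0 = 0 := by
    have h := h 5 5 0
    simp (decide := true) only [Matrix.of_apply, Matrix.cons_val, hl, if_true, if_false] at h
    linarith
  have e551 : -2 * A 0 5 * A 4 5 - 2 * A 1 5 * s 5 - 2 * t 1 = 0 := by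
    have h := h 5 5 1
    simp (decide := true) only [Matrix.of_apply, Matrix.cons_val, hl, if_true, if_false] at h
    linarith
  have e552 : -2 * A 2 5 * s 5 - 2 * t 2 = 0 := by
    have h := h 5 5 2
    simp (decide := true) only [Matrix.of_apply, Matrix.cons_val, hl, if_true, if_false] at h
    linarith
  have e553 : -2 * A 3 5 * s 5 - 2 * t 3 = 0 := by
    have h := h 5 5 3
    simp (decide := true) only [Matrix.of_apply, Matrix.cons_val, hl, if_true, if_false] at h
    linarith
  have e554 : -2 * A 4 5 * s 5 - 2 * t 4 = 0 := by
    have h := h 5 5 4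
    simp (decide := true) only [Matrix.of_apply, Matrix.cons_val, hl, if_true, if_false] at h
    linarith
  have e440 : -2 * A 0 4 * s 4 + 2 * A 1 4 * A 1 5 + 2 * A 2 4 * A 2 5 + 2 * A 3 4 * A 3 5
      - 2 * t 0 = 0 := by
    have h := h 4 4 0
    simp (decide := true) only [Matrix.of_apply, Matrix.cons_val, hl, if_true, if_false] at h
    linarith
  have e441 : -2 * A 0 4 * A 1 5 - 2 * A 1 4 * s 4 - 2 * t 1 = 0 := by
    have h := h 4 4 1
    simp (decide := true) only [Matrix.of_apply, Matrix.cons_val, hl, if_true, if_false] at h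
    linarith
  have e442 : -2 * A 0 4 * A 2 5 - 2 * A 2 4 * s 4 - 2 * A 3 4 * A 4 5 - 2 * t 2 = 0 := by
    have h := h 4 4 2
    simp (decide := true) only [Matrix.of_apply, Matrix.cons_val, hl, if_true, if_false] at h
    linarith
  have e443 : -2 * A 0 4 * A 3 5 + 2 * A 2 4 * A 4 5 - 2 * A 3 4 * s 4 - 2 * t 3 = 0 := by
    have h := h 4 4 3
    simp (decide := true) only [Matrix.of_apply, Matrix.cons_val, hl, if_true, if_false] at h
    linarith
  have e450 : -A 0 4 * s 5 - A 0 5 * s 4 + A 1 4 * A 4 5 + A 1 5 * A 1 5 + A 2 5 * A 2 5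
      + A 3 5 * A 3 5 = 0 := by
    have h := h 4 5 0
    simp (decide := true) only [Matrix.of_apply, Matrix.cons_val, hl, if_true, if_false] at h
    linarith
  have e451 : -A 0 4 * A 4 5 - A 0 5 * A 1 5 - A 1 4 * s 5 - A 1 5 * s 4 = 0 := by
    have h := h 4 5 1
    simp (decide := true) only [Matrix.of_apply, Matrix.cons_val, hl, if_true, if_false] at h
    linarith
  have e452 : -A 0 5 * A 2 5 - A 2 4 * s 5 - A 2 5 * s 4 - A 3 5 * A 4 5 = 0 := by
    have h := h 4 5 2
    simp (decide := true) only [Matrix.of_apply, Matrix.cons_val, hl, if_true, if_false] at h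
    linarith
  have e453 : -A 0 5 * A 3 5 + A 2 5 * A 4 5 - A 3 4 * s 5 - A 3 5 * s 4 = 0 := by
    have h := h 4 5 3
    simp (decide := true) only [Matrix.of_apply, Matrix.cons_val, hl, if_true, if_false] at h
    linarith
  have m0 : s 0 = A 0 1 * t 1 + A 0 2 * t 2 + A 0 3 * t 3 + A 0 4 * t 4 + A 0 5 * t 5 := by
    have h := hst 0
    simp only [hl] at h
    linarith
  have m1 : s 1 = -A 0 1 * t 0 + A 1 2 * t 2 + A 1 3 * t 3 + A 1 4 * t 4 + A 1 5 * t 5 := by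
    have h := hst 1
    simp only [hl] at h
    linarith
  have m2 : s 2 = -A 0 2 * t 0 - A 1 2 * t 1 + A 2 3 * t 3 + A 2 4 * t 4 + A 2 5 * t 5 := by
    have h := hst 2
    simp only [hl] at h
    linarith
  have m3 : s 3 = -A 0 3 * t 0 - A 1 3 * t 1 - A 2 3 * t 2 + A 3 4 * t 4 + A 3 5 * t 5 := by
    have h := hst 3
    simp only [hl] at h
    linarith
  have m4 : s 4 = -A 0 4 * t 0 - A 1 4 * t 1 - A 2 4 * t 2 - A 3 4 * t 3 + A 4 5 * t 5 := by
    have h := hst 4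
    simp only [hl] at h
    linarith
  have r05 : -A 0 1 * A 1 5 - A 0 2 * A 2 5 - A 0 3 * A 3 5 - A 0 4 * A 4 5 = 0 := by
    have h := hr 0 5
    simp (decide := true) only [hl, Matrix.one_apply, if_true, if_false] at h
    linarith
  have r15 : A 0 1 * A 0 5 - A 1 2 * A 2 5 - A 1 3 * A 3 5 - A 1 4 * A 4 5 = 0 := by
    have h := hr 1 5
    simp (decide := true) only [hl, Matrix.one_apply, if_true, if_false] at h
    linarith
  have r25 : A 0 2 * A 0 5 + A 1 2 * A 1 5 - A 2 3 * A 3 5 - A 2 4 * A 4 5 = 0 := by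
    have h := hr 2 5
    simp (decide := true) only [hl, Matrix.one_apply, if_true, if_false] at h
    linarith
  have r35 : A 0 3 * A 0 5 + A 1 3 * A 1 5 + A 2 3 * A 2 5 - A 3 4 * A 4 5 = 0 := by
    have h := hr 3 5
    simp (decide := true) only [hl, Matrix.one_apply, if_true, if_false] at h
    linarith
  have r45 : A 0 4 * A 0 5 + A 1 4 * A 1 5 + A 2 4 * A 2 5 + A 3 4 * A 3 5 = 0 := by
    have h := hr 4 5
    simp (decide := true) only [hl, Matrix.one_apply, if_true, if_false] at h
    linarith
  have r55 : A 0 5 * A 0 5 + A 1 5 * A 1 5 + A 2 5 * A 2 5 + A 3 5 * A 3 5 + A 4 5 * A 4 5 = 1 := by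
    have h := hr 5 5
    simp (decide := true) only [hl, Matrix.one_apply, if_true, if_false] at h
    linarith
  clear h hr hl hst
  simp only [ha, mul_zero, zero_mul, sub_zero, zero_sub, add_zero]
    at e445 e550 e551 e442 e443 e554 e450 e451 e452 e453 m4 r05 r15 r25 r35 r55
  have t5 : t 5 = 0 := by linarith
  have t4 : t 4 = 0 := by linarith
  have t0 : t 0 = -A 0 5 * s 5 := by linarith
  have t1 : t 1 = -A 1 5 * s 5 := by linarith
  have t2 : t 2 = -A 2 5 * s 5 := by linarith
  have t3 : t 3 = -A 3 5 * s 5 := by linarith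
  simp only [t0, t1, t2, t3, t4, t5] at m0 m1 m2 m3 m4 ⊢
  rw [t0] at e440
  rw [t1] at e441
  rw [t2] at e442
  rw [t3] at e443
  have s0 : s 0 = 0 := by linear_combination m0 + s 5 * r05
  have s1 : s 1 = 0 := by linear_combination m1 + s 5 * r15
  have s2 : s 2 = 0 := by linear_combination m2 + s 5 * r25
  have s3 : s 3 = 0 := by linear_combination m3 + s 5 * r35
  have s4 : s 4 = 0 := by linear_combination m4 + s 5 * r45
  rw [s4] at e440 e441 e442 e443 e450 e451 e452 e453
  -- The equations give `A i 5 * (A 0 4 - s 5) = 0` for `i ≤ 3`, with row orthogonality used for `i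
  -- = 0`; weighting by `A i 5` and summing produces the unit norm of row `5`.
  have s5 : s 5 = A 0 4 := by
    linear_combination (A 0 4 - s 5) * r55 + A 0 5 / 2 * e440 + A 1 5 / 2 * e441
      + A 2 5 / 2 * e442 + A 3 5 / 2 * e443 - A 0 5 * r45
  rw [s5] at e450 e451 e452 e453 ⊢
  refine ⟨⟨s0, s1, s2, s3, s4, rfl, rfl, rfl, rfl, rfl⟩, ?_, ?_, ?_, ?_⟩ <;> linarith

-- Here `(A 0 4, A 0 5)` is a unit vector. If `A 0 5 ≠ 0`, the equations whose first two indices are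
-- among `1, 2, 3` contradict row orthonormality; the degenerate case `A 0 4 = 0` is excluded first.
set_option maxHeartbeats 1000000 in
lemma apply_zero_five_eq_zero (hs : Aᵀ = -A) (hA : A * A = -1) {s t : Fin 6 → ℝ}
    (hst : ∀ i, s i = ∑ q, A i q * t q)
    (h : ∀ i j k, ∑ q, A j q * extDerivCoeff A i q k + ∑ q, A i q * extDerivCoeff A j q k =
      2 * (1 : Matrix (Fin 6) (Fin 6) ℝ) i j * t k - t i * (1 : Matrix (Fin 6) (Fin 6) ℝ) j k
        - t j * (1 : Matrix (Fin 6) (Fin 6) ℝ) i k - s i * A j k - s j * A i k) :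
    A 0 5 = 0 := by
  have ha := apply_four_five_eq_zero hs hA h
  obtain ⟨⟨s0, s1, s2, s3, s4, s5, t0, t1, t2, t3⟩, h00, h1, h2, h3⟩ :=
    eq_zero_of_lee_form hs hA hst h
  have hr := row_orthonormal hs hA
  have hl := lower_entries hs
  simp only [extDerivCoeff_expand, structureForm_four, structureForm_five, Fin.sum_univ_six,
    Matrix.one_apply] at h
  have e110 : -2 * A 0 1 * s 1 - 2 * A 1 2 * A 2 4 - 2 * A 1 3 * A 3 4 + 2 * A 1 4 * A 1 5
      + 2 * A 1 5 * A 4 5 - 2 * t 0 = 0 := by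
    have h := h 1 1 0
    simp (decide := true) only [Matrix.of_apply, Matrix.cons_val, hl, if_true, if_false] at h
    linarith
  have e112 : -2 * A 0 1 * A 2 4 + 2 * A 1 2 * s 1 + 2 * A 1 3 * A 1 5 - 2 * t 2 = 0 := by
    have h := h 1 1 2
    simp (decide := true) only [Matrix.of_apply, Matrix.cons_val, hl, if_true, if_false] at h
    linarith
  have e113 : -2 * A 0 1 * A 3 4 - 2 * A 1 2 * A 1 5 + 2 * A 1 3 * s 1 - 2 * t 3 = 0 := by
    have h := h 1 1 3
    simp (decide := true) only [Matrix.of_apply, Matrix.cons_val, hl, if_true, if_false] at h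
    linarith
  have e220 : -2 * A 0 2 * s 2 - 2 * A 0 5 * A 2 3 - 2 * A 1 2 * A 2 4 + 2 * A 2 4 * A 2 5
      - 2 * t 0 = 0 := by
    have h := h 2 2 0
    simp (decide := true) only [Matrix.of_apply, Matrix.cons_val, hl, if_true, if_false] at h
    linarith
  have e221 : 2 * A 0 2 * A 2 4 - 2 * A 1 2 * s 2 - 2 * A 1 5 * A 2 3 - 2 * t 1 = 0 := by
    have h := h 2 2 1
    simp (decide := true) only [Matrix.of_apply, Matrix.cons_val, hl, if_true, if_false] at h
    linarith
  have e223 : -2 * A 0 2 * A 0 5 - 2 * A 1 2 * A 1 5 + 2 * A 2 3 * s 2 + 2 * A 2 4 * A 4 5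
      - 2 * t 3 = 0 := by
    have h := h 2 2 3
    simp (decide := true) only [Matrix.of_apply, Matrix.cons_val, hl, if_true, if_false] at h
    linarith
  have e330 : -2 * A 0 3 * s 3 - 2 * A 0 5 * A 2 3 - 2 * A 1 3 * A 3 4 + 2 * A 3 4 * A 3 5
      - 2 * t 0 = 0 := by
    have h := h 3 3 0
    simp (decide := true) only [Matrix.of_apply, Matrix.cons_val, hl, if_true, if_false] at h
    linarith
  have e331 : 2 * A 0 3 * A 3 4 - 2 * A 1 3 * s 3 - 2 * A 1 5 * A 2 3 - 2 * t 1 = 0 := by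
    have h := h 3 3 1
    simp (decide := true) only [Matrix.of_apply, Matrix.cons_val, hl, if_true, if_false] at h
    linarith
  have e120 : -A 0 1 * s 2 - A 0 2 * s 1 - A 0 5 * A 1 3 + A 1 4 * A 2 5 + A 1 5 * A 2 4
      - A 2 3 * A 3 4 + A 2 5 * A 4 5 = 0 := by
    have h := h 1 2 0
    simp (decide := true) only [Matrix.of_apply, Matrix.cons_val, hl, if_true, if_false] at h
    linarith
  have e130 : -A 0 1 * s 3 - A 0 3 * s 1 + A 0 5 * A 1 2 + A 1 4 * A 3 5 + A 1 5 * A 3 4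
      + A 2 3 * A 2 4 + A 3 5 * A 4 5 = 0 := by
    have h := h 1 3 0
    simp (decide := true) only [Matrix.of_apply, Matrix.cons_val, hl, if_true, if_false] at h
    linarith
  have r00 : A 0 1 * A 0 1 + A 0 2 * A 0 2 + A 0 3 * A 0 3 + A 0 4 * A 0 4 + A 0 5 * A 0 5 = 1 := by
    have h := hr 0 0
    simp (decide := true) only [hl, Matrix.one_apply, if_true, if_false] at h
    linarith
  have r01 : A 0 2 * A 1 2 + A 0 3 * A 1 3 + A 0 4 * A 1 4 + A 0 5 * A 1 5 = 0 := by
    have h := hr 0 1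
    simp (decide := true) only [hl, Matrix.one_apply, if_true, if_false] at h
    linarith
  have r02 : -A 0 1 * A 1 2 + A 0 3 * A 2 3 + A 0 4 * A 2 4 + A 0 5 * A 2 5 = 0 := by
    have h := hr 0 2
    simp (decide := true) only [hl, Matrix.one_apply, if_true, if_false] at h
    linarith
  have r03 : -A 0 1 * A 1 3 - A 0 2 * A 2 3 + A 0 4 * A 3 4 + A 0 5 * A 3 5 = 0 := by
    have h := hr 0 3
    simp (decide := true) only [hl, Matrix.one_apply, if_true, if_false] at h
    linarith
  have r04 : -A 0 1 * A 1 4 - A 0 2 * A 2 4 - A 0 3 * A 3 4 + A 0 5 * A 4 5 = 0 := by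
    have h := hr 0 4
    simp (decide := true) only [hl, Matrix.one_apply, if_true, if_false] at h
    linarith
  have r05 : -A 0 1 * A 1 5 - A 0 2 * A 2 5 - A 0 3 * A 3 5 - A 0 4 * A 4 5 = 0 := by
    have h := hr 0 5
    simp (decide := true) only [hl, Matrix.one_apply, if_true, if_false] at h
    linarith
  have r11 : A 0 1 * A 0 1 + A 1 2 * A 1 2 + A 1 3 * A 1 3 + A 1 4 * A 1 4 + A 1 5 * A 1 5 = 1 := by
    have h := hr 1 1
    simp (decide := true) only [hl, Matrix.one_apply, if_true, if_false] at h
    linarith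
  have r12 : A 0 1 * A 0 2 + A 1 3 * A 2 3 + A 1 4 * A 2 4 + A 1 5 * A 2 5 = 0 := by
    have h := hr 1 2
    simp (decide := true) only [hl, Matrix.one_apply, if_true, if_false] at h
    linarith
  have r13 : A 0 1 * A 0 3 - A 1 2 * A 2 3 + A 1 4 * A 3 4 + A 1 5 * A 3 5 = 0 := by
    have h := hr 1 3
    simp (decide := true) only [hl, Matrix.one_apply, if_true, if_false] at h
    linarith
  have r14 : A 0 1 * A 0 4 - A 1 2 * A 2 4 - A 1 3 * A 3 4 + A 1 5 * A 4 5 = 0 := by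
    have h := hr 1 4
    simp (decide := true) only [hl, Matrix.one_apply, if_true, if_false] at h
    linarith
  have r15 : A 0 1 * A 0 5 - A 1 2 * A 2 5 - A 1 3 * A 3 5 - A 1 4 * A 4 5 = 0 := by
    have h := hr 1 5
    simp (decide := true) only [hl, Matrix.one_apply, if_true, if_false] at h
    linarith
  have r22 : A 0 2 * A 0 2 + A 1 2 * A 1 2 + A 2 3 * A 2 3 + A 2 4 * A 2 4 + A 2 5 * A 2 5 = 1 := by
    have h := hr 2 2
    simp (decide := true) only [hl, Matrix.one_apply, if_true, if_false] at h
    linarith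
  have r23 : A 0 2 * A 0 3 + A 1 2 * A 1 3 + A 2 4 * A 3 4 + A 2 5 * A 3 5 = 0 := by
    have h := hr 2 3
    simp (decide := true) only [hl, Matrix.one_apply, if_true, if_false] at h
    linarith
  have r24 : A 0 2 * A 0 4 + A 1 2 * A 1 4 - A 2 3 * A 3 4 + A 2 5 * A 4 5 = 0 := by
    have h := hr 2 4
    simp (decide := true) only [hl, Matrix.one_apply, if_true, if_false] at h
    linarith
  have r25 : A 0 2 * A 0 5 + A 1 2 * A 1 5 - A 2 3 * A 3 5 - A 2 4 * A 4 5 = 0 := by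
    have h := hr 2 5
    simp (decide := true) only [hl, Matrix.one_apply, if_true, if_false] at h
    linarith
  have r33 : A 0 3 * A 0 3 + A 1 3 * A 1 3 + A 2 3 * A 2 3 + A 3 4 * A 3 4 + A 3 5 * A 3 5 = 1 := by
    have h := hr 3 3
    simp (decide := true) only [hl, Matrix.one_apply, if_true, if_false] at h
    linarith
  have r34 : A 0 3 * A 0 4 + A 1 3 * A 1 4 + A 2 3 * A 2 4 + A 3 5 * A 4 5 = 0 := by
    have h := hr 3 4
    simp (decide := true) only [hl, Matrix.one_apply, if_true, if_false] at h
    linarith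
  have r35 : A 0 3 * A 0 5 + A 1 3 * A 1 5 + A 2 3 * A 2 5 - A 3 4 * A 4 5 = 0 := by
    have h := hr 3 5
    simp (decide := true) only [hl, Matrix.one_apply, if_true, if_false] at h
    linarith
  have r44 : A 0 4 * A 0 4 + A 1 4 * A 1 4 + A 2 4 * A 2 4 + A 3 4 * A 3 4 + A 4 5 * A 4 5 = 1 := by
    have h := hr 4 4
    simp (decide := true) only [hl, Matrix.one_apply, if_true, if_false] at h
    linarith
  have r45 : A 0 4 * A 0 5 + A 1 4 * A 1 5 + A 2 4 * A 2 5 + A 3 4 * A 3 5 = 0 := by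
    have h := hr 4 5
    simp (decide := true) only [hl, Matrix.one_apply, if_true, if_false] at h
    linarith
  have r55 : A 0 5 * A 0 5 + A 1 5 * A 1 5 + A 2 5 * A 2 5 + A 3 5 * A 3 5 + A 4 5 * A 4 5 = 1 := by
    have h := hr 5 5
    simp (decide := true) only [hl, Matrix.one_apply, if_true, if_false] at h
    linarith
  clear h hr hl hst
  simp only [ha, s0, s1, s2, s3, s4, s5, t0, t1, t2, t3, mul_zero, zero_mul, sub_zero, zero_sub,
    add_zero] at *
  clear s0 s1 s2 s3 s4 s5 t0 t1 t2 t3 hs hA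
  by_contra hu
  have hv : A 0 4 ≠ 0 := by
    intro hv
    grind
  grind

lemma eq_zero_of_sum_mul_self_eq_zero {a b c : ℝ} (h : a * a + b * b + c * c = 0) :
    a = 0 ∧ b = 0 ∧ c = 0 := by
  refine ⟨?_, ?_, ?_⟩ <;> nlinarith [mul_self_nonneg a, mul_self_nonneg b, mul_self_nonneg c]

-- With `A 0 5 = 0` one has `A 0 4 = ±1`, so rows `0` and `4` have no other entry. The remaining
-- equations give `A 2 3 = A 0 4`, row norms kill what is left, and the orientation fixes `A 1 5`.
set_option maxHeartbeats 1000000 in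
theorem eq_varpi_of_lee_form (hs : Aᵀ = -A) (hA : A * A = -1) (hp : 0 < pfaffian A)
    {s t : Fin 6 → ℝ} (hst : ∀ i, s i = ∑ q, A i q * t q)
    (h : ∀ i j k, ∑ q, A j q * extDerivCoeff A i q k + ∑ q, A i q * extDerivCoeff A j q k =
      2 * (1 : Matrix (Fin 6) (Fin 6) ℝ) i j * t k - t i * (1 : Matrix (Fin 6) (Fin 6) ℝ) j k
        - t j * (1 : Matrix (Fin 6) (Fin 6) ℝ) i k - s i * A j k - s j * A i k) :
    A = varpi₁ ∨ A = varpi₂ := by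
  have ha := apply_four_five_eq_zero hs hA h
  have hy := apply_zero_five_eq_zero hs hA hst h
  obtain ⟨⟨s0, s1, s2, s3, s4, s5, t0, t1, t2, t3⟩, h00, h1, h2, h3⟩ :=
    eq_zero_of_lee_form hs hA hst h
  have hr := row_orthonormal hs hA
  have hl := lower_entries hs
  simp only [extDerivCoeff_expand, structureForm_four, structureForm_five, Fin.sum_univ_six,
    Matrix.one_apply] at h
  have e112 : -2 * A 0 1 * A 2 4 + 2 * A 1 2 * s 1 + 2 * A 1 3 * A 1 5 - 2 * t 2 = 0 := by
    have h := h 1 1 2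
    simp (decide := true) only [Matrix.of_apply, Matrix.cons_val, hl, if_true, if_false] at h
    linarith
  have e113 : -2 * A 0 1 * A 3 4 - 2 * A 1 2 * A 1 5 + 2 * A 1 3 * s 1 - 2 * t 3 = 0 := by
    have h := h 1 1 3
    simp (decide := true) only [Matrix.of_apply, Matrix.cons_val, hl, if_true, if_false] at h
    linarith
  have e221 : 2 * A 0 2 * A 2 4 - 2 * A 1 2 * s 2 - 2 * A 1 5 * A 2 3 - 2 * t 1 = 0 := by
    have h := h 2 2 1
    simp (decide := true) only [Matrix.of_apply, Matrix.cons_val, hl, if_true, if_false] at h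
    linarith
  have r00 : A 0 1 * A 0 1 + A 0 2 * A 0 2 + A 0 3 * A 0 3 + A 0 4 * A 0 4 + A 0 5 * A 0 5 = 1 := by
    have h := hr 0 0
    simp (decide := true) only [hl, Matrix.one_apply, if_true, if_false] at h
    linarith
  have r22 : A 0 2 * A 0 2 + A 1 2 * A 1 2 + A 2 3 * A 2 3 + A 2 4 * A 2 4 + A 2 5 * A 2 5 = 1 := by
    have h := hr 2 2
    simp (decide := true) only [hl, Matrix.one_apply, if_true, if_false] at h
    linarith
  have r33 : A 0 3 * A 0 3 + A 1 3 * A 1 3 + A 2 3 * A 2 3 + A 3 4 * A 3 4 + A 3 5 * A 3 5 = 1 := by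
    have h := hr 3 3
    simp (decide := true) only [hl, Matrix.one_apply, if_true, if_false] at h
    linarith
  have r55 : A 0 5 * A 0 5 + A 1 5 * A 1 5 + A 2 5 * A 2 5 + A 3 5 * A 3 5 + A 4 5 * A 4 5 = 1 := by
    have h := hr 5 5
    simp (decide := true) only [hl, Matrix.one_apply, if_true, if_false] at h
    linarith
  clear h hr hst
  simp only [pfaffian, halfSquare] at hp
  simp only [ha, hy, s0, s1, s2, s3, s4, s5, t0, t1, t2, t3, mul_zero, zero_mul, sub_zero,
    zero_sub, add_zero, zero_add] at e112 e113 e221 r00 r22 r33 r55 h00 h1 h2 h3 hp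
  have hx : A 0 4 ≠ 0 := by
    intro hx
    simp [hx] at h00
  have z1 : A 1 4 = 0 := (mul_eq_zero.1 h1).resolve_right hx
  have z2 : A 2 4 = 0 := (mul_eq_zero.1 h2).resolve_right hx
  have z3 : A 3 4 = 0 := (mul_eq_zero.1 h3).resolve_right hx
  obtain ⟨a1, a2, a3⟩ := eq_zero_of_sum_mul_self_eq_zero
    (a := A 0 1) (b := A 0 2) (c := A 0 3) (by linarith)
  simp only [z1, z2, z3, a1, a2, a3, mul_zero, zero_mul, sub_zero,
    zero_sub, add_zero, zero_add] at e112 e113 e221 r22 r33 hp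
  -- If `A 1 5` vanished, `e112` and `e113` would make `A 2 5` and `A 3 5` vanish too, against the
  -- unit norm of row `5`.
  have y1 : A 1 5 ≠ 0 := by grind
  have a23 : A 2 3 = A 0 4 := by grind
  rw [a23] at r22 r33 hp
  obtain ⟨a12, y2, -⟩ := eq_zero_of_sum_mul_self_eq_zero
    (a := A 1 2) (b := A 2 5) (c := 0) (by linarith)
  obtain ⟨a13, y3, -⟩ := eq_zero_of_sum_mul_self_eq_zero
    (a := A 1 3) (b := A 3 5) (c := 0) (by linarith)
  -- The Pfaffian has become `-(A 0 4)² * A 1 5`.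
  have y15 : A 1 5 = -1 := by
    simp only [a12, a13, y2, y3, mul_zero, add_zero] at hp r55
    have h₁ : (A 1 5 - 1) * (A 1 5 + 1) = 0 := by linarith
    rcases mul_eq_zero.1 h₁ with h₁ | h₁
    · rw [show A 1 5 = 1 by linarith] at hp
      linarith
    · linarith
  have hx' : A 0 4 = 1 ∨ A 0 4 = -1 := by grind
  refine hx'.symm.imp (fun h => ?_) (fun h => ?_) <;> rw [h] at a23 <;> ext i j <;>
    fin_cases i <;> fin_cases j <;>
    simp [varpi₁, varpi₂, eForm₂, wedge, eForm, hl, ha, hy, z1, z2, z3, a1, a2, a3, a12, a13, a23,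
      y2, y3, y15, h]

/-! ### Matrix entries on generalized edges, and the edges in `𝒵₂₃₄` -/

lemma eForm_eq_single (p : Fin 6) : eForm (p + 1) = Pi.single p 1 := by
  ext k
  simp [eForm, Pi.single_apply, Fin.ext_iff]

/-- Annihilating both legs means that columns `p` and `q` of `A` are those of the wedge. The sign
`ε` treats opposite edges together. -/
lemma genEdge_apply {ε : ℝ} (hε : ε * ε = 1) {p q : Fin 6} (hpq : p ≠ q)
    (h : A ∈ genEdge (ε • eForm (p + 1)) (eForm (q + 1))) (k : Fin 6) :
    A k p = (if k = q then -ε else 0) ∧ A k q = if k = p then ε else 0 := by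
  obtain ⟨-, h₁, h₂⟩ := h
  rw [eForm_eq_single, eForm_eq_single] at h₁ h₂
  have hε0 : ε ≠ 0 := by
    rintro rfl
    simp at hε
  have h₁ := congrFun h₁ k
  have h₂ := congrFun h₂ k
  rw [Matrix.mulVec_smul] at h₁
  simp [wedge, Pi.single_apply, hpq, hpq.symm, hε0, sub_eq_zero] at h₁ h₂
  constructor
  · split_ifs at h₁ ⊢ <;> linarith
  · rw [h₂]

/-- A skew orthogonal `4 × 4` matrix with rows `(0, p, q, r)`, `(-p, 0, s, t)`, `(-q, -s, 0, w)`,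
`(-r, -t, -w, 0)` is self-dual or anti-self-dual according to the sign of its Pfaffian. -/
lemma self_dual_of_orthogonal {p q r s t w δ : ℝ} (hδ : δ * δ = 1)
    (h₁ : p * p + q * q + r * r = 1) (h₂ : p * p + s * s + t * t = 1)
    (h₃ : q * q + s * s + w * w = 1) (h₄ : r * r + t * t + w * w = 1)
    (h₁₂ : q * s + r * t = 0) (h₁₃ : p * s = r * w) (h₁₄ : p * t + q * w = 0)
    (hP : 0 < δ * (p * w - q * t + r * s)) : w = δ * p ∧ t = -(δ * q) ∧ s = δ * r := by
  set P := p * w - q * t + r * s with hPdef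
  -- A skew `4 × 4` matrix times its Hodge dual is a multiple of its Pfaffian. Orthogonality
  -- therefore makes each entry `P` times the dual entry, with `P² = 1`.
  have hw : w * P = p := by grind
  have ht : t * P = -q := by grind
  have hs : s * P = r := by grind
  have hPP : P * P = 1 := by grind
  have : P = δ := by
    have h : (P - δ) * (P + δ) = 0 := by linear_combination hPP - hδ
    rcases mul_eq_zero.1 h with h | h
    · linarith
    · rw [show P = -δ by linarith] at hP
      nlinarith
  rw [this] at hw ht hs hPP
  refine ⟨?_, ?_, ?_⟩ <;> grind

lemma nijenhuisCoeff_skew (hs : Aᵀ = -A) (k i j : Fin 6) :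
    nijenhuisCoeff A k i j = -nijenhuisCoeff A k j i := by
  have hc : ∀ k, (structureForm k)ᵀ = -structureForm k := fun k => by
    ext i j
    exact structureForm_skew k j i
  have h : (nijenhuisCoeff A k)ᵀ = -nijenhuisCoeff A k := by
    rw [nijenhuisCoeff_expand]
    simp only [Matrix.transpose_add, Matrix.transpose_smul, Matrix.transpose_sub,
      Matrix.transpose_mul, hs, hc, Matrix.mul_neg, Matrix.neg_mul, Matrix.mul_assoc]
    module
  exact congrFun (congrFun h j) i

/-- The tensor is skew in its first two arguments, so its cyclic sum is totally skew and increasing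
triples suffice. -/
lemma nijenhuisCoeff_cyclic_of_lt (hs : Aᵀ = -A)
    (h : ∀ i j k, i < j → j < k →
      nijenhuisCoeff A k i j + nijenhuisCoeff A i j k
          + nijenhuisCoeff A j k i = 0) (i j k : Fin 6) :
    nijenhuisCoeff A k i j + nijenhuisCoeff A i j k + nijenhuisCoeff A j k i = 0 := by
  have hk := nijenhuisCoeff_skew hs
  rcases lt_trichotomy i j with h₁ | rfl | h₁
  · rcases lt_trichotomy j k with h₂ | rfl | h₂
    · exact h i j k h₁ h₂
    · linarith [hk i j j, hk j i j]
    · rcases lt_trichotomy i k with h₃ | rfl | h₃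
      · linarith [h i k j h₃ h₂, hk k i j, hk i j k, hk j k i]
      · linarith [hk j i i, hk i i j]
      · linarith [h k i j h₃ h₁]
  · linarith [hk k i i, hk i i k]
  · rcases lt_trichotomy i k with h₂ | rfl | h₂
    · linarith [h j i k h₁ h₂, hk k i j, hk i j k, hk j k i]
    · linarith [hk j i i, hk i i j]
    · rcases lt_trichotomy j k with h₃ | rfl | h₃
      · linarith [h j k i h₃ h₂]
      · linarith [hk i j j, hk j i j]
      · linarith [h k j i h₃ h₁, hk k i j, hk i j k, hk j k i]

/-- Every `deᵏ` is a combination of `e^{12}`, `e^{15}` and `e^{34}`, and conjugating a decomposable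
form by `A` gives `2 × 2` minors. This keeps the later case checks small. -/
lemma nijenhuisCoeff_apply (k i j : Fin 6) :
    nijenhuisCoeff A k i j = structureForm k i j
      + structureForm k 0 1 * (A i 0 * A 1 j - A i 1 * A 0 j)
      + structureForm k 0 4 * (A i 0 * A 4 j - A i 4 * A 0 j)
      + structureForm k 2 3 * (A i 2 * A 3 j - A i 3 * A 2 j)
      + A 4 k * (A i 0 * structureForm 4 0 j + A i 1 * structureForm 4 1 j
      - structureForm 4 i 0 * A 0 j - structureForm 4 i 1 * A 1 j) + A 5 k *
      (A i 0 * structureForm 5 0 j + A i 2 * structureForm 5 2 j + A i 3 * structureForm 5 3 j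
      + A i 4 * structureForm 5 4 j - structureForm 5 i 0 * A 0 j - structureForm 5 i 2 * A 2 j
      - structureForm 5 i 3 * A 3 j - structureForm 5 i 4 * A 4 j) := by
  have hk : structureForm k = structureForm k 0 1 • eForm₂ 1 2 + structureForm k 0 4 • eForm₂ 1 5
      + structureForm k 2 3 • eForm₂ 3 4 := by
    by_cases hk : k < 4
    · simp [structureForm_of_lt hk]
    · obtain rfl | rfl : k = 4 ∨ k = 5 := by omega
      · have h₁ : structureForm 4 0 1 = 1 := by simp [structureForm_four]
        have h₂ : structureForm 4 0 4 = 0 := by simp [structureForm_four]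
        have h₃ : structureForm 4 2 3 = 0 := by simp [structureForm_four]
        rw [h₁, h₂, h₃, one_smul, zero_smul, zero_smul, add_zero, add_zero]
        rfl
      · have h₁ : structureForm 5 0 1 = 0 := by simp [structureForm_five]
        have h₂ : structureForm 5 0 4 = 1 := by simp [structureForm_five]
        have h₃ : structureForm 5 2 3 = 1 := by simp [structureForm_five]
        rw [h₁, h₂, h₃, one_smul, zero_smul, one_smul, zero_add]
        rfl
  have hw : ∀ (p q : Fin 6), (A * wedge (Pi.single p 1) (Pi.single q 1) * A) i j =
      A i p * A q j - A i q * A p j := by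
    intro p q
    have : wedge (Pi.single p 1) (Pi.single q 1) =
        Matrix.vecMulVec (Pi.single p 1) (Pi.single q 1)
          - Matrix.vecMulVec (Pi.single q 1) (Pi.single p 1) := by
      ext a b
      simp only [wedge, Matrix.of_apply, Matrix.sub_apply, Matrix.vecMulVec_apply]
      ring
    rw [this, Matrix.mul_sub, Matrix.sub_mul, Matrix.mul_vecMulVec, Matrix.mul_vecMulVec,
      Matrix.vecMulVec_mul, Matrix.vecMulVec_mul]
    simp [Matrix.vecMulVec_apply]
  have h₁ : eForm 1 = Pi.single 0 1 := eForm_eq_single 0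
  have h₂ : eForm 2 = Pi.single 1 1 := eForm_eq_single 1
  have h₃ : eForm 3 = Pi.single 2 1 := eForm_eq_single 2
  have h₄ : eForm 4 = Pi.single 3 1 := eForm_eq_single 3
  have h₅ : eForm 5 = Pi.single 4 1 := eForm_eq_single 4
  rw [nijenhuisCoeff_eq_add, Matrix.add_apply]
  conv_lhs => enter [1, 2]; rw [hk]
  simp only [Matrix.mul_add, Matrix.add_mul, Matrix.mul_smul, Matrix.smul_mul, Matrix.add_apply,
    Matrix.smul_apply, smul_eq_mul, eForm₂, h₁, h₂, h₃, h₄, h₅, hw]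
  ring

lemma entries_of_mem_genEdge_three_four {ε : ℝ} (hε : ε * ε = 1)
    (h : A ∈ genEdge (ε • eForm 3) (eForm 4)) :
    (A 0 2 = 0 ∧ A 0 3 = 0 ∧ A 1 2 = 0 ∧ A 1 3 = 0 ∧ A 2 4 = 0 ∧ A 3 4 = 0 ∧ A 2 5 = 0 ∧ A 3 5 = 0
        ∧ A 2 3 = ε) ∧
      A 4 5 = ε * A 0 1 ∧ A 1 5 = -(ε * A 0 4) ∧ A 1 4 = ε * A 0 5 ∧
      A 0 1 * A 0 1 + A 0 4 * A 0 4 + A 0 5 * A 0 5 = 1 := by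
  have hl := lower_entries h.1.1
  have hr := row_orthonormal h.1.1 h.1.2.1
  have hc := genEdge_apply hε (p := 2) (q := 3) (by decide) h
  have hp := h.1.2.2
  have z20 : A 0 2 = 0 := by
    have h := (hc 0).1
    simpa (decide := true) only [hl, if_false, neg_eq_zero] using h
  have z30 : A 0 3 = 0 := by
    have h := (hc 0).2
    simpa (decide := true) only [hl, if_false, neg_eq_zero] using h
  have z21 : A 1 2 = 0 := by
    have h := (hc 1).1
    simpa (decide := true) only [hl, if_false, neg_eq_zero] using h
  have z31 : A 1 3 = 0 := by
    have h := (hc 1).2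
    simpa (decide := true) only [hl, if_false, neg_eq_zero] using h
  have z24 : A 2 4 = 0 := by
    have h := (hc 4).1
    simpa (decide := true) only [hl, if_false, neg_eq_zero] using h
  have z34 : A 3 4 = 0 := by
    have h := (hc 4).2
    simpa (decide := true) only [hl, if_false, neg_eq_zero] using h
  have z25 : A 2 5 = 0 := by
    have h := (hc 5).1
    simpa (decide := true) only [hl, if_false, neg_eq_zero] using h
  have z35 : A 3 5 = 0 := by
    have h := (hc 5).2
    simpa (decide := true) only [hl, if_false, neg_eq_zero] using h
  have zij : A 2 3 = ε := by
    have h := (hc 2).2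
    simpa (decide := true) only [if_true] using h
  simp only [pfaffian, halfSquare, z20, z30, z21, z31, z24, z34, z25, z35, zij] at hp
  have r00 := hr 0 0
  have r11 := hr 1 1
  have r44 := hr 4 4
  have r55 := hr 5 5
  have r01 := hr 0 1
  have r04 := hr 0 4
  have r05 := hr 0 5
  simp (decide := true) only [hl, Matrix.one_apply, if_true, if_false, z20, z30, z21, z31, z24,
      z34, z25, z35, zij] at r00 r11 r44 r55 r01 r04 r05
  obtain ⟨e₁, e₂, e₃⟩ := self_dual_of_orthogonal (p := A 0 1) (q := A 0 4) (r := A 0 5)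
    (s := A 1 4) (t := A 1 5) (w := A 4 5) (δ := ε) (by linarith) (by linarith) (by linarith)
    (by linarith) (by linarith) (by linarith) (by linarith) (by linarith) (by linarith)
  refine ⟨⟨z20, z30, z21, z31, z24, z34, z25, z35, zij⟩, e₁, e₂, e₃, by linarith⟩

/-- The block has sign `-ε` because `e^{15} ∧ e^{2346} = -e^{123456}`. -/
lemma entries_of_mem_genEdge_one_five {ε : ℝ} (hε : ε * ε = 1)
    (h : A ∈ genEdge (ε • eForm 1) (eForm 5)) :
    (A 0 1 = 0 ∧ A 1 4 = 0 ∧ A 0 2 = 0 ∧ A 2 4 = 0 ∧ A 0 3 = 0 ∧ A 3 4 = 0 ∧ A 0 5 = 0 ∧ A 4 5 = 0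
        ∧ A 0 4 = ε) ∧
      A 3 5 = -ε * A 1 2 ∧ A 2 5 = -(-ε * A 1 3) ∧ A 2 3 = -ε * A 1 5 ∧
      A 1 2 * A 1 2 + A 1 3 * A 1 3 + A 1 5 * A 1 5 = 1 := by
  have hl := lower_entries h.1.1
  have hr := row_orthonormal h.1.1 h.1.2.1
  have hc := genEdge_apply hε (p := 0) (q := 4) (by decide) h
  have hp := h.1.2.2
  have z01 : A 0 1 = 0 := by
    have h := (hc 1).1
    simpa (decide := true) only [hl, if_false, neg_eq_zero] using h
  have z41 : A 1 4 = 0 := by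
    have h := (hc 1).2
    simpa (decide := true) only [hl, if_false, neg_eq_zero] using h
  have z02 : A 0 2 = 0 := by
    have h := (hc 2).1
    simpa (decide := true) only [hl, if_false, neg_eq_zero] using h
  have z42 : A 2 4 = 0 := by
    have h := (hc 2).2
    simpa (decide := true) only [hl, if_false, neg_eq_zero] using h
  have z03 : A 0 3 = 0 := by
    have h := (hc 3).1
    simpa (decide := true) only [hl, if_false, neg_eq_zero] using h
  have z43 : A 3 4 = 0 := by
    have h := (hc 3).2
    simpa (decide := true) only [hl, if_false, neg_eq_zero] using h
  have z05 : A 0 5 = 0 := by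
    have h := (hc 5).1
    simpa (decide := true) only [hl, if_false, neg_eq_zero] using h
  have z45 : A 4 5 = 0 := by
    have h := (hc 5).2
    simpa (decide := true) only [hl, if_false, neg_eq_zero] using h
  have zij : A 0 4 = ε := by
    have h := (hc 0).2
    simpa (decide := true) only [if_true] using h
  simp only [pfaffian, halfSquare, z01, z41, z02, z42, z03, z43, z05, z45, zij] at hp
  have r11 := hr 1 1
  have r22 := hr 2 2
  have r33 := hr 3 3
  have r55 := hr 5 5
  have r12 := hr 1 2
  have r13 := hr 1 3
  have r15 := hr 1 5
  simp (decide := true) only [hl, Matrix.one_apply, if_true, if_false, z01, z41, z02, z42, z03,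
      z43, z05, z45, zij] at r11 r22 r33 r55 r12 r13 r15
  obtain ⟨e₁, e₂, e₃⟩ := self_dual_of_orthogonal (p := A 1 2) (q := A 1 3) (r := A 1 5)
    (s := A 2 3) (t := A 2 5) (w := A 3 5) (δ := -ε) (by linarith) (by linarith) (by linarith)
    (by linarith) (by linarith) (by linarith) (by linarith) (by linarith) (by linarith)
  refine ⟨⟨z01, z41, z02, z42, z03, z43, z05, z45, zij⟩, e₁, e₂, e₃, by linarith⟩

lemma entries_of_mem_genEdge_five_six {ε : ℝ} (hε : ε * ε = 1)
    (h : A ∈ genEdge (ε • eForm 5) (eForm 6)) :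
    (A 0 4 = 0 ∧ A 0 5 = 0 ∧ A 1 4 = 0 ∧ A 1 5 = 0 ∧ A 2 4 = 0 ∧ A 2 5 = 0 ∧ A 3 4 = 0 ∧ A 3 5 = 0
        ∧ A 4 5 = ε) ∧
      A 2 3 = ε * A 0 1 ∧ A 1 3 = -(ε * A 0 2) ∧ A 1 2 = ε * A 0 3 ∧
      A 0 1 * A 0 1 + A 0 2 * A 0 2 + A 0 3 * A 0 3 = 1 := by
  have hl := lower_entries h.1.1
  have hr := row_orthonormal h.1.1 h.1.2.1
  have hc := genEdge_apply hε (p := 4) (q := 5) (by decide) h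
  have hp := h.1.2.2
  have z40 : A 0 4 = 0 := by
    have h := (hc 0).1
    simpa (decide := true) only [hl, if_false, neg_eq_zero] using h
  have z50 : A 0 5 = 0 := by
    have h := (hc 0).2
    simpa (decide := true) only [hl, if_false, neg_eq_zero] using h
  have z41 : A 1 4 = 0 := by
    have h := (hc 1).1
    simpa (decide := true) only [hl, if_false, neg_eq_zero] using h
  have z51 : A 1 5 = 0 := by
    have h := (hc 1).2
    simpa (decide := true) only [hl, if_false, neg_eq_zero] using h
  have z42 : A 2 4 = 0 := by
    have h := (hc 2).1
    simpa (decide := true) only [hl, if_false, neg_eq_zero] using h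
  have z52 : A 2 5 = 0 := by
    have h := (hc 2).2
    simpa (decide := true) only [hl, if_false, neg_eq_zero] using h
  have z43 : A 3 4 = 0 := by
    have h := (hc 3).1
    simpa (decide := true) only [hl, if_false, neg_eq_zero] using h
  have z53 : A 3 5 = 0 := by
    have h := (hc 3).2
    simpa (decide := true) only [hl, if_false, neg_eq_zero] using h
  have zij : A 4 5 = ε := by
    have h := (hc 4).2
    simpa (decide := true) only [if_true] using h
  simp only [pfaffian, halfSquare, z40, z50, z41, z51, z42, z52, z43, z53, zij] at hp
  have r00 := hr 0 0
  have r11 := hr 1 1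
  have r22 := hr 2 2
  have r33 := hr 3 3
  have r01 := hr 0 1
  have r02 := hr 0 2
  have r03 := hr 0 3
  simp (decide := true) only [hl, Matrix.one_apply, if_true, if_false, z40, z50, z41, z51, z42,
      z52, z43, z53, zij] at r00 r11 r22 r33 r01 r02 r03
  obtain ⟨e₁, e₂, e₃⟩ := self_dual_of_orthogonal (p := A 0 1) (q := A 0 2) (r := A 0 3)
    (s := A 1 2) (t := A 1 3) (w := A 2 3) (δ := ε) (by linarith) (by linarith) (by linarith)
    (by linarith) (by linarith) (by linarith) (by linarith) (by linarith) (by linarith)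
  refine ⟨⟨z40, z50, z41, z51, z42, z52, z43, z53, zij⟩, e₁, e₂, e₃, by linarith⟩

/-- Again the sign is `-ε`, since `e^{26} ∧ e^{1345} = -e^{123456}`. -/
lemma entries_of_mem_genEdge_two_six {ε : ℝ} (hε : ε * ε = 1)
    (h : A ∈ genEdge (ε • eForm 2) (eForm 6)) :
    (A 0 1 = 0 ∧ A 0 5 = 0 ∧ A 1 2 = 0 ∧ A 2 5 = 0 ∧ A 1 3 = 0 ∧ A 3 5 = 0 ∧ A 1 4 = 0 ∧ A 4 5 = 0
        ∧ A 1 5 = ε) ∧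
      A 3 4 = -ε * A 0 2 ∧ A 2 4 = -(-ε * A 0 3) ∧ A 2 3 = -ε * A 0 4 ∧
      A 0 2 * A 0 2 + A 0 3 * A 0 3 + A 0 4 * A 0 4 = 1 := by
  have hl := lower_entries h.1.1
  have hr := row_orthonormal h.1.1 h.1.2.1
  have hc := genEdge_apply hε (p := 1) (q := 5) (by decide) h
  have hp := h.1.2.2
  have z10 : A 0 1 = 0 := by
    have h := (hc 0).1
    simpa (decide := true) only [hl, if_false, neg_eq_zero] using h
  have z50 : A 0 5 = 0 := by
    have h := (hc 0).2
    simpa (decide := true) only [hl, if_false, neg_eq_zero] using h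
  have z12 : A 1 2 = 0 := by
    have h := (hc 2).1
    simpa (decide := true) only [hl, if_false, neg_eq_zero] using h
  have z52 : A 2 5 = 0 := by
    have h := (hc 2).2
    simpa (decide := true) only [hl, if_false, neg_eq_zero] using h
  have z13 : A 1 3 = 0 := by
    have h := (hc 3).1
    simpa (decide := true) only [hl, if_false, neg_eq_zero] using h
  have z53 : A 3 5 = 0 := by
    have h := (hc 3).2
    simpa (decide := true) only [hl, if_false, neg_eq_zero] using h
  have z14 : A 1 4 = 0 := by
    have h := (hc 4).1
    simpa (decide := true) only [hl, if_false, neg_eq_zero] using h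
  have z54 : A 4 5 = 0 := by
    have h := (hc 4).2
    simpa (decide := true) only [hl, if_false, neg_eq_zero] using h
  have zij : A 1 5 = ε := by
    have h := (hc 1).2
    simpa (decide := true) only [if_true] using h
  simp only [pfaffian, halfSquare, z10, z50, z12, z52, z13, z53, z14, z54, zij] at hp
  have r00 := hr 0 0
  have r22 := hr 2 2
  have r33 := hr 3 3
  have r44 := hr 4 4
  have r02 := hr 0 2
  have r03 := hr 0 3
  have r04 := hr 0 4
  simp (decide := true) only [hl, Matrix.one_apply, if_true, if_false, z10, z50, z12, z52, z13,
      z53, z14, z54, zij] at r00 r22 r33 r44 r02 r03 r04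
  obtain ⟨e₁, e₂, e₃⟩ := self_dual_of_orthogonal (p := A 0 2) (q := A 0 3) (r := A 0 4)
    (s := A 2 3) (t := A 2 4) (w := A 3 4) (δ := -ε) (by linarith) (by linarith) (by linarith)
    (by linarith) (by linarith) (by linarith) (by linarith) (by linarith) (by linarith)
  refine ⟨⟨z10, z50, z12, z52, z13, z53, z14, z54, zij⟩, e₁, e₂, e₃, by linarith⟩

-- After substitution only `ε` and three entries on the unit sphere remain; each cyclic sum vanishes
-- modulo `ε² = 1` and the sphere equation.
set_option maxHeartbeats 2000000 in
lemma nijenhuisCoeff_cyclic_of_mem_genEdge_three_four {ε : ℝ} (hε : ε * ε = 1)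
    (h : A ∈ genEdge (ε • eForm 3) (eForm 4)) (i j k : Fin 6) :
    nijenhuisCoeff A k i j + nijenhuisCoeff A i j k + nijenhuisCoeff A j k i = 0 := by
  obtain ⟨⟨z₁, z₂, z₃, z₄, z₅, z₆, z₇, z₈, z₉⟩, h₁, h₂, h₃, hn⟩ :=
    entries_of_mem_genEdge_three_four hε h
  have hl := lower_entries h.1.1
  refine nijenhuisCoeff_cyclic_of_lt h.1.1 (fun i j k hij hjk => ?_) i j k
  have hc : ∀ k < 4, structureForm k = 0 := fun k => structureForm_of_lt
  have c0 := hc 0 (by decide)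
  have c1 := hc 1 (by decide)
  have c2 := hc 2 (by decide)
  have c3 := hc 3 (by decide)
  clear hc h
  fin_cases i <;> fin_cases j <;> first | exact absurd hij (by decide) | skip
  all_goals fin_cases k <;> first | exact absurd hjk (by decide) | skip
  all_goals
    simp only [Fin.zero_eta, Fin.mk_one, Fin.reduceFinMk, nijenhuisCoeff_apply, c0, c1, c2, c3,
      structureForm_four, structureForm_five, Matrix.of_apply, Matrix.cons_val, Matrix.zero_apply,
      hl, z₁, z₂, z₃, z₄, z₅, z₆, z₇, z₈, z₉, h₁, h₂, h₃]
  all_goals clear hl hij hjk c0 c1 c2 c3 z₁ z₂ z₃ z₄ z₅ z₆ z₇ z₈ z₉ h₁ h₂ h₃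
  all_goals grind

set_option maxHeartbeats 2000000 in
lemma nijenhuisCoeff_cyclic_of_mem_genEdge_one_five {ε : ℝ} (hε : ε * ε = 1)
    (h : A ∈ genEdge (ε • eForm 1) (eForm 5)) (i j k : Fin 6) :
    nijenhuisCoeff A k i j + nijenhuisCoeff A i j k + nijenhuisCoeff A j k i = 0 := by
  obtain ⟨⟨z₁, z₂, z₃, z₄, z₅, z₆, z₇, z₈, z₉⟩, h₁, h₂, h₃, hn⟩ :=
    entries_of_mem_genEdge_one_five hε h
  have hl := lower_entries h.1.1
  refine nijenhuisCoeff_cyclic_of_lt h.1.1 (fun i j k hij hjk => ?_) i j k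
  have hc : ∀ k < 4, structureForm k = 0 := fun k => structureForm_of_lt
  have c0 := hc 0 (by decide)
  have c1 := hc 1 (by decide)
  have c2 := hc 2 (by decide)
  have c3 := hc 3 (by decide)
  clear hc h
  fin_cases i <;> fin_cases j <;> first | exact absurd hij (by decide) | skip
  all_goals fin_cases k <;> first | exact absurd hjk (by decide) | skip
  all_goals
    simp only [Fin.zero_eta, Fin.mk_one, Fin.reduceFinMk, nijenhuisCoeff_apply, c0, c1, c2, c3,
      structureForm_four, structureForm_five, Matrix.of_apply, Matrix.cons_val, Matrix.zero_apply,
      hl, z₁, z₂, z₃, z₄, z₅, z₆, z₇, z₈, z₉, h₁, h₂, h₃]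
  all_goals clear hl hij hjk c0 c1 c2 c3 z₁ z₂ z₃ z₄ z₅ z₆ z₇ z₈ z₉ h₁ h₂ h₃
  all_goals grind

end Invariant

/-! ### Inclusions in `𝒵₂₃₄` and `𝒵₁₂₃` -/

section Classes

variable {M : Type*} [TopologicalSpace M] [ChartedSpace E6 M] [IsManifold 𝓘(ℝ, E6) ∞ M]
  [RiemannianBundle (fun x : M => TangentSpace 𝓘(ℝ, E6) x)]
  [IsContMDiffRiemannianBundle 𝓘(ℝ, E6) ∞ E6 (fun x : M => TangentSpace 𝓘(ℝ, E6) x)]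
  {E : Fin 6 → Π x : M, TangentSpace 𝓘(ℝ, E6) x}
  {nabla : CovariantDerivative 𝓘(ℝ, E6) E6 (fun x : M => TangentSpace 𝓘(ℝ, E6) x)}

lemma genEdge_neg_eForm (i : ℕ) (v : Fin 6 → ℝ) :
    genEdge (-eForm i) v = genEdge ((-1 : ℝ) • eForm i) v := by
  rw [neg_one_smul]

lemma genEdge_eForm (i : ℕ) (v : Fin 6 → ℝ) :
    genEdge (eForm i) v = genEdge ((1 : ℝ) • eForm i) v := by
  rw [one_smul]

lemma edges_subset_ghClass_two_three_four (hE : IsInvariantFrame E) (hnabla : IsLeviCivita nabla) :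
    edge₀₂ ∪ edge₁₃ ∪ genEdge (eForm 1) (eForm 5) ∪ genEdge (-eForm 1) (eForm 5)
      ⊆ ghClass E nabla 2 3 4 := by
  have h₁ : (1 : ℝ) * 1 = 1 := by norm_num
  have h₂ : (-1 : ℝ) * -1 = 1 := by norm_num
  rw [edge₀₂, edge₁₃, genEdge_neg_eForm, genEdge_eForm, genEdge_eForm, genEdge_neg_eForm]
  rintro A (((h | h) | h) | h) <;> refine mem_ghClass_two_three_four hE hnabla h.1 ?_
  · exact nijenhuisCoeff_cyclic_of_mem_genEdge_three_four h₁ h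
  · exact nijenhuisCoeff_cyclic_of_mem_genEdge_three_four h₂ h
  · exact nijenhuisCoeff_cyclic_of_mem_genEdge_one_five h₁ h
  · exact nijenhuisCoeff_cyclic_of_mem_genEdge_one_five h₂ h

lemma formInner_eForm₂ {A : Matrix (Fin 6) (Fin 6) ℝ} (hs : Aᵀ = -A) (p q : Fin 6) :
    formInner A (eForm₂ (p + 1) (q + 1)) = A p q := by
  have h : ∀ i j, A i j * eForm₂ (p + 1) (q + 1) i j =
      (if i = p then if j = q then A i j else 0 else 0)
        - if i = q then if j = p then A i j else 0 else 0 := by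
    intro i j
    simp only [eForm₂, wedge, eForm_eq_single, Matrix.of_apply, Pi.single_apply]
    split_ifs <;> ring
  simp only [formInner, h, Finset.sum_sub_distrib]
  simp
  linarith [apply_skew hs p q]

lemma formInner_add (A B C : Matrix (Fin 6) (Fin 6) ℝ) :
    formInner A (B + C) = formInner A B + formInner A C := by
  simp only [formInner, Matrix.add_apply, mul_add, Finset.sum_add_distrib]

lemma formInner_neg (A B : Matrix (Fin 6) (Fin 6) ℝ) :
    formInner A (-B) = -formInner A B := by
  simp only [formInner, Matrix.neg_apply, mul_neg, Finset.sum_neg_distrib]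

lemma formInner_sub (A B C : Matrix (Fin 6) (Fin 6) ℝ) :
    formInner A (B - C) = formInner A B - formInner A C := by
  rw [sub_eq_add_neg, formInner_add, formInner_neg, sub_eq_add_neg]

/-- On `𝔼(±e^{56})` one has `A 0 4 = 0` and `A 2 3 = ±A 0 1`, while the equator imposes `A 2 3 = ∓A
0 1`; both entries vanish. On `𝔼(e^{26})`, `A 0 1 = 0` and the block relation gives `A 2 3 = -A 0
4`. -/
lemma subset_ghClass_one_two_three (hE : IsInvariantFrame E) (hnabla : IsLeviCivita nabla) :
    equator edge₀₃ ω₀ ω₃ ∪ equator edge₁₂ ω₁ ω₂ ∪ genEdge (eForm 2) (eForm 6)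
      ⊆ ghClass E nabla 1 2 3 := by
  have h₁ : (1 : ℝ) * 1 = 1 := by norm_num
  have h₂ : (-1 : ℝ) * -1 = 1 := by norm_num
  rw [edge₀₃, edge₁₂, genEdge_neg_eForm, genEdge_eForm, genEdge_eForm]
  rintro A ((⟨h, he⟩ | ⟨h, he⟩) | h)
  · have hi := formInner_eForm₂ h.1.1
    obtain ⟨⟨z₁, z₂, z₃, z₄, z₅, z₆, z₇, z₈, z₉⟩, e₁, e₂, e₃, hn⟩ :=
      entries_of_mem_genEdge_five_six h₁ h
    have h12 : formInner A (eForm₂ 1 2) = A 0 1 := hi 0 1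
    have h34 : formInner A (eForm₂ 3 4) = A 2 3 := hi 2 3
    simp only [ω₀, ω₃, formInner_add, formInner_sub, formInner_neg, h12, h34] at he
    exact mem_ghClass_one_two_three hE hnabla h.1 (by linarith) (by linarith)
  · have hi := formInner_eForm₂ h.1.1
    obtain ⟨⟨z₁, z₂, z₃, z₄, z₅, z₆, z₇, z₈, z₉⟩, e₁, e₂, e₃, hn⟩ :=
      entries_of_mem_genEdge_five_six h₂ h
    have h12 : formInner A (eForm₂ 1 2) = A 0 1 := hi 0 1
    have h34 : formInner A (eForm₂ 3 4) = A 2 3 := hi 2 3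
    simp only [ω₁, ω₂, formInner_add, formInner_sub, formInner_neg, h12, h34] at he
    exact mem_ghClass_one_two_three hE hnabla h.1 (by linarith) (by linarith)
  · obtain ⟨⟨z₁, z₂, z₃, z₄, z₅, z₆, z₇, z₈, z₉⟩, e₁, e₂, e₃, hn⟩ :=
      entries_of_mem_genEdge_two_six h₁ h
    exact mem_ghClass_one_two_three hE hnabla h.1 (by linarith) (by linarith)

end Classes

/-! ### Membership of `ϖ₁` and `ϖ₂` by integer computation -/

section SignedPermutation

/-- Integer structure constants: `structureForm k i j` as an integer. -/
def structureInt (k i j : Fin 6) : ℤ :=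
  if k = 4 then (if i = 0 ∧ j = 1 then 1 else if i = 1 ∧ j = 0 then -1 else 0)
  else if k = 5 then
    (if i = 0 ∧ j = 4 ∨ i = 2 ∧ j = 3 then 1 else if i = 4 ∧ j = 0 ∨ i = 3 ∧ j = 2 then -1 else 0)
  else 0

/-- Twice the Christoffel symbols. -/
def christoffelInt (i j k : Fin 6) : ℤ :=
  structureInt i j k - structureInt k i j - structureInt j k i

/-- Twice the coefficients of `∇ω` for the signed permutation matrix of `σ` and `ε`. -/
def nablaInt (σ : Fin 6 → Fin 6) (ε : Fin 6 → ℤ) (i j k : Fin 6) : ℤ :=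
  ε j * christoffelInt i (σ j) k + ε k * christoffelInt i j (σ k)

lemma structureForm_eq_intCast (k i j : Fin 6) : structureForm k i j = structureInt k i j := by
  by_cases hk : k < 4
  · rw [structureForm_of_lt hk, structureInt, if_neg (by omega), if_neg (by omega)]
    simp
  · obtain rfl | rfl : k = 4 ∨ k = 5 := by omega
    · rw [structureForm_four]
      fin_cases i <;> fin_cases j <;> simp [structureInt]
    · rw [structureForm_five]
      fin_cases i <;> fin_cases j <;> simp [structureInt]

lemma christoffel_eq_intCast (i j k : Fin 6) :
    christoffel i j k = (christoffelInt i j k : ℝ) / 2 := by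
  simp only [christoffel, Matrix.of_apply, structureForm_eq_intCast, christoffelInt]
  push_cast
  rfl

variable {A : Matrix (Fin 6) (Fin 6) ℝ} {σ : Fin 6 → Fin 6} {ε : Fin 6 → ℤ}

lemma nablaCoeff_eq_intCast (hs : Aᵀ = -A) (hA : ∀ i j, A i j = if j = σ i then (ε i : ℝ) else 0)
    (i j k : Fin 6) : nablaCoeff A i j k = (nablaInt σ ε i j k : ℝ) / 2 := by
  have h : ∀ m, christoffel i j m * A m k = -(A k m * christoffel i j m) := by
    intro m
    rw [apply_skew hs m k]
    ring
  simp only [nablaCoeff, Matrix.sub_apply, Matrix.mul_apply, h]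
  simp only [hA, ite_mul, zero_mul,
    Finset.sum_neg_distrib, Finset.sum_ite_eq', Finset.mem_univ, if_true, christoffel_eq_intCast,
    nablaInt]
  push_cast
  ring

variable {M : Type*} [TopologicalSpace M] [ChartedSpace E6 M] [IsManifold 𝓘(ℝ, E6) ∞ M]
  [RiemannianBundle (fun x : M => TangentSpace 𝓘(ℝ, E6) x)]
  [IsContMDiffRiemannianBundle 𝓘(ℝ, E6) ∞ E6 (fun x : M => TangentSpace 𝓘(ℝ, E6) x)]
  {E : Fin 6 → Π x : M, TangentSpace 𝓘(ℝ, E6) x}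
  {nabla : CovariantDerivative 𝓘(ℝ, E6) E6 (fun x : M => TangentSpace 𝓘(ℝ, E6) x)}

/-- Each row of `A` has one nonzero entry, so sums against `A` collapse to single terms. The
condition is linear in `∇ω`, so doubling clears the denominators and leaves a decidable integer
identity. -/
lemma mem_ghClass_one_two_four_of_int (hE : IsInvariantFrame E) (hnabla : IsLeviCivita nabla)
    (hZ : A ∈ Z) (hA : ∀ i j, A i j = if j = σ i then (ε i : ℝ) else 0)
    (h : ∀ i j k, 2 * (nablaInt σ ε i j k + ε i * (ε j * nablaInt σ ε (σ i) (σ j) k)) =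
      (if i = j then 1 else 0) * ∑ l, nablaInt σ ε l l k
      - (if i = k then 1 else 0) * ∑ l, nablaInt σ ε l l j
      - (if i = σ j then ε j else 0) * (ε k * ∑ l, nablaInt σ ε l l (σ k))
      + (if i = σ k then ε k else 0) * (ε j * ∑ l, nablaInt σ ε l l (σ j))) :
    A ∈ ghClass E nabla 1 2 4 := by
  refine mem_ghClass_one_two_four hE hnabla hZ fun i j k => ?_
  have hsum : ∑ p, ∑ q, A i p * A j q * nablaCoeff A p q k =
      ε i * (ε j * nablaCoeff A (σ i) (σ j) k) := by
    simp only [hA, ite_mul, zero_mul, mul_assoc, mul_ite, mul_zero, Finset.sum_ite_eq',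
      Finset.mem_univ, if_true]
  rw [hsum]
  have h := congrArg (Int.cast : ℤ → ℝ) (h i j k)
  push_cast at h
  simp only [nablaCoeff_eq_intCast hZ.1 hA, hA, ite_mul, zero_mul, Finset.sum_ite_eq',
    Finset.mem_univ, if_true, ← Finset.sum_div, Matrix.one_apply] at h ⊢
  split_ifs at h ⊢ <;> linarith

lemma varpi₁_apply (i j : Fin 6) : varpi₁ i j =
    if j = ![4, 5, 3, 2, 0, 1] i then ((![-1, -1, -1, 1, 1, 1] : Fin 6 → ℤ) i : ℝ) else 0 := by
  fin_cases i <;> fin_cases j <;> simp [varpi₁, eForm₂, wedge, eForm]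

lemma varpi₂_apply (i j : Fin 6) : varpi₂ i j =
    if j = ![4, 5, 3, 2, 0, 1] i then ((![1, -1, 1, -1, -1, 1] : Fin 6 → ℤ) i : ℝ) else 0 := by
  fin_cases i <;> fin_cases j <;> simp [varpi₂, eForm₂, wedge, eForm]

lemma mem_Z_of_signedPermutation (hA : ∀ i j, A i j = if j = σ i then (ε i : ℝ) else 0)
    (h₁ : ∀ i j, (if i = σ j then ε j else 0) = -if j = σ i then ε i else 0)
    (h₂ : ∀ i j, (if j = σ (σ i) then ε i * ε (σ i) else 0) = -if i = j then 1 else 0)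
    (hp : 0 < pfaffian A) : A ∈ Z := by
  have hs : Aᵀ = -A := by
    ext i j
    rw [Matrix.transpose_apply, Matrix.neg_apply, hA, hA]
    exact_mod_cast h₁ i j
  refine ⟨hs, ?_, hp⟩
  ext i j
  rw [Matrix.mul_apply, Matrix.neg_apply, Matrix.one_apply]
  simp only [hA i, ite_mul, zero_mul, Finset.sum_ite_eq', Finset.mem_univ, if_true]
  rw [hA]
  simp only [mul_ite, mul_zero]
  exact_mod_cast h₂ i j

lemma varpi₁_mem_Z : varpi₁ ∈ Z := by
  refine mem_Z_of_signedPermutation varpi₁_apply (by decide) (by decide) ?_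
  simp [pfaffian, halfSquare, varpi₁_apply]

lemma varpi₂_mem_Z : varpi₂ ∈ Z := by
  refine mem_Z_of_signedPermutation varpi₂_apply (by decide) (by decide) ?_
  simp [pfaffian, halfSquare, varpi₂_apply]

lemma varpi₁_mem_ghClass (hE : IsInvariantFrame E) (hnabla : IsLeviCivita nabla) :
    varpi₁ ∈ ghClass E nabla 1 2 4 :=
  mem_ghClass_one_two_four_of_int hE hnabla varpi₁_mem_Z varpi₁_apply (by decide +kernel)

lemma varpi₂_mem_ghClass (hE : IsInvariantFrame E) (hnabla : IsLeviCivita nabla) :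
    varpi₂ ∈ ghClass E nabla 1 2 4 :=
  mem_ghClass_one_two_four_of_int hE hnabla varpi₂_mem_Z varpi₂_apply (by decide +kernel)

lemma varpi₁_mem_equator : varpi₁ ∈ equator edge₁₃ ω₁ ω₃ := by
  refine ⟨⟨varpi₁_mem_Z, ?_, ?_⟩, ?_⟩
  · ext k
    fin_cases k <;> simp [Matrix.mulVec, dotProduct, Fin.sum_univ_six, wedge, eForm, varpi₁_apply]
  · ext k
    fin_cases k <;> simp [Matrix.mulVec, dotProduct, Fin.sum_univ_six, wedge, eForm, varpi₁_apply]
  · have hi := formInner_eForm₂ varpi₁_mem_Z.1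
    have h12 : formInner varpi₁ (eForm₂ 1 2) = varpi₁ 0 1 := hi 0 1
    have h56 : formInner varpi₁ (eForm₂ 5 6) = varpi₁ 4 5 := hi 4 5
    simp [ω₁, ω₃, formInner_add, formInner_sub, formInner_neg, h12, h56, varpi₁_apply]

lemma varpi₂_mem_equator : varpi₂ ∈ equator edge₀₂ ω₀ ω₂ := by
  refine ⟨⟨varpi₂_mem_Z, ?_, ?_⟩, ?_⟩
  · ext k
    fin_cases k <;> simp [Matrix.mulVec, dotProduct, Fin.sum_univ_six, wedge, eForm, varpi₂_apply]
  · ext k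
    fin_cases k <;> simp [Matrix.mulVec, dotProduct, Fin.sum_univ_six, wedge, eForm, varpi₂_apply]
  · have hi := formInner_eForm₂ varpi₂_mem_Z.1
    have h12 : formInner varpi₂ (eForm₂ 1 2) = varpi₂ 0 1 := hi 0 1
    have h56 : formInner varpi₂ (eForm₂ 5 6) = varpi₂ 4 5 := hi 4 5
    simp [ω₀, ω₂, formInner_add, formInner_sub, formInner_neg, h12, h56, varpi₂_apply]

end SignedPermutation

end GrayHervella

theorem theorem3 {M : Type*} [TopologicalSpace M] [ChartedSpace E6 M]
    [IsManifold 𝓘(ℝ, E6) ∞ M] [Nonempty M]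
    [RiemannianBundle (fun x : M => TangentSpace 𝓘(ℝ, E6) x)]
    [IsContMDiffRiemannianBundle 𝓘(ℝ, E6) ∞ E6 (fun x : M => TangentSpace 𝓘(ℝ, E6) x)]
    (E : Fin 6 → Π x : M, TangentSpace 𝓘(ℝ, E6) x) (hE : IsInvariantFrame E)
    (nabla : CovariantDerivative 𝓘(ℝ, E6) E6 (fun x : M => TangentSpace 𝓘(ℝ, E6) x))
    (hnabla : IsLeviCivita nabla) :
    edge₀₂ ∪ edge₁₃ ∪ genEdge (eForm 1) (eForm 5) ∪ genEdge (-eForm 1) (eForm 5)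
        ⊆ ghClass E nabla 2 3 4 ∧
      ghClass E nabla 1 3 4 = ∅ ∧
      ghClass E nabla 1 2 4 = {varpi₁, varpi₂} ∧
      equator edge₀₃ ω₀ ω₃ ∪ equator edge₁₂ ω₁ ω₂ ∪ genEdge (eForm 2) (eForm 6)
        ⊆ ghClass E nabla 1 2 3 ∧
      varpi₁ ∈ equator edge₁₃ ω₁ ω₃ ∧
      varpi₂ ∈ equator edge₀₂ ω₀ ω₂ := by
  refine ⟨edges_subset_ghClass_two_three_four hE hnabla, ?_, ?_,
    subset_ghClass_one_two_three hE hnabla, varpi₁_mem_equator, varpi₂_mem_equator⟩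
  · refine Set.eq_empty_iff_forall_notMem.2 fun A h => ?_
    exact not_nijenhuisCoeff_skew h.1.1 h.1.2.1 (nijenhuisCoeff_skew_of_mem hE hnabla h)
  · ext A
    rw [Set.mem_insert_iff, Set.mem_singleton_iff]
    constructor
    · intro h
      obtain ⟨t, ht⟩ := exists_lee_form_of_mem hE hnabla h
      -- Here `s` is by definition the sum `∑ q, A i q * t q`, the Lee form evaluated on `J Eᵢ`.
      exact eq_varpi_of_lee_form h.1.1 h.1.2.1 h.1.2.2 (fun _ => rfl) ht
    · rintro (rfl | rfl)
      · exact varpi₁_mem_ghClass hE hnabla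
      · exact varpi₂_mem_ghClass hE hnabla
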